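/- **Conventions.** A diagram is a finite set of cells $(c,r)$ (column $c\ge 1$ counted from the left, row $r\ge 1$ counted from the bottom). A weak composition $\beta=(\beta_1,\beta_2,\ldots)$ is a finitely supported sequence of nonnegative integers; its composition diagram has $\beta_r$ left-justified cells in row $r$. A Kohnert move takes the rightmost cell of a row and moves it down within its column to the first vacant position below, if there is one; $\mathrm{KD}(\beta)$ is the set of diagrams obtained from the composition diagram of $\beta$ by sequences of Kohnert moves. Write $\alpha\preceq\beta$ if $\alpha$ is obtained from $\beta$ by successively exchanging parts $\beta_r<\beta_s$ with $r<s$, and $\alpha\preceq^0\beta$ if only exchanges with $0<\beta_r<\beta_s$, $r<s$, are used. *Thread weight.* The threads of $T\in\mathrm{KD}(\beta)$ are built as follows: start a new thread at the rightmost, then lowest, unthreaded cell; after a cell in column $c+1$ continue with the lowest unthreaded cell of column $c$ weakly above it, until column $1$ is reached or no such cell exists; repeat until all cells are threaded. For $T\in\mathrm{KD}(\beta)$ all threads end in column $1$, and $\theta(T)_r$ is the number of cells of the thread ending in column $1$, row $r$. *Labelings.* A semi-proper labeling of $T$ of shape $\alpha$ assigns positive integers to the cells such that the entries of column $c$ are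 distinct and form the set $\{i\mid\alpha_i\ge c\}$, each entry in row $r$ is at least $r$, and cells with equal entries weakly descend from left to right. A position $x\notin T$ in column $c+1$ abuts $i$ if the label $i$ in column $c$ lies weakly above $x$ and either $\alpha_i=c$ or the label $i$ in column $c+1$ lies strictly below $x$ (for $c=0$, each $i\ge1$ is regarded as lying in row $i$ of column $0$). *Rectification.* For $x\notin T$ weakly below row $k$, define $\mathfrak{Rect}^{(k)}_\alpha(T,x)$ recursively: (1) if for some semi-proper labeling of $T$ of some shape $\alpha'\preceq^0\alpha$ the position $x$, in column $c+1$, abuts some $i\le k$ with $\alpha'_i=c$, return $T\cup\{x\}$; (2) else, if in some semi-proper labeling of $T$ of some shape $\alpha'\preceq^0\alpha$ the position $x$ abuts some $i\le k$, return $\mathfrak{Rect}^{(k)}_\alpha(T\cup\{x\}\setminus\{y\},y)$, where $y$ is the lowest cell in the column of $x$ for which some such labeling has $x$ abut the label $i\le k$ of $y$; (3) else return $\mathfrak{Rect}^{(k)}_\alpha(T,y)$, where $y$ is the rightmost vacant position left of $x$ in its row. *Restricted insertion.* For $T\in\mathrm{KD}(\beta)$ and $1\le r\le k$, set $$T\xleftarrow{\beta,k}r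 \;=\; \mathfrak{Rect}^{(k)}_\alpha\bigl(T,(\max_i\beta_i+1,\;r)\bigr),$$ where $\alpha$ is the maximal composition (for $\preceq^0$) with $\theta(T)\preceq^0\alpha\preceq\beta$. **Theorem.** Let $\beta$ be a weak composition and $k$ an integer. If $(S\xleftarrow{\beta,k}s)=(T\xleftarrow{\beta,k}t)$ for some $S,T\in\mathrm{KD}(\beta)$ and some integers $1\le s,t\le k$, then $S=T$ and $s=t$. -/

import Mathlib

namespace Kohnert

/-- A cell `(c, r)` lies in column `c` and row `r`. Columns are numbered from left to right and
rows from bottom to top, both starting with `1`. -/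
abbrev Cell := ℕ × ℕ

/-- A diagram is a finite set of cells. -/
abbrev Diagram := Finset Cell

/-- A weak composition `(α 1, α 2, …)`, with trailing zeros ignored. The value at `0` plays no
role; it is required to be `0` for the compositions the theorem is about. -/
abbrev Comp := ℕ →₀ ℕ

/-! ### Kohnert diagrams -/

/-- The composition diagram of `α`: row `r` holds `α r` left-justified cells. -/
def compDiagram (α : Comp) : Diagram :=
  α.support.biUnion fun r => (Finset.Icc 1 (α r)).image fun c => (c, r)

/-- `U` results from `T` by one Kohnert move: the rightmost cell `(c, r)` of row `r` moves down
within column `c` to the first vacant position `(c, q)` below it. -/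
def KohnertMove (T U : Diagram) : Prop :=
  ∃ c r q : ℕ, (c, r) ∈ T ∧ (∀ c', c < c' → (c', r) ∉ T) ∧
    1 ≤ q ∧ q < r ∧ (c, q) ∉ T ∧ (∀ p, q < p → p < r → (c, p) ∈ T) ∧
    U = insert (c, q) (T.erase (c, r))

/-- The set of Kohnert diagrams of `β`: all diagrams reachable from the composition diagram of `β`
by a (possibly empty) sequence of Kohnert moves. -/
def KD (β : Comp) : Set Diagram :=
  {T | Relation.ReflTransGen KohnertMove (compDiagram β) T}

/-! ### Left swaps -/

/-- `α` results from `β` by one left swap: two parts `β r < β s` with `r < s` are exchanged. -/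
def LeftSwap (β α : Comp) : Prop :=
  ∃ r s : ℕ, 1 ≤ r ∧ r < s ∧ β r < β s ∧ α = β.equivMapDomain (Equiv.swap r s)

/-- `α` results from `β` by one pinned left swap: the exchanged parts are nonzero. -/
def PinnedLeftSwap (β α : Comp) : Prop :=
  ∃ r s : ℕ, 1 ≤ r ∧ r < s ∧ 0 < β r ∧ β r < β s ∧ α = β.equivMapDomain (Equiv.swap r s)

/-- `α ⪯ β`: `α` results from `β` by some sequence of left swaps. -/
def SwapLE (α β : Comp) : Prop := Relation.ReflTransGen LeftSwap β α

/-- `α ⪯⁰ β`: `α` results from `β` by some sequence of pinned left swaps. -/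
def PinnedLE (α β : Comp) : Prop := Relation.ReflTransGen PinnedLeftSwap β α

/-! ### Threads -/

/-- The rows of the cells of `U` in column `c` that are weakly above row `r`. -/
def rowsAbove (U : Diagram) (c r : ℕ) : Finset ℕ :=
  (U.filter fun y => y.1 = c ∧ r ≤ y.2).image Prod.snd

/-- The thread through the set `U` of unthreaded cells that begins at the cell `(c, r)`. After a
cell in column `c + 1`, it continues with the lowest unthreaded cell of column `c` weakly
above it, and it stops if there is none (in particular after column `1`). -/
def threadFrom (U : Diagram) : ℕ → ℕ → Diagram
  | 0, r => {(0, r)}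
  | c + 1, r => insert (c + 1, r)
      (if h : (rowsAbove U c r).Nonempty then threadFrom U c ((rowsAbove U c r).min' h) else ∅)

theorem mem_threadFrom (U : Diagram) (c r : ℕ) : (c, r) ∈ threadFrom U c r := by
  cases c <;> simp [threadFrom]

theorem rowsAbove_sup_nonempty {U : Diagram} (h : U.Nonempty) :
    (rowsAbove U (U.sup Prod.fst) 0).Nonempty := by
  obtain ⟨x, hx, hs⟩ := Finset.exists_mem_eq_sup U h Prod.fst
  exact ⟨x.2, by simp only [rowsAbove, Finset.mem_image, Finset.mem_filter]
                 exact ⟨x, ⟨hx, hs.symm, Nat.zero_le _⟩, rfl⟩⟩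

/-- The thread decomposition: each new thread begins with the rightmost, then lowest, unthreaded
cell. -/
def threads (U : Diagram) : List Diagram :=
  if h : U.Nonempty then
    threadFrom U (U.sup Prod.fst) ((rowsAbove U (U.sup Prod.fst) 0).min' (rowsAbove_sup_nonempty h))
      :: threads (U \ threadFrom U (U.sup Prod.fst)
          ((rowsAbove U (U.sup Prod.fst) 0).min' (rowsAbove_sup_nonempty h)))
  else []
termination_by U.card
decreasing_by
  apply Finset.card_lt_card
  rw [Finset.ssubset_iff_of_subset Finset.sdiff_subset]
  have hm := Finset.min'_mem _ (rowsAbove_sup_nonempty h)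
  have hx : (U.sup Prod.fst,
      (rowsAbove U (U.sup Prod.fst) 0).min' (rowsAbove_sup_nonempty h)) ∈ U := by
    generalize (rowsAbove U (U.sup Prod.fst) 0).min' (rowsAbove_sup_nonempty h) = m at hm ⊢
    simp only [rowsAbove, Finset.mem_image, Finset.mem_filter] at hm
    obtain ⟨y, ⟨hy, h1, -⟩, h2⟩ := hm
    rw [← h1, ← h2]
    exact hy
  exact ⟨_, hx, fun hc => (Finset.mem_sdiff.mp hc).2 (mem_threadFrom _ _ _)⟩

/-- The thread weight `θ(T)`: its `r`-th part is the number of cells in the thread that ends in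
column `1`, row `r`. -/
noncomputable def threadWeight (T : Diagram) : Comp :=
  ((threads T).map fun t => ∑ x ∈ t with x.1 = 1, Finsupp.single x.2 t.card).sum

/-! ### Labelings -/

/-- `L` (whose values outside `T` are irrelevant) is a semi-proper labeling of `T` of shape `α`. -/
structure IsSemiProper (α : Comp) (T : Diagram) (L : Cell → ℕ) : Prop where
  /-- The entries of column `c` are distinct and form the set `{i | α i ≥ c}`. -/
  strict : ∀ c, 1 ≤ c → Set.BijOn (fun r => L (c, r)) {r | (c, r) ∈ T} {i | 1 ≤ i ∧ c ≤ α i}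
  /-- Each entry in row `r` is at least `r`. -/
  flagged : ∀ x ∈ T, x.2 ≤ L x
  /-- Cells with equal entries weakly descend from left to right. -/
  descending : ∀ x ∈ T, ∀ y ∈ T, L x = L y → x.1 < y.1 → y.2 ≤ x.2

/-- The label `i` occurs in column `c`, row `p`. In the virtual column `0`, each label `i ≥ 1`
occurs exactly once, in its own row `i`. -/
def LabelAt (T : Diagram) (L : Cell → ℕ) (c i p : ℕ) : Prop :=
  ((c, p) ∈ T ∧ L (c, p) = i) ∨ (c = 0 ∧ 1 ≤ i ∧ p = i)

/-- The position `x` in column `c + 1` abuts the label `i`, for the labeling `L` of `T` of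
shape `α`: label `i` in column `c` lies weakly above `x`, and either `α i = c` or label `i` in
column `c + 1` lies strictly below `x`. Here `c = x.1 - 1`, with `x.1 ≥ 1`. -/
def Abuts (α : Comp) (T : Diagram) (L : Cell → ℕ) (x : Cell) (i : ℕ) : Prop :=
  (∃ p, x.2 ≤ p ∧ LabelAt T L (x.1 - 1) i p) ∧
    (α i = x.1 - 1 ∨ ∃ p, p < x.2 ∧ LabelAt T L x.1 i p)

/-! ### Restricted rectification and insertion -/

/-- The landing condition: for some semi-proper labeling of `T` of shape `α' ⪯⁰ α`, the position
`x` abuts the rightmost occurrence of some label `i ≤ k`. -/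
def Lands (k : ℕ) (α : Comp) (T : Diagram) (x : Cell) : Prop :=
  ∃ (α' : Comp) (L : Cell → ℕ) (i : ℕ), PinnedLE α' α ∧ IsSemiProper α' T L ∧ i ≤ k ∧
    Abuts α' T L x i ∧ α' i = x.1 - 1

/-- The rows of the cells `y` in the column of `x` for which some semi-proper labeling of `T` of
shape `α' ⪯⁰ α` has `x` abut a label `i ≤ k` that is the label of `y`. If `x` does not
land, then such a cell exists as soon as `x` abuts some `i ≤ k` in such a labeling, and it
always lies below `x`. -/
def bumpRows (k : ℕ) (α : Comp) (T : Diagram) (x : Cell) : Set ℕ :=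
  {p | p < x.2 ∧ (x.1, p) ∈ T ∧ ∃ (α' : Comp) (L : Cell → ℕ) (i : ℕ),
    PinnedLE α' α ∧ IsSemiProper α' T L ∧ i ≤ k ∧ Abuts α' T L x i ∧ L (x.1, p) = i}

/-- The columns of the vacant positions left of `x` in its row. -/
def vacantLeft (T : Diagram) (x : Cell) : Finset ℕ :=
  (Finset.Ico 1 x.1).filter fun d => (d, x.2) ∉ T

open Classical in
/-- The rectification of `T` labeled by `α` with `x` restricted by `k`: land, else bump the
lowest possible cell, else pass to the rightmost vacant position left of `x`. (If there were no such
position, rectification would be undefined; the value is then `T` by convention.) -/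
noncomputable def rect (k : ℕ) (α : Comp) (T : Diagram) (x : Cell) : Diagram :=
  if Lands k α T x then insert x T
  else if hb : (bumpRows k α T x).Nonempty then
    rect k α ((insert x T).erase (x.1, sInf (bumpRows k α T x))) (x.1, sInf (bumpRows k α T x))
  else if hv : (vacantLeft T x).Nonempty then
    rect k α T ((vacantLeft T x).max' hv, x.2)
  else T
termination_by x.1 + x.2
decreasing_by
  · have := (Nat.sInf_mem hb).1
    omega
  · have := Finset.max'_mem _ hv
    generalize (vacantLeft T x).max' hv = m at this ⊢
    simp only [vacantLeft, Finset.mem_filter, Finset.mem_Ico] at this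
    omega

/-- `α` is maximal with `θ(T) ⪯⁰ α ⪯ β`. -/
def IsInsertionLabel (β : Comp) (T : Diagram) (α : Comp) : Prop :=
  PinnedLE (threadWeight T) α ∧ SwapLE α β ∧
    ∀ γ, PinnedLE (threadWeight T) γ → SwapLE γ β → PinnedLE α γ → γ = α

open Classical in
/-- The maximal `α` with `θ(T) ⪯⁰ α ⪯ β`; for `T ∈ KD β` it exists and is unique. -/
noncomputable def insertionLabel (β : Comp) (T : Diagram) : Comp :=
  if h : ∃ α, IsInsertionLabel β T α then h.choose else β

/-- The insertion of `r` restricted by `k` into `T` labeled by `β`: rectify `T`, labeled by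
the maximal `α` with `θ(T) ⪯⁰ α ⪯ β`, with the position in row `r` and column
`max β + 1`. -/
noncomputable def insertion (β : Comp) (k : ℕ) (T : Diagram) (r : ℕ) : Diagram :=
  rect k (insertionLabel β T) T (β.support.sup β + 1, r)

end Kohnert

/-!
The idea is to run the rectification backwards. All that the rectification rules see of the
compositions `⪯ β` is a family of lower bounds: a path labeling of the columns of a diagram, with
weakly descending paths that start in a virtual column `0`, is *good* if for all `c` and `m` at
least as many labels `≤ m` occur in column `c` as `β` has parts `≥ c` among its first `m` parts
(`IsGood`). By the tableau criterion for left swaps (`Dominated.swapLE`), the shapes of good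
labelings are `⪯ β` if the columns have the sizes of those of `β`. Labeling every path by its row
in column `1` makes the support of the shape equal to column `1`. Among the compositions `⪯ β`
with this support there is a largest one for `⪯⁰` (`Dominated.exists_maximum`), and the thread
weight is one of them (`Admissible.threadWeight`), so that the maximal `α` of the definition of
the insertion is that largest one (`insertionLabel_spec`). Hence "some semi-proper labeling of
shape `⪯⁰ α`" may be replaced by "some good labeling" throughout, and rectification becomes a
`Run` (`IsTop.run`). Kohnert moves preserve the existence of good labelings
(`IsGood.exists_of_kohnert`), which gives one for each diagram in `KD β`.

A run does not make use of `α`, and it can be reversed. A position that lands or leaves a column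
to the left has, together with the current diagram, a union that does not change by bumps within
the column. So it remains to recover the position at which the run entered the column. Unless the
run starts there, the entering position `x` is one that the column to its right could not use: no
good labeling has the position right of `x` abut a label `≤ k`, even if cells of the row had to be
passed (`Reach.of_filled`). Suppose that two positions `x` and `y` are possible, `y` being higher.
Then the run that enters at `y` cannot get past `x` (`Bumps.lt_of_not_reach`): it would contradict
`reach_of_exchange`, by which a label `≤ k` available at a bump or landing across the row of `x`
gives a label `≤ k` that the position right of `x` abuts. That lemma is the heart of the matter.
It cuts up a labeling that is good for one diagram, and completes its part above `x` to a good
labeling of the other diagram, by uncrossing paths (`PathLabeling.exists_uncross`) and by filling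
columns greedily from top to bottom (`exists_greedy_labels`, `PathLabeling.exists_extension`).
-/

namespace Kohnert

/-! ### Matching the labels of two adjacent columns -/

/-- The number of cells in rows `≥ r` of the column `A` whose label under `f` is at most `m`. -/
def lowCount (A : Finset ℕ) (f : ℕ → ℕ) (m r : ℕ) : ℕ :=
  (A.filter fun p => r ≤ p ∧ f p ≤ m).card

/-- The number of cells of the column `A` in the rows `r ≤ p < s`. -/
def rowCount (A : Finset ℕ) (r s : ℕ) : ℕ :=
  (A.filter fun p => r ≤ p ∧ p < s).card

/-- Every cell of the column `B` finds its label in the column `A` to its left, in a weakly higher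
row. -/
def Links (A : Finset ℕ) (f : ℕ → ℕ) (B : Finset ℕ) (g : ℕ → ℕ) : Prop :=
  ∀ p ∈ B, ∃ q ∈ A, p ≤ q ∧ f q = g p

theorem lowCount_congr {A : Finset ℕ} {f g : ℕ → ℕ} {r : ℕ} (m : ℕ)
    (h : ∀ p ∈ A, r ≤ p → f p = g p) : lowCount A f m r = lowCount A g m r := by
  unfold lowCount
  congr 1
  apply Finset.filter_congr
  intro p hp
  constructor <;> rintro ⟨h1, h2⟩ <;> refine ⟨h1, ?_⟩
  · rwa [← h p hp h1]
  · rwa [h p hp h1]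

theorem lowCount_split (A : Finset ℕ) (f : ℕ → ℕ) (m r s : ℕ) :
    lowCount A f m r ≤ rowCount A r s + lowCount A f m s := by
  unfold lowCount rowCount
  refine le_trans (Finset.card_le_card ?_) (Finset.card_union_le _ _)
  intro p
  simp only [Finset.mem_union, Finset.mem_filter]
  rintro ⟨h1, h2, h3⟩
  rcases lt_or_ge p s with h4 | h4
  · exact Or.inl ⟨h1, h2, h4⟩
  · exact Or.inr ⟨h1, h4, h3⟩

theorem rowCount_add (A : Finset ℕ) {r s t : ℕ} (h : r ≤ s) (h' : s ≤ t) :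
    rowCount A r t = rowCount A r s + rowCount A s t := by
  unfold rowCount
  rw [← Finset.card_union_of_disjoint]
  · congr 1
    ext p
    simp only [Finset.mem_union, Finset.mem_filter]
    constructor
    · rintro ⟨h1, h2, h3⟩
      rcases lt_or_ge p s with h4 | h4
      · exact Or.inl ⟨h1, h2, h4⟩
      · exact Or.inr ⟨h1, h4, h3⟩
    · rintro (⟨h1, h2, h3⟩ | ⟨h1, h2, h3⟩)
      · exact ⟨h1, h2, by omega⟩
      · exact ⟨h1, by omega, h3⟩
  · rw [Finset.disjoint_left]
    simp only [Finset.mem_filter]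
    rintro p ⟨_, _, h1⟩ ⟨_, h2, _⟩
    omega

theorem rowCount_congr {A B : Finset ℕ} {r s : ℕ}
    (h : ∀ p, r ≤ p → p < s → (p ∈ A ↔ p ∈ B)) : rowCount A r s = rowCount B r s := by
  unfold rowCount
  congr 1
  ext p
  simp only [Finset.mem_filter]
  constructor <;> rintro ⟨h1, h2, h3⟩
  · exact ⟨(h p h2 h3).1 h1, h2, h3⟩
  · exact ⟨(h p h2 h3).2 h1, h2, h3⟩

theorem rowCount_le_one (A : Finset ℕ) (r : ℕ) : rowCount A r (r + 1) ≤ 1 := by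
  refine le_trans (Finset.card_le_card (t := {r}) ?_) (by simp)
  intro p
  simp only [Finset.mem_filter, Finset.mem_singleton]
  omega

theorem rowCount_eq_zero {A : Finset ℕ} {r : ℕ} (h : r ∉ A) : rowCount A r (r + 1) = 0 := by
  unfold rowCount
  rw [Finset.card_eq_zero, Finset.filter_eq_empty_iff]
  intro p hp
  have : p ≠ r := fun h' => h (h' ▸ hp)
  omega

theorem rowCount_eq_one {A : Finset ℕ} {r : ℕ} (h : r ∈ A) : rowCount A r (r + 1) = 1 := by
  apply le_antisymm (rowCount_le_one _ _)
  unfold rowCount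
  rw [Nat.one_le_iff_ne_zero, Finset.card_ne_zero]
  exact ⟨r, by simp [h]⟩

theorem lowCount_mono_row (A : Finset ℕ) (f : ℕ → ℕ) (m : ℕ) {r s : ℕ} (h : r ≤ s) :
    lowCount A f m s ≤ lowCount A f m r := by
  apply Finset.card_le_card
  intro p
  simp only [Finset.mem_filter]
  rintro ⟨h1, h2, h3⟩
  exact ⟨h1, h.trans h2, h3⟩

theorem Links.lowCount_le {A B : Finset ℕ} {f g : ℕ → ℕ} (h : Links A f B g)
    (hg : Set.InjOn g B) (m r : ℕ) : lowCount B g m r ≤ lowCount A f m r := by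
  choose! t ht using h
  apply Finset.card_le_card_of_injOn t
  · intro p hp
    simp only [Finset.coe_filter, Set.mem_ofPred_eq] at hp ⊢
    obtain ⟨h1, h2, h3⟩ := ht p hp.1
    exact ⟨h1, by omega, by omega⟩
  · intro p hp q hq hpq
    simp only [Finset.coe_filter, Set.mem_ofPred_eq] at hp hq
    apply hg hp.1 hq.1
    rw [← (ht p hp.1).2.2, ← (ht q hq.1).2.2, hpq]

/-- A partial labeling of the rows `≥ ρ` of `B` extends to all of `B`: go down row by row and give
each cell the smallest label of `A` that is weakly above it and still unused. The cells in low rows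
then carry as many small labels as the rows above and the column `A` permit. -/
theorem exists_greedy_labels {A B : Finset ℕ} {f : ℕ → ℕ} (hf : Set.InjOn f A) (ρ : ℕ) :
    ∀ g : ℕ → ℕ, Set.InjOn g (B.filter fun p => ρ ≤ p) → Links A f (B.filter fun p => ρ ≤ p) g →
    (∀ r < ρ, (B.filter fun p => r ≤ p).card ≤ (A.filter fun p => r ≤ p).card) →
    ∃ g' : ℕ → ℕ, (∀ p, ρ ≤ p → g' p = g p) ∧ Set.InjOn g' B ∧ Links A f B g' ∧
      ∀ m r, r < ρ → rowCount B r ρ + lowCount B g' m ρ ≤ lowCount B g' m r ∨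
        ∃ r', r ≤ r' ∧ r' < ρ ∧ rowCount B r r' + lowCount A f m r' ≤ lowCount B g' m r := by
  induction ρ with
  | zero =>
    intro g h1 h2 _
    refine ⟨g, fun _ _ => rfl, ?_, ?_, fun m r h => absurd h (by omega)⟩
    · simpa using h1
    · simpa using h2
  | succ ρ ih =>
    intro g hg hl hall
    -- it is enough to treat the row `ρ`
    suffices H : ∃ g₁ : ℕ → ℕ, (∀ p, ρ + 1 ≤ p → g₁ p = g p) ∧
        Set.InjOn g₁ (B.filter fun p => ρ ≤ p) ∧ Links A f (B.filter fun p => ρ ≤ p) g₁ ∧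
        ∀ m, rowCount B ρ (ρ + 1) + lowCount B g₁ m (ρ + 1) ≤ lowCount B g₁ m ρ ∨
          lowCount A f m ρ ≤ lowCount B g₁ m ρ by
      obtain ⟨g₁, h1, h2, h3, h4⟩ := H
      obtain ⟨g', k1, k2, k3, k4⟩ := ih g₁ h2 h3 fun r hr => hall r (by omega)
      refine ⟨g', fun p hp => ?_, k2, k3, fun m r hr => ?_⟩
      · rw [k1 p (by omega), h1 p hp]
      have e1 : lowCount B g' m ρ = lowCount B g₁ m ρ :=
        lowCount_congr m fun p _ hp => k1 p hp
      have e2 : lowCount B g' m (ρ + 1) = lowCount B g₁ m (ρ + 1) :=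
        lowCount_congr m fun p _ hp => k1 p (by omega)
      have key : rowCount B r ρ + lowCount B g' m ρ ≤ lowCount B g' m r ∨
        ∃ r', r ≤ r' ∧ r' < ρ ∧ rowCount B r r' + lowCount A f m r' ≤ lowCount B g' m r := by
        rcases Nat.lt_succ_iff_lt_or_eq.1 hr with h | rfl
        · exact k4 m r h
        · left
          simp [rowCount]
      rcases key with key | ⟨r', a, b, c⟩
      · rcases h4 m with h | h
        · left
          rw [rowCount_add B (Nat.lt_succ_iff.1 hr) (show ρ ≤ ρ + 1 by omega)]
          omega
        · right
          exact ⟨ρ, by omega, by omega, by omega⟩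
      · right
        exact ⟨r', a, by omega, c⟩
    by_cases hρ : ρ ∈ B
    · -- the labels weakly above row `ρ` that are not used above row `ρ`
      set av := ((A.filter fun p => ρ ≤ p).image f) \ ((B.filter fun p => ρ + 1 ≤ p).image g)
        with hav
      have hne : av.Nonempty := by
        rw [← Finset.card_pos]
        have c1 : ((A.filter fun p => ρ ≤ p).image f).card = (A.filter fun p => ρ ≤ p).card :=
          Finset.card_image_of_injOn (hf.mono (by intro x hx; simp at hx; exact hx.1))
        have c2 : ((B.filter fun p => ρ + 1 ≤ p).image g).card ≤
          (B.filter fun p => ρ + 1 ≤ p).card := Finset.card_image_le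
        have c3 : (B.filter fun p => ρ + 1 ≤ p).card < (B.filter fun p => ρ ≤ p).card := by
          apply Finset.card_lt_card
          rw [Finset.ssubset_iff_of_subset]
          · exact ⟨ρ, by simp [hρ], by simp⟩
          · intro p
            simp only [Finset.mem_filter]
            rintro ⟨h1, h2⟩
            exact ⟨h1, by omega⟩
        have c4 := hall ρ (by omega)
        have c5 := Finset.le_card_sdiff ((B.filter fun p => ρ + 1 ≤ p).image g)
          ((A.filter fun p => ρ ≤ p).image f)
        rw [← hav] at c5
        omega
      have ha := Finset.min'_mem av hne
      have hmin : ∀ b ∈ av, av.min' hne ≤ b := fun b hb => Finset.min'_le av b hb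
      generalize av.min' hne = a at ha hmin
      rw [hav, Finset.mem_sdiff, Finset.mem_image] at ha
      obtain ⟨⟨q, hq, hqa⟩, hna⟩ := ha
      simp only [Finset.mem_filter] at hq
      have hna' : ∀ p ∈ B, ρ + 1 ≤ p → g p ≠ a := fun p hp hp' h =>
        hna (Finset.mem_image.2 ⟨p, Finset.mem_filter.2 ⟨hp, hp'⟩, h⟩)
      have hup : ∀ p, ρ + 1 ≤ p → Function.update g ρ a p = g p := fun p hp =>
        Function.update_of_ne (by omega) _ _
      refine ⟨Function.update g ρ a, hup, ?_, ?_, ?_⟩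
      · intro x hx y hy hxy
        simp only [Finset.coe_filter, Set.mem_ofPred_eq] at hx hy
        rcases Nat.lt_or_ge ρ x with h1 | h1 <;> rcases Nat.lt_or_ge ρ y with h2 | h2
        · rw [hup x h1, hup y h2] at hxy
          exact hg (by simp; exact ⟨hx.1, h1⟩) (by simp; exact ⟨hy.1, h2⟩) hxy
        · obtain rfl : y = ρ := by omega
          rw [hup x h1, Function.update_self] at hxy
          exact absurd hxy (hna' x hx.1 h1)
        · obtain rfl : x = ρ := by omega
          rw [hup y h2, Function.update_self] at hxy
          exact absurd hxy.symm (hna' y hy.1 h2)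
        · omega
      · intro p hp
        simp only [Finset.mem_filter] at hp
        rcases Nat.lt_or_ge ρ p with h1 | h1
        · obtain ⟨q', h2, h3, h4⟩ := hl p (by simp; exact ⟨hp.1, h1⟩)
          exact ⟨q', h2, h3, by rw [hup p h1, h4]⟩
        · obtain rfl : p = ρ := by omega
          exact ⟨q, hq.1, hq.2, by rw [Function.update_self, hqa]⟩
      · intro m
        rcases Nat.lt_or_ge m a with h | h
        · right
          -- all labels `≤ m` weakly above row `ρ` are used above row `ρ`
          have : (A.filter fun p => ρ ≤ p ∧ f p ≤ m).image f ⊆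
              (B.filter fun p => ρ ≤ p ∧ Function.update g ρ a p ≤ m).image
                (Function.update g ρ a) := by
            intro l hl'
            simp only [Finset.mem_image, Finset.mem_filter] at hl'
            obtain ⟨p, ⟨p1, p2, p3⟩, rfl⟩ := hl'
            by_contra hcon
            have : f p ∈ av := by
              rw [hav, Finset.mem_sdiff, Finset.mem_image, Finset.mem_image]
              refine ⟨⟨p, by simp [p1, p2], rfl⟩, ?_⟩
              rintro ⟨p', hp', e⟩
              simp only [Finset.mem_filter] at hp'
              apply hcon
              rw [Finset.mem_image]
              refine ⟨p', ?_, by rw [hup p' hp'.2, e]⟩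
              simp only [Finset.mem_filter]
              exact ⟨hp'.1, by omega, by rw [hup p' hp'.2]; omega⟩
            have := hmin _ this
            omega
          have h1 := Finset.card_le_card this
          rw [Finset.card_image_of_injOn
            (hf.mono (by intro x hx; simp at hx; exact hx.1))] at h1
          exact h1.trans Finset.card_image_le
        · left
          rw [rowCount_eq_one hρ]
          unfold lowCount
          rw [add_comm, ← Finset.card_insert_of_notMem (a := ρ) (by simp)]
          apply Finset.card_le_card
          intro p
          simp only [Finset.mem_insert, Finset.mem_filter]
          rintro (rfl | ⟨h1, h2, h3⟩)
          · exact ⟨hρ, le_rfl, by rw [Function.update_self]; exact h⟩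
          · exact ⟨h1, by omega, h3⟩
    · have hB : (B.filter fun p => ρ ≤ p) = B.filter fun p => ρ + 1 ≤ p := by
        apply Finset.filter_congr
        intro p hp
        have : p ≠ ρ := fun h => hρ (h ▸ hp)
        omega
      refine ⟨g, fun _ _ => rfl, by rw [hB]; exact hg, by rw [hB]; exact hl, fun m => Or.inl ?_⟩
      rw [rowCount_eq_zero hρ, zero_add]
      exact lowCount_mono_row _ _ _ (Nat.le_succ ρ)

/-- If no cell of `B` with a label above `m` could take over a label `≤ m` from a lower cell (or an
unused one), then `B` carries small labels as high up as possible. -/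
theorem lowCount_le_of_stable {A B : Finset ℕ} {f g f' g' : ℕ → ℕ} {m : ℕ}
    (hf : Set.InjOn f A)
    (hs : ∀ p ∈ B, m < g p → ∀ q ∈ A, f q ≤ m → p ≤ q → ∃ p' ∈ B, g p' = f q ∧ p < p')
    (hl' : Links A f' B g') (hg' : Set.InjOn g' B)
    (h : ∀ r, lowCount A f' m r ≤ lowCount A f m r) (r : ℕ) :
    lowCount B g' m r ≤ lowCount B g m r := by
  by_cases hbig : ∃ p, p ∈ B ∧ r ≤ p ∧ m < g p
  · classical
    -- `p` is the lowest cell in the rows `≥ r` with a label above `m`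
    have hp := Nat.find_spec hbig
    have hmin := fun q => Nat.find_min hbig (m := q)
    generalize Nat.find hbig = p at hp hmin
    obtain ⟨hpB, hrp, hmp⟩ := hp
    have e1 : lowCount A f m p ≤ lowCount B g m p := by
      have : (A.filter fun q => p ≤ q ∧ f q ≤ m).image f ⊆
          (B.filter fun q => p ≤ q ∧ g q ≤ m).image g := by
        intro l hl
        simp only [Finset.mem_image, Finset.mem_filter] at hl ⊢
        obtain ⟨q, ⟨h1, h2, h3⟩, rfl⟩ := hl
        obtain ⟨p', h4, h5, h6⟩ := hs p hpB hmp q h1 h3 h2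
        exact ⟨p', ⟨h4, h6.le, by omega⟩, h5⟩
      have h1 := Finset.card_le_card this
      rw [Finset.card_image_of_injOn
        (hf.mono (by intro x hx; simp at hx; exact hx.1))] at h1
      exact h1.trans Finset.card_image_le
    have e2 : rowCount B r p + lowCount B g m p ≤ lowCount B g m r := by
      unfold rowCount lowCount
      rw [← Finset.card_union_of_disjoint]
      · apply Finset.card_le_card
        intro q
        simp only [Finset.mem_union, Finset.mem_filter]
        rintro (⟨h1, h2, h3⟩ | ⟨h1, h2, h3⟩)
        · refine ⟨h1, h2, ?_⟩
          by_contra hc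
          exact hmin q h3 ⟨h1, h2, by omega⟩
        · exact ⟨h1, by omega, h3⟩
      · rw [Finset.disjoint_left]
        simp only [Finset.mem_filter]
        rintro q ⟨_, _, h1⟩ ⟨_, h2, _⟩
        omega
    have e3 := lowCount_split B g' m r p
    have e4 := hl'.lowCount_le hg' m p
    have e5 := h p
    omega
  · apply Finset.card_le_card
    intro p
    simp only [Finset.mem_filter]
    rintro ⟨h1, h2, _⟩
    refine ⟨h1, h2, ?_⟩
    by_contra hc
    exact hbig ⟨p, h1, h2, by omega⟩

/-! ### Path labelings and uncrossing -/

/-- A labeling of the columns `0, …, n` of `D` (given by their sets of rows) by paths that weakly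
descend from left to right: the label `i` starts in row `i` of column `0`, labels are distinct in
each column, and each cell finds its label weakly above in the column to its left. -/
structure PathLabeling (n : ℕ) (D : ℕ → Finset ℕ) (L : ℕ → ℕ → ℕ) : Prop where
  base : ∀ p ∈ D 0, L 0 p = p
  inj : ∀ c ≤ n, Set.InjOn (L c) (D c)
  links : ∀ c < n, Links (D c) (L c) (D (c + 1)) (L (c + 1))

/-- In column `c`, the label `b` occurs, and it lies above the label `a` if that occurs as well. -/
def Dominates (D : ℕ → Finset ℕ) (L : ℕ → ℕ → ℕ) (a b c : ℕ) : Prop :=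
  ∃ p ∈ D c, L c p = b ∧ ∀ q ∈ D c, L c q = a → q < p

/-- Exchange the labels `a` and `b` in the columns `lo < c ≤ hi`. -/
def swapOn (lo hi a b : ℕ) (L : ℕ → ℕ → ℕ) (c p : ℕ) : ℕ :=
  if lo < c ∧ c ≤ hi then Equiv.swap a b (L c p) else L c p

theorem swapOn_of_mem {lo hi a b c : ℕ} (L : ℕ → ℕ → ℕ) (h : lo < c) (h' : c ≤ hi) :
    swapOn lo hi a b L c = Equiv.swap a b ∘ L c := by
  funext p
  simp [swapOn, h, h']

theorem swapOn_of_notMem {lo hi a b c : ℕ} (L : ℕ → ℕ → ℕ) (h : ¬(lo < c ∧ c ≤ hi)) :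
    swapOn lo hi a b L c = L c := by
  funext p
  simp only [swapOn, if_neg h]

theorem swapOn_of_ne {lo hi a b c p : ℕ} {L : ℕ → ℕ → ℕ} (ha : L c p ≠ a) (hb : L c p ≠ b) :
    swapOn lo hi a b L c p = L c p := by
  unfold swapOn
  split_ifs
  · exact Equiv.swap_apply_of_ne_of_ne ha hb
  · rfl

/-- An edge between two columns survives if the labels `a` and `b` are exchanged on its right. -/
theorem Links.swap_right {A B : Finset ℕ} {f g : ℕ → ℕ} {a b : ℕ} (h : Links A f B g)
    (hb : ∀ p ∈ B, g p = b → ∃ q ∈ A, p ≤ q ∧ f q = a)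
    (ha : ∀ p ∈ B, g p = a → ∃ q ∈ A, p ≤ q ∧ f q = b) : Links A f B (Equiv.swap a b ∘ g) := by
  intro p hp
  by_cases h1 : g p = a
  · simpa [h1] using ha p hp h1
  by_cases h2 : g p = b
  · simpa [h2] using hb p hp h2
  · simpa [Equiv.swap_apply_of_ne_of_ne h1 h2] using h p hp

theorem Links.swap {A B : Finset ℕ} {f g : ℕ → ℕ} (a b : ℕ) (h : Links A f B g) :
    Links A (Equiv.swap a b ∘ f) B (Equiv.swap a b ∘ g) := by
  intro p hp
  obtain ⟨q, h1, h2, h3⟩ := h p hp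
  exact ⟨q, h1, h2, by simp [h3]⟩

theorem Links.swap_left {A B : Finset ℕ} {f g : ℕ → ℕ} {a b : ℕ} (h : Links A f B g)
    (hb : ∀ p ∈ B, g p = b → ∃ q ∈ A, p ≤ q ∧ f q = a)
    (ha : ∀ p ∈ B, g p = a → ∃ q ∈ A, p ≤ q ∧ f q = b) : Links A (Equiv.swap a b ∘ f) B g := by
  have := (h.swap_right hb ha).swap a b
  rwa [← Function.comp_assoc, show Equiv.swap a b ∘ Equiv.swap a b = id by
    funext x; simp, Function.id_comp] at this

/-- Two paths may exchange their segments in the columns `lo < c ≤ hi` if they may be reconnected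
at both ends. -/
theorem PathLabeling.swapOn {n : ℕ} {D : ℕ → Finset ℕ} {L : ℕ → ℕ → ℕ} (hL : PathLabeling n D L)
    {lo hi a b : ℕ} (hlt : lo < hi)
    (hlo : Links (D lo) (L lo) (D (lo + 1)) (Equiv.swap a b ∘ L (lo + 1)))
    (hhi : hi < n → Links (D hi) (Equiv.swap a b ∘ L hi) (D (hi + 1)) (L (hi + 1))) :
    PathLabeling n D (swapOn lo hi a b L) := by
  refine ⟨fun p hp => ?_, fun c hc => ?_, fun c hc => ?_⟩
  · rw [swapOn_of_notMem L (by omega)]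
    exact hL.base p hp
  · by_cases h : lo < c ∧ c ≤ hi
    · rw [swapOn_of_mem L h.1 h.2]
      exact (Equiv.injective _).injOn.comp (hL.inj c hc) (Set.mapsTo_univ _ _)
    · rw [swapOn_of_notMem L h]
      exact hL.inj c hc
  · by_cases h : lo < c ∧ c ≤ hi <;> by_cases h' : lo < c + 1 ∧ c + 1 ≤ hi
    · rw [swapOn_of_mem L h.1 h.2, swapOn_of_mem L h'.1 h'.2]
      exact (hL.links c hc).swap a b
    · obtain rfl : c = hi := by omega
      rw [swapOn_of_mem L h.1 h.2, swapOn_of_notMem L h']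
      exact hhi hc
    · obtain rfl : c = lo := by omega
      rw [swapOn_of_notMem L h, swapOn_of_mem L h'.1 h'.2]
      exact hlo
    · rw [swapOn_of_notMem L h, swapOn_of_notMem L h']
      exact hL.links c hc

/-- If the path `a` may step to the higher cell of a larger label `b` instead of its own next cell,
then the two paths can be uncrossed: `a` takes over the segment of `b` up to the first column where
`b` is no longer above `a`, where both return to their own cells. -/
theorem PathLabeling.exists_uncross {n : ℕ} {D : ℕ → Finset ℕ} {L : ℕ → ℕ → ℕ}
    (hL : PathLabeling n D L) {a b c pa pb : ℕ} (hc : c < n) (hpa : pa ∈ D c)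
    (hLa : L c pa = a) (hpb : pb ∈ D (c + 1)) (hLb : L (c + 1) pb = b) (hle : pb ≤ pa)
    (hlow : ∀ q ∈ D (c + 1), L (c + 1) q = a → q < pb) :
    ∃ hi, c < hi ∧ hi ≤ n ∧ (∀ c', c < c' → c' ≤ hi → Dominates D L a b c') ∧
      PathLabeling n D (Kohnert.swapOn c hi a b L) := by
  classical
  let P : ℕ → Prop := fun h => ∀ c', c < c' → c' ≤ h → Dominates D L a b c'
  have hP : P (c + 1) := fun c' h1 h2 => by
    obtain rfl : c' = c + 1 := by omega
    exact ⟨pb, hpb, hLb, hlow⟩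
  have h1 : P (Nat.findGreatest P n) := Nat.findGreatest_spec (m := c + 1) hc hP
  have h2 : c + 1 ≤ Nat.findGreatest P n := Nat.le_findGreatest hc hP
  have h3 : Nat.findGreatest P n ≤ n := Nat.findGreatest_le n
  have h4 : ∀ k, Nat.findGreatest P n < k → k ≤ n → ¬ P k := fun k =>
    Nat.findGreatest_is_greatest
  generalize Nat.findGreatest P n = hi at h1 h2 h3 h4
  refine ⟨hi, h2, h3, h1, hL.swapOn h2 ?_ fun hn => ?_⟩
  · refine (hL.links c hc).swap_right (fun p hp h => ?_) fun p hp h => ?_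
    · obtain rfl : p = pb := hL.inj (c + 1) hc hp hpb (h.trans hLb.symm)
      exact ⟨pa, hpa, hle, hLa⟩
    · obtain ⟨q, q1, q2, q3⟩ := hL.links c hc pb hpb
      exact ⟨q, q1, (hlow p hp h).le.trans q2, q3.trans hLb⟩
  · obtain ⟨p, p1, p2, p3⟩ := h1 hi h2 le_rfl
    have hnd : ¬ Dominates D L a b (hi + 1) := fun hd => h4 (hi + 1) (by omega) hn fun c' k1 k2 => by
      rcases Nat.lt_succ_iff_lt_or_eq.1 (Nat.lt_succ_of_le k2) with k | rfl
      · exact h1 c' k1 (by omega)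
      · exact hd
    refine (hL.links hi hn).swap_left (fun q hq h => ?_) fun q hq h => ?_
    · -- the label `b` occurs but does not dominate, so `a` lies above it
      have : ∃ q' ∈ D (hi + 1), L (hi + 1) q' = a ∧ q ≤ q' := by
        by_contra hcon
        push Not at hcon
        exact hnd ⟨q, hq, h, hcon⟩
      obtain ⟨q', k1, k2, k3⟩ := this
      obtain ⟨s, s1, s2, s3⟩ := hL.links hi hn q' k1
      exact ⟨s, s1, k3.trans s2, s3.trans k2⟩
    · obtain ⟨s, s1, s2, s3⟩ := hL.links hi hn q hq
      exact ⟨p, p1, s2.trans (p3 s s1 (s3.trans h)).le, p2⟩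

theorem lowCount_le_swap {A : Finset ℕ} {f : ℕ → ℕ} {a b p : ℕ} (hf : Set.InjOn f A) (hab : a < b)
    (hp : p ∈ A) (hpb : f p = b) (hlow : ∀ q ∈ A, f q = a → q < p) (m r : ℕ) :
    lowCount A f m r ≤ lowCount A (Equiv.swap a b ∘ f) m r := by
  unfold lowCount
  rcases Nat.lt_or_ge m b with h | h
  · apply Finset.card_le_card_of_injOn fun q => if f q = a then p else q
    · intro q hq
      simp only [Finset.coe_filter, Set.mem_ofPred_eq, Function.comp_apply] at hq ⊢
      split_ifs with h1
      · have := hlow q hq.1 h1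
        refine ⟨hp, by omega, ?_⟩
        rw [hpb, Equiv.swap_apply_right]
        omega
      · rw [Equiv.swap_apply_of_ne_of_ne h1 (by omega)]
        exact hq
    · intro q hq q' hq' e
      simp only [Finset.coe_filter, Set.mem_ofPred_eq] at hq hq' e
      split_ifs at e with h1 h2 h2
      · exact hf hq.1 hq'.1 (h1.trans h2.symm)
      · subst e; omega
      · subst e; omega
      · exact e
  · apply Finset.card_le_card
    intro q
    simp only [Finset.mem_filter, Function.comp_apply]
    rintro ⟨h1, h2, h3⟩
    refine ⟨h1, h2, ?_⟩
    rw [Equiv.swap_apply_def]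
    split_ifs <;> omega

theorem lowCount_le_swapOn {n : ℕ} {D : ℕ → Finset ℕ} {L : ℕ → ℕ → ℕ} (hL : PathLabeling n D L)
    {a b lo hi : ℕ} (hab : a < b) (hhi : hi ≤ n)
    (hd : ∀ c, lo < c → c ≤ hi → Dominates D L a b c) (c m r : ℕ) :
    lowCount (D c) (L c) m r ≤ lowCount (D c) (swapOn lo hi a b L c) m r := by
  by_cases h : lo < c ∧ c ≤ hi
  · rw [swapOn_of_mem L h.1 h.2]
    obtain ⟨p, p1, p2, p3⟩ := hd c h.1 h.2
    exact lowCount_le_swap (hL.inj c (by omega)) hab p1 p2 p3 m r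
  · rw [swapOn_of_notMem L h]

/-- A measure that drops when two paths are uncrossed. The row enters as `p + 1` so that every
occurrence of a label has positive weight. -/
def labelWeight (n : ℕ) (D : ℕ → Finset ℕ) (L : ℕ → ℕ → ℕ) : ℕ :=
  ∑ c ∈ Finset.range (n + 1), ∑ p ∈ D c, L c p * (p + 1)

theorem sum_swap_lt {A : Finset ℕ} {f : ℕ → ℕ} {a b p : ℕ} (hf : Set.InjOn f A) (hab : a < b)
    (hp : p ∈ A) (hpb : f p = b) (hlow : ∀ q ∈ A, f q = a → q < p) :
    ∑ q ∈ A, (Equiv.swap a b ∘ f) q * (q + 1) < ∑ q ∈ A, f q * (q + 1) := by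
  by_cases h : ∃ q ∈ A, f q = a
  · obtain ⟨q, hq, hqa⟩ := h
    have hqp := hlow q hq hqa
    have hq' : q ∈ A.erase p := Finset.mem_erase.2 ⟨by omega, hq⟩
    rw [← Finset.add_sum_erase A _ hp, ← Finset.add_sum_erase A _ hp,
      ← Finset.add_sum_erase _ _ hq', ← Finset.add_sum_erase _ _ hq']
    have e : ∑ x ∈ (A.erase p).erase q, (Equiv.swap a b ∘ f) x * (x + 1) =
        ∑ x ∈ (A.erase p).erase q, f x * (x + 1) := by
      apply Finset.sum_congr rfl
      intro x hx
      simp only [Finset.mem_erase] at hx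
      rw [Function.comp_apply, Equiv.swap_apply_of_ne_of_ne]
      · exact fun h => hx.1 (hf hx.2.2 hq (h.trans hqa.symm))
      · exact fun h => hx.2.1 (hf hx.2.2 hp (h.trans hpb.symm))
    rw [e]
    simp only [Function.comp_apply, hpb, hqa, Equiv.swap_apply_left, Equiv.swap_apply_right]
    obtain ⟨d, rfl⟩ := Nat.exists_eq_add_of_lt hab
    obtain ⟨d', rfl⟩ := Nat.exists_eq_add_of_lt hqp
    nlinarith [Nat.zero_le (d * d'), Nat.zero_le d, Nat.zero_le d']
  · push Not at h
    apply Finset.sum_lt_sum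
    · intro q hq
      rw [Function.comp_apply, Equiv.swap_apply_def, if_neg (h q hq)]
      split_ifs with h1
      · rw [h1]; exact Nat.mul_le_mul_right _ hab.le
      · exact le_rfl
    · refine ⟨p, hp, ?_⟩
      rw [Function.comp_apply, hpb, Equiv.swap_apply_right]
      exact Nat.mul_lt_mul_of_pos_right hab (by omega)

theorem labelWeight_swapOn_lt {n : ℕ} {D : ℕ → Finset ℕ} {L : ℕ → ℕ → ℕ} (hL : PathLabeling n D L)
    {a b lo hi : ℕ} (hab : a < b) (hlt : lo < hi) (hhi : hi ≤ n)
    (hd : ∀ c, lo < c → c ≤ hi → Dominates D L a b c) :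
    labelWeight n D (swapOn lo hi a b L) < labelWeight n D L := by
  have key : ∀ c, lo < c → c ≤ hi →
      ∑ p ∈ D c, swapOn lo hi a b L c p * (p + 1) < ∑ p ∈ D c, L c p * (p + 1) := by
    intro c h1 h2
    rw [swapOn_of_mem L h1 h2]
    obtain ⟨p, p1, p2, p3⟩ := hd c h1 h2
    exact sum_swap_lt (hL.inj c (by omega)) hab p1 p2 p3
  apply Finset.sum_lt_sum
  · intro c _
    by_cases h : lo < c ∧ c ≤ hi
    · exact (key c h.1 h.2).le
    · rw [swapOn_of_notMem L h]
  · exact ⟨hi, Finset.mem_range.2 (by omega), key hi hlt le_rfl⟩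

/-! ### Extending and comparing labelings -/

theorem PathLabeling.congr {n : ℕ} {D D' : ℕ → Finset ℕ} {L L' : ℕ → ℕ → ℕ}
    (hL : PathLabeling n D L) (hD : ∀ c ≤ n, D' c = D c)
    (hL' : ∀ c ≤ n, ∀ p ∈ D c, L' c p = L c p) : PathLabeling n D' L' := by
  refine ⟨fun p hp => ?_, fun c hc p hp q hq h => ?_, fun c hc p hp => ?_⟩
  · rw [hD 0 (by omega)] at hp
    rw [hL' 0 (by omega) p hp]
    exact hL.base p hp
  · rw [hD c hc] at hp hq
    rw [hL' c hc p hp, hL' c hc q hq] at h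
    exact hL.inj c hc hp hq h
  · rw [hD (c + 1) hc] at hp
    obtain ⟨q, h1, h2, h3⟩ := hL.links c hc p hp
    refine ⟨q, by rwa [hD c hc.le], h2, ?_⟩
    rw [hL' c hc.le q h1, hL' (c + 1) hc p hp, h3]

theorem PathLabeling.mono {n m : ℕ} {D : ℕ → Finset ℕ} {L : ℕ → ℕ → ℕ}
    (hL : PathLabeling n D L) (h : m ≤ n) : PathLabeling m D L :=
  ⟨hL.base, fun c hc => hL.inj c (by omega), fun c hc => hL.links c (by omega)⟩

theorem PathLabeling.update_succ {n : ℕ} {D : ℕ → Finset ℕ} {L : ℕ → ℕ → ℕ} {g : ℕ → ℕ}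
    (hL : PathLabeling n D L) (hg : Set.InjOn g (D (n + 1)))
    (hl : Links (D n) (L n) (D (n + 1)) g) :
    PathLabeling (n + 1) D (Function.update L (n + 1) g) := by
  have e : ∀ c, c ≤ n → Function.update L (n + 1) g c = L c := fun c hc =>
    Function.update_of_ne (by omega) _ _
  refine ⟨fun p hp => ?_, fun c hc => ?_, fun c hc => ?_⟩
  · rw [e 0 (by omega)]
    exact hL.base p hp
  · rcases Nat.lt_succ_iff_lt_or_eq.1 (Nat.lt_succ_of_le hc) with h | rfl
    · rw [e c (by omega)]
      exact hL.inj c (by omega)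
    · rwa [Function.update_self]
  · rw [e c (by omega)]
    rcases Nat.lt_succ_iff_lt_or_eq.1 hc with h | rfl
    · rw [e (c + 1) h]
      exact hL.links c h
    · rwa [Function.update_self]

theorem PathLabeling.label_mem {n : ℕ} {D : ℕ → Finset ℕ} {L : ℕ → ℕ → ℕ}
    (hL : PathLabeling n D L) : ∀ c ≤ n, ∀ p ∈ D c, L c p ∈ D 0 ∧ p ≤ L c p := by
  intro c
  induction c with
  | zero => intro _ p hp; rw [hL.base p hp]; exact ⟨hp, le_rfl⟩
  | succ c ih =>
    intro hc p hp
    obtain ⟨q, h1, h2, h3⟩ := hL.links c hc p hp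
    have := ih (by omega) q h1
    rw [h3] at this
    exact ⟨this.1, h2.trans this.2⟩

theorem PathLabeling.lowCount_succ_le {n : ℕ} {D : ℕ → Finset ℕ} {L : ℕ → ℕ → ℕ}
    (hL : PathLabeling n D L) {c : ℕ} (hc : c < n) (m r : ℕ) :
    lowCount (D (c + 1)) (L (c + 1)) m r ≤ lowCount (D c) (L c) m r :=
  (hL.links c hc).lowCount_le (hL.inj (c + 1) hc) m r

theorem lowCount_eq_card {A : Finset ℕ} {f : ℕ → ℕ} {m : ℕ} (h : ∀ p ∈ A, f p ≤ m) (r : ℕ) :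
    lowCount A f m r = (A.filter fun p => r ≤ p).card := by
  unfold lowCount
  congr 1
  apply Finset.filter_congr
  intro p hp
  simp [h p hp]

theorem lowCount_le_card (A : Finset ℕ) (f : ℕ → ℕ) (m r : ℕ) :
    lowCount A f m r ≤ (A.filter fun p => r ≤ p).card := by
  apply Finset.card_le_card
  intro p
  simp only [Finset.mem_filter]
  rintro ⟨h1, h2, _⟩
  exact ⟨h1, h2⟩

theorem PathLabeling.card_succ_le {n : ℕ} {D : ℕ → Finset ℕ} {L : ℕ → ℕ → ℕ}
    (hL : PathLabeling n D L) {c : ℕ} (hc : c < n) (r : ℕ) :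
    ((D (c + 1)).filter fun p => r ≤ p).card ≤ ((D c).filter fun p => r ≤ p).card := by
  have h : ∀ p ∈ D (c + 1), L (c + 1) p ≤ (D 0).sup id := fun p hp =>
    Finset.le_sup (f := id) (hL.label_mem (c + 1) hc p hp).1
  rw [← lowCount_eq_card h]
  exact (hL.lowCount_succ_le hc _ r).trans (lowCount_le_card _ _ _ _)

/-- The step from the label counts of one column to the greedy label counts of the next one is a
minimum of translations. Hence a labeling of the columns `≤ e` that in each count is at least as
good as one of the labelings `Li i` of diagrams with the same columns beyond `e` extends to all
columns, and keeps this property. -/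
theorem PathLabeling.exists_extension {ι : Type*} {D : ℕ → Finset ℕ} {L : ℕ → ℕ → ℕ} {e n : ℕ}
    {N : ℕ} (hen : e ≤ n) (hL : PathLabeling e D L) (Di : ι → ℕ → Finset ℕ) (Li : ι → ℕ → ℕ → ℕ)
    (hi : ∀ i, PathLabeling n (Di i) (Li i)) (hN : ∀ i, ∀ p ∈ Di i 0, p ≤ N)
    (hD : ∀ i c, e < c → Di i c = D c)
    (hdom : ∀ m r, ∃ i, lowCount (Di i e) (Li i e) m r ≤ lowCount (D e) (L e) m r) :
    ∃ L', PathLabeling n D L' ∧ (∀ c ≤ e, L' c = L c) ∧ ∀ c, e ≤ c → c ≤ n → ∀ m r,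
      ∃ i, lowCount (Di i c) (Li i c) m r ≤ lowCount (D c) (L' c) m r := by
  suffices H : ∀ k, e + k ≤ n → ∃ L', PathLabeling (e + k) D L' ∧ (∀ c ≤ e, L' c = L c) ∧
      ∀ c, e ≤ c → c ≤ e + k → ∀ m r,
        ∃ i, lowCount (Di i c) (Li i c) m r ≤ lowCount (D c) (L' c) m r by
    obtain ⟨k, rfl⟩ := Nat.exists_eq_add_of_le hen
    exact H k le_rfl
  intro k
  induction k with
  | zero =>
    intro _
    refine ⟨L, hL, fun _ _ => rfl, fun c h1 h2 => ?_⟩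
    obtain rfl : c = e := by omega
    exact hdom
  | succ k ih =>
    intro hk
    obtain ⟨L', h1, h2, h3⟩ := ih (by omega)
    set d := e + k with hd
    have hempty : (D (d + 1)).filter (fun p => (D (d + 1)).sup id + 1 ≤ p) = ∅ := by
      rw [Finset.filter_eq_empty_iff]
      intro p hp
      have : p ≤ (D (d + 1)).sup id := Finset.le_sup (f := id) hp
      omega
    obtain ⟨g, -, k2, k3, k4⟩ := exists_greedy_labels (A := D d) (B := D (d + 1))
      (h1.inj d le_rfl) ((D (d + 1)).sup id + 1) (fun _ => 0) (by rw [hempty]; simp)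
      (by rw [hempty]; intro p hp; simp at hp) (fun r _ => by
        obtain ⟨i, hi'⟩ := h3 d (by omega) le_rfl N r
        have c1 := (hi i).lowCount_succ_le (c := d) (by omega) N r
        rw [lowCount_eq_card (A := Di i (d + 1)) (fun p hp =>
          hN i _ ((hi i).label_mem (d + 1) (by omega) p hp).1), hD i (d + 1) (by omega)] at c1
        exact c1.trans (hi'.trans (lowCount_le_card _ _ _ _)))
    refine ⟨Function.update L' (d + 1) g, h1.update_succ k2 k3, fun c hc => ?_, ?_⟩
    · rw [Function.update_of_ne (by omega), h2 c hc]
    · intro c hc hc' m r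
      rcases Nat.lt_succ_iff_lt_or_eq.1 (Nat.lt_succ_of_le hc') with h | rfl
      · rw [Function.update_of_ne (by omega)]
        exact h3 c hc (by omega) m r
      · have e2 : e + (k + 1) = d + 1 := by omega
        rw [e2, Function.update_self]
        rcases Nat.lt_or_ge r ((D (d + 1)).sup id + 1) with hr | hr
        · rcases k4 m r hr with k5 | ⟨r', a1, a2, a3⟩
          · obtain ⟨i, -⟩ := h3 d (by omega) le_rfl m r
            refine ⟨i, ?_⟩
            have c1 := lowCount_split (Di i (d + 1)) (Li i (d + 1)) m r ((D (d + 1)).sup id + 1)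
            have c2 := lowCount_le_card (Di i (d + 1)) (Li i (d + 1)) m ((D (d + 1)).sup id + 1)
            rw [hD i (d + 1) (by omega)] at c1 c2 ⊢
            rw [hempty, Finset.card_empty] at c2
            omega
          · obtain ⟨i, hi'⟩ := h3 d (by omega) le_rfl m r'
            refine ⟨i, ?_⟩
            have c1 := lowCount_split (Di i (d + 1)) (Li i (d + 1)) m r r'
            have c2 := (hi i).lowCount_succ_le (c := d) (by omega) m r'
            rw [hD i (d + 1) (by omega)] at c1 c2 ⊢
            omega
        · obtain ⟨i, -⟩ := h3 d (by omega) le_rfl m r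
          refine ⟨i, ?_⟩
          have c2 := lowCount_le_card (Di i (d + 1)) (Li i (d + 1)) m r
          have c3 : ((D (d + 1)).filter fun p => r ≤ p).card = 0 := by
            rw [Finset.card_eq_zero, Finset.filter_eq_empty_iff]
            intro p hp
            have : p ≤ (D (d + 1)).sup id := Finset.le_sup (f := id) hp
            omega
          rw [hD i (d + 1) (by omega)] at c2 ⊢
          omega

/-- A labeling that respects the bounds `b c m` on the number of labels `≤ m` in column `c`, for
`1 ≤ c ≤ n`. -/
structure IsGood (n : ℕ) (b : ℕ → ℕ → ℕ) (D : ℕ → Finset ℕ) (L : ℕ → ℕ → ℕ) : Prop where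
  path : PathLabeling n D L
  bound : ∀ c, 1 ≤ c → c ≤ n → ∀ m, b c m ≤ lowCount (D c) (L c) m 0

/-- In some good labeling, a label `i ≤ k` of column `c` weakly above row `r` does not occur in
column `c + 1` above row `r`. For a vacant position `(c + 1, r)` this means that it abuts a label
`i ≤ k`. -/
def Reach (n : ℕ) (b : ℕ → ℕ → ℕ) (k : ℕ) (D : ℕ → Finset ℕ) (c r : ℕ) : Prop :=
  ∃ L, IsGood n b D L ∧ ∃ i ≤ k, (∃ p ∈ D c, r ≤ p ∧ L c p = i) ∧
    ∀ q ∈ D (c + 1), L (c + 1) q = i → q ≤ r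

/-- Occupied positions can be passed: the cell `(c + 1, r)` may be assumed to carry a label `≤ k`
itself. -/
theorem Reach.succ {n : ℕ} {b : ℕ → ℕ → ℕ} {k : ℕ} {D : ℕ → Finset ℕ} {c r : ℕ}
    (h : Reach n b k D c r) (hr : r ∈ D (c + 1)) (hc : c + 2 ≤ n) : Reach n b k D (c + 1) r := by
  suffices H : ∃ L, IsGood n b D L ∧ L (c + 1) r ≤ k by
    obtain ⟨L, hL, hk⟩ := H
    refine ⟨L, hL, _, hk, ⟨r, hr, le_rfl, rfl⟩, fun q hq h => ?_⟩
    obtain ⟨q', h1, h2, h3⟩ := hL.path.links (c + 1) (by omega) q hq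
    rwa [hL.path.inj (c + 1) (by omega) h1 hr (h3.trans h)] at h2
  obtain ⟨L, hL, i, hi, ⟨p, hp, hrp, hpi⟩, hq⟩ := h
  rcases Nat.lt_or_ge k (L (c + 1) r) with hk | hk
  · have hlow : ∀ q ∈ D (c + 1), L (c + 1) q = i → q < r := fun q h1 h2 => by
      have := hq q h1 h2
      have : q ≠ r := by rintro rfl; omega
      omega
    obtain ⟨hi', h1, h2, h3, h4⟩ := hL.path.exists_uncross (c := c) (by omega) hp hpi hr rfl hrp hlow
    refine ⟨_, ⟨h4, fun c' k1 k2 m => ?_⟩, ?_⟩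
    · exact (hL.bound c' k1 k2 m).trans (lowCount_le_swapOn hL.path (by omega) h2 h3 c' m 0)
    · rw [swapOn_of_mem L (Nat.lt_succ_self c) h1, Function.comp_apply, Equiv.swap_apply_right]
      exact hi
  · exact ⟨L, hL, hk⟩

theorem Reach.of_filled {n : ℕ} {b : ℕ → ℕ → ℕ} {k : ℕ} {D : ℕ → Finset ℕ} {c r : ℕ}
    (h : Reach n b k D c r) : ∀ d, c ≤ d → d < n → (∀ c', c < c' → c' ≤ d → r ∈ D c') →
    Reach n b k D d r := by
  intro d
  induction d with
  | zero => intro h1 _ _; obtain rfl : c = 0 := by omega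
            exact h
  | succ d ih =>
    intro h1 h2 h3
    rcases Nat.lt_succ_iff_lt_or_eq.1 (Nat.lt_succ_of_le h1) with h4 | rfl
    · exact (ih (by omega) (by omega) fun c' k1 k2 => h3 c' k1 (by omega)).succ
        (h3 (d + 1) h4 le_rfl) (by omega)
    · exact h

/-! ### Exchanging two cells of a column -/

/-- The part of `D` that matters above row `r` in the columns beyond `e`: all cells of the columns
`≤ e`, and of the later ones only the cells above row `r`. -/
def upperPart (D : ℕ → Finset ℕ) (e r : ℕ) (c : ℕ) : Finset ℕ :=
  if c ≤ e then D c else (D c).filter fun p => r < p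

theorem upperPart_of_le (D : ℕ → Finset ℕ) {e r c : ℕ} (h : c ≤ e) : upperPart D e r c = D c :=
  if_pos h

theorem mem_upperPart {D : ℕ → Finset ℕ} {e r c p : ℕ} (h : e < c) :
    p ∈ upperPart D e r c ↔ p ∈ D c ∧ r < p := by
  simp [upperPart, Nat.not_le.2 h]

theorem lowCount_upperPart {D : ℕ → Finset ℕ} {e r c : ℕ} (h : e < c) (f : ℕ → ℕ) (m : ℕ) {s : ℕ}
    (hs : s ≤ r + 1) : lowCount (upperPart D e r c) f m s = lowCount (D c) f m (r + 1) := by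
  unfold lowCount
  congr 1
  ext p
  simp only [Finset.mem_filter, mem_upperPart h]
  constructor
  · rintro ⟨⟨h1, h2⟩, _, h3⟩
    exact ⟨h1, h2, h3⟩
  · rintro ⟨h1, h2, h3⟩
    exact ⟨⟨h1, h2⟩, by omega, h3⟩

theorem lowCount_upperPart_of_lt {D : ℕ → Finset ℕ} {e r c : ℕ} (h : e < c) (f : ℕ → ℕ) (m : ℕ)
    {s : ℕ} (hs : r < s) : lowCount (upperPart D e r c) f m s = lowCount (D c) f m s := by
  unfold lowCount
  congr 1
  ext p
  simp only [Finset.mem_filter, mem_upperPart h]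
  constructor
  · rintro ⟨⟨h1, _⟩, h2, h3⟩
    exact ⟨h1, h2, h3⟩
  · rintro ⟨h1, h2, h3⟩
    exact ⟨⟨h1, by omega⟩, h2, h3⟩

/-- A labeling `u` of the upper part of `D₁` that keeps a label `i` of column `e + 1` unused in
column `e + 2`, and whose counts compare to those of the labeling `L₂` of `D₂`. -/
structure Reserve (D₁ D₂ : ℕ → Finset ℕ) (L₂ : ℕ → ℕ → ℕ) (e r k : ℕ) (u : ℕ → ℕ → ℕ) (i : ℕ) :
    Prop where
  path : PathLabeling (e + 2) (upperPart D₁ e r) u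
  le : i ≤ k
  mem : ∃ p ∈ upperPart D₁ e r (e + 1), u (e + 1) p = i
  notMem : ∀ q ∈ upperPart D₁ e r (e + 2), u (e + 2) q ≠ i
  left : ∀ c ≤ e, ∀ m s, lowCount (D₂ c) (L₂ c) m s ≤ lowCount (D₁ c) (u c) m s
  mid : ∀ m, lowCount (D₂ (e + 1)) (L₂ (e + 1)) m (r + 1) + (if i ≤ m then 1 else 0) ≤
    lowCount (upperPart D₁ e r (e + 1)) (u (e + 1)) m 0
  right : ∀ m s, r < s → lowCount (D₂ (e + 2)) (L₂ (e + 2)) m s ≤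
    lowCount (upperPart D₁ e r (e + 2)) (u (e + 2)) m s

/-- One uncrossing step for a label below the reserved label `i`. If the uncrossing takes `i` out of
column `e + 1`, the smaller label that replaces it is reserved instead. -/
theorem Reserve.exists_lt {D₁ D₂ : ℕ → Finset ℕ} {L₂ : ℕ → ℕ → ℕ} {e r k : ℕ} {u : ℕ → ℕ → ℕ}
    {i : ℕ} (h : Reserve D₁ D₂ L₂ e r k u i) {a b c pa pb : ℕ} (hai : a < i) (hab : a < b)
    (hc : c ≤ e) (hpa : pa ∈ upperPart D₁ e r c) (hua : u c pa = a)
    (hpb : pb ∈ upperPart D₁ e r (c + 1)) (hub : u (c + 1) pb = b) (hle : pb ≤ pa)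
    (hlow : ∀ q ∈ upperPart D₁ e r (c + 1), u (c + 1) q = a → q < pb) :
    ∃ u' i', Reserve D₁ D₂ L₂ e r k u' i' ∧ labelWeight (e + 2) (upperPart D₁ e r) u' <
      labelWeight (e + 2) (upperPart D₁ e r) u := by
  obtain ⟨hi, h1, h2, h3, h4⟩ := h.path.exists_uncross (by omega) hpa hua hpb hub hle hlow
  have hF := lowCount_le_swapOn h.path hab h2 h3
  have hlt := labelWeight_swapOn_lt h.path hab h1 h2 h3
  set u' := swapOn c hi a b u with hu'
  have left' : ∀ c ≤ e, ∀ m s, lowCount (D₂ c) (L₂ c) m s ≤ lowCount (D₁ c) (u' c) m s := by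
    intro c hc m s
    have := hF c m s
    rw [upperPart_of_le D₁ hc] at this
    exact (h.left c hc m s).trans this
  have right' : ∀ m s, r < s → lowCount (D₂ (e + 2)) (L₂ (e + 2)) m s ≤
      lowCount (upperPart D₁ e r (e + 2)) (u' (e + 2)) m s := fun m s hs =>
    (h.right m s hs).trans (hF _ m s)
  have keep : (∃ p ∈ upperPart D₁ e r (e + 1), u' (e + 1) p = i) →
      (∀ q ∈ upperPart D₁ e r (e + 2), u' (e + 2) q ≠ i) → ∃ u' i', Reserve D₁ D₂ L₂ e r k u' i' ∧
        labelWeight (e + 2) (upperPart D₁ e r) u' < labelWeight (e + 2) (upperPart D₁ e r) u :=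
    fun k1 k2 => ⟨u', i, ⟨h4, h.le, k1, k2, left', fun m => (h.mid m).trans (hF _ m 0), right'⟩, hlt⟩
  obtain ⟨p, hp, hpi⟩ := h.mem
  by_cases hbi : b = i
  · subst hbi
    -- the reserved label does not occur in column `e + 2`, so this column is not affected
    have hi' : hi < e + 2 := by
      by_contra hcon
      obtain ⟨q, q1, q2, _⟩ := h3 (e + 2) (by omega) (by omega)
      exact h.notMem q q1 q2
    have e2 : u' (e + 2) = u (e + 2) := swapOn_of_notMem u (by omega)
    have hn : ∀ q ∈ upperPart D₁ e r (e + 2), u' (e + 2) q ≠ b := by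
      rw [e2]; exact h.notMem
    by_cases hmid : c < e + 1 ∧ e + 1 ≤ hi
    · have e1 : u' (e + 1) = Equiv.swap a b ∘ u (e + 1) := swapOn_of_mem u hmid.1 hmid.2
      by_cases ha : ∃ q ∈ upperPart D₁ e r (e + 1), u (e + 1) q = a
      · obtain ⟨q, q1, q2⟩ := ha
        exact keep ⟨q, q1, by rw [e1, Function.comp_apply, q2, Equiv.swap_apply_left]⟩ hn
      · push Not at ha
        refine ⟨u', a, ⟨h4, by have := h.le; omega, ⟨p, hp, ?_⟩, fun q hq hqa => ?_, left',
          fun m => ?_, right'⟩, hlt⟩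
        · rw [e1, Function.comp_apply, hpi, Equiv.swap_apply_right]
        · obtain ⟨q', k1, _, k2⟩ := h.path.links (e + 1) (by omega) q hq
          rw [← e2, hqa] at k2
          exact ha q' k1 k2
        · have hm := h.mid m
          have hm' := hF (e + 1) m 0
          by_cases k1 : b ≤ m
          · rw [if_pos k1] at hm
            split_ifs <;> omega
          rw [if_neg k1] at hm
          by_cases k2 : a ≤ m
          · rw [if_pos k2]
            -- the cell of the former label `b > m` now carries the label `a ≤ m`
            have : lowCount (upperPart D₁ e r (e + 1)) (u (e + 1)) m 0 + 1 ≤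
                lowCount (upperPart D₁ e r (e + 1)) (u' (e + 1)) m 0 := by
              unfold lowCount
              rw [← Finset.card_insert_of_notMem (a := p) (by simp [hpi]; omega)]
              apply Finset.card_le_card
              intro q
              simp only [Finset.mem_insert, Finset.mem_filter]
              rintro (rfl | ⟨l1, l2, l3⟩)
              · refine ⟨hp, by omega, ?_⟩
                rwa [e1, Function.comp_apply, hpi, Equiv.swap_apply_right]
              · refine ⟨l1, l2, ?_⟩
                rwa [e1, Function.comp_apply,
                  Equiv.swap_apply_of_ne_of_ne (ha q l1) (by omega)]
            omega
          · rw [if_neg k2]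
            omega
    · have e1 : u' (e + 1) = u (e + 1) := swapOn_of_notMem u hmid
      exact keep ⟨p, hp, by rw [e1, hpi]⟩ hn
  · refine keep ⟨p, hp, ?_⟩ fun q hq hqi => h.notMem q hq ?_
    · rw [hu', swapOn_of_ne (by omega) (by omega), hpi]
    · rw [hu'] at hqi
      unfold swapOn at hqi
      split_ifs at hqi
      · rwa [Equiv.swap_apply_eq_iff, Equiv.swap_apply_of_ne_of_ne (by omega) (by omega)] at hqi
      · exact hqi

/-- Uncrossing as long as possible makes all counts of labels below the reserved one maximal. -/
theorem Reserve.exists_maximal {D₁ D₂ : ℕ → Finset ℕ} {L₂ : ℕ → ℕ → ℕ} {e r k : ℕ}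
    {L₁ : ℕ → ℕ → ℕ} (hL₁ : PathLabeling (e + 2) D₁ L₁) {u : ℕ → ℕ → ℕ} {i : ℕ}
    (h : Reserve D₁ D₂ L₂ e r k u i) : ∃ u i, Reserve D₁ D₂ L₂ e r k u i ∧ ∀ m < i,
      lowCount (D₁ (e + 1)) (L₁ (e + 1)) m (r + 1) ≤
        lowCount (upperPart D₁ e r (e + 1)) (u (e + 1)) m 0 := by
  induction hw : labelWeight (e + 2) (upperPart D₁ e r) u using Nat.strong_induction_on
    generalizing u i with
  | _ w ih =>
  by_cases hs : ∀ m < i, ∀ c ≤ e, ∀ p ∈ upperPart D₁ e r (c + 1), m < u (c + 1) p →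
      ∀ q ∈ upperPart D₁ e r c, u c q ≤ m → p ≤ q →
        ∃ p' ∈ upperPart D₁ e r (c + 1), u (c + 1) p' = u c q ∧ p < p'
  · refine ⟨u, i, h, fun m hm => ?_⟩
    rw [← lowCount_upperPart (e := e) (Nat.lt_succ_self e) (L₁ (e + 1)) m (Nat.zero_le (r + 1))]
    suffices H : ∀ c ≤ e + 1, ∀ s, lowCount (upperPart D₁ e r c) (L₁ c) m s ≤
        lowCount (upperPart D₁ e r c) (u c) m s from H (e + 1) le_rfl 0
    intro c
    induction c with
    | zero =>
      intro _ s
      refine (lowCount_congr m fun p hp _ => ?_).le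
      rw [h.path.base p hp]
      rw [upperPart_of_le D₁ (Nat.zero_le e)] at hp
      exact hL₁.base p hp
    | succ c ihc =>
      intro hc s
      have hsub : ∀ p ∈ upperPart D₁ e r (c + 1), p ∈ D₁ (c + 1) := by
        intro p hp
        unfold upperPart at hp
        split_ifs at hp
        · exact hp
        · exact (Finset.mem_filter.1 hp).1
      refine lowCount_le_of_stable (h.path.inj c (by omega)) (hs m hm c (by omega)) ?_ ?_
        (ihc (by omega)) s
      · intro p hp
        rw [upperPart_of_le D₁ (by omega)]
        exact hL₁.links c (by omega) p (hsub p hp)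
      · exact (hL₁.inj (c + 1) (by omega)).mono fun p hp => hsub p hp
  · push Not at hs
    obtain ⟨m, hm, c, hc, p, hp, hmp, q, hq, hqm, hpq, hno⟩ := hs
    obtain ⟨u', i', h1, h2⟩ := h.exists_lt (a := u c q) (by omega) (by omega) hc hq rfl hp rfl hpq
      fun q' k1 k2 => by
        have k3 := hno q' k1 k2
        rcases Nat.lt_or_eq_of_le k3 with k4 | rfl
        · exact k4
        · omega
    exact ih _ (hw ▸ h2) h1 rfl

/-- Suppose that the cells `(e + 1, r₂)` of `D₁` and `(e + 1, r₁)` of `D₂`, with `r₁ < r₂`, are the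
only difference between two diagrams with good labelings. If `(e + 1, r₂)` abuts a label `i ≤ k` for
a good labeling of `D₂`, and `i` does not occur above row `r₁` in that column, then `(e + 2, r₁)`
abuts a label `≤ k` for some good labeling of `D₁`.

Above row `r₁` one uses the given labeling of `D₂`, with the label `i` moved to `(e + 1, r₂)`, after
uncrossing it for the labels below `i`; the rest is filled greedily. The labels `≥ i` then do as well
as in the labeling of `D₂`, since the loss of the cell `(e + 1, r₁)` is made up for by `i`, and
the labels `< i` do as well as in the labeling of `D₁`. -/
theorem reach_of_exchange {n : ℕ} {b : ℕ → ℕ → ℕ} {k N : ℕ} {D₁ D₂ : ℕ → Finset ℕ}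
    {L₁ L₂ : ℕ → ℕ → ℕ} {e r₁ r₂ i : ℕ} {Q : Finset ℕ} (hn : e + 2 ≤ n) (hr : r₁ < r₂)
    (hQ₁ : r₁ ∉ Q) (hQ₂ : r₂ ∉ Q) (hD₁ : D₁ (e + 1) = insert r₂ Q) (hD₂ : D₂ (e + 1) = insert r₁ Q)
    (hD : ∀ c, c ≠ e + 1 → D₁ c = D₂ c) (hN : ∀ p ∈ D₁ 0, p ≤ N)
    (h₁ : IsGood n b D₁ L₁) (h₂ : IsGood n b D₂ L₂) (hi : i ≤ k)
    (hp : ∃ p ∈ D₂ e, r₂ ≤ p ∧ L₂ e p = i)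
    (hq : ∀ q ∈ D₂ (e + 1), L₂ (e + 1) q = i → q ≤ r₁) : Reach n b k D₁ (e + 1) r₁ := by
  obtain ⟨p₀, hp₀, hrp₀, hip₀⟩ := hp
  set V := upperPart D₁ e r₁ with hV
  have hVe : ∀ c ≤ e, V c = D₁ c := fun c hc => upperPart_of_le D₁ hc
  have hV1 : ∀ p, p ∈ V (e + 1) ↔ p ∈ D₁ (e + 1) ∧ r₁ < p := fun p => mem_upperPart (by omega)
  have hV2 : ∀ p, p ∈ V (e + 2) ↔ p ∈ D₁ (e + 2) ∧ r₁ < p := fun p => mem_upperPart (by omega)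
  have hV1' : ∀ p, p ∈ V (e + 1) ↔ p = r₂ ∨ p ∈ D₂ (e + 1) ∧ r₁ < p ∧ p ≠ r₂ := by
    intro p
    rw [hV1, hD₁, hD₂, Finset.mem_insert, Finset.mem_insert]
    constructor
    · rintro ⟨rfl | h1, h2⟩
      · exact Or.inl rfl
      · by_cases h3 : p = r₂
        · exact Or.inl h3
        · exact Or.inr ⟨Or.inr h1, h2, h3⟩
    · rintro (rfl | ⟨rfl | h1, h2, _⟩)
      · exact ⟨Or.inl rfl, hr⟩
      · omega
      · exact ⟨Or.inr h1, h2⟩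
  -- the labeling of `D₂`, with `i` moved to `(e + 1, r₂)`
  have start : Reserve D₁ D₂ L₂ e r₁ k (Function.update L₂ (e + 1)
      (Function.update (L₂ (e + 1)) r₂ i)) i := by
    set u := Function.update L₂ (e + 1) (Function.update (L₂ (e + 1)) r₂ i) with hu
    have uc : ∀ c, c ≠ e + 1 → u c = L₂ c := fun c hc => Function.update_of_ne hc _ _
    have u1 : u (e + 1) = Function.update (L₂ (e + 1)) r₂ i := Function.update_self _ _ _
    have ur : u (e + 1) r₂ = i := by rw [u1, Function.update_self]
    have un : ∀ p, p ≠ r₂ → u (e + 1) p = L₂ (e + 1) p := fun p hp => by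
      rw [u1, Function.update_of_ne hp]
    have hni : ∀ p ∈ D₂ (e + 1), r₁ < p → L₂ (e + 1) p ≠ i := fun p h1 h2 h3 => by
      have := hq p h1 h3
      omega
    have hcount : ∀ m, lowCount (D₂ (e + 1)) (L₂ (e + 1)) m (r₁ + 1) + (if i ≤ m then 1 else 0) ≤
        lowCount (V (e + 1)) (u (e + 1)) m 0 := by
      intro m
      have hsub : ∀ p, p ∈ D₂ (e + 1) → r₁ + 1 ≤ p → L₂ (e + 1) p ≤ m →
          p ∈ (V (e + 1)).filter fun p => 0 ≤ p ∧ u (e + 1) p ≤ m := by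
        intro p k1 k2 k3
        have hne : p ≠ r₂ := by
          rintro rfl
          rw [hD₂, Finset.mem_insert] at k1
          rcases k1 with k1 | k1
          · omega
          · exact hQ₂ k1
        exact Finset.mem_filter.2 ⟨(hV1' p).2 (Or.inr ⟨k1, k2, hne⟩), by omega, by rwa [un p hne]⟩
      have hr2 : r₂ ∉ D₂ (e + 1) := by
        rw [hD₂, Finset.mem_insert]
        rintro (rfl | h)
        · omega
        · exact hQ₂ h
      split_ifs with him
      · unfold lowCount
        rw [← Finset.card_insert_of_notMem (a := r₂) (by simp [hr2])]
        apply Finset.card_le_card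
        intro p
        rw [Finset.mem_insert, Finset.mem_filter]
        rintro (rfl | ⟨k1, k2, k3⟩)
        · exact Finset.mem_filter.2 ⟨(hV1' p).2 (Or.inl rfl), by omega, by rwa [ur]⟩
        · exact hsub p k1 k2 k3
      · apply Finset.card_le_card
        intro p
        rw [Finset.mem_filter]
        rintro ⟨k1, k2, k3⟩
        exact hsub p k1 k2 k3
    refine ⟨⟨fun p hp => ?_, fun c hc => ?_, fun c hc => ?_⟩, hi, ⟨r₂, (hV1' r₂).2 (Or.inl rfl), ur⟩,
      fun q hq hqi => ?_, fun c hc m s => ?_, hcount, fun m s hs => ?_⟩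
    · rw [uc 0 (by omega)]
      rw [upperPart_of_le D₁ (Nat.zero_le e), hD 0 (by omega)] at hp
      exact h₂.path.base p hp
    · by_cases hce : c = e + 1
      · subst hce
        intro x hx y hy hxy
        have hx' := (hV1' x).1 hx
        have hy' := (hV1' y).1 hy
        rcases hx' with rfl | ⟨x1, x2, x3⟩ <;> rcases hy' with rfl | ⟨y1, y2, y3⟩
        · rfl
        · rw [ur, un y y3] at hxy
          exact absurd hxy.symm (hni y y1 y2)
        · rw [ur, un x x3] at hxy
          exact absurd hxy (hni x x1 x2)
        · rw [un x x3, un y y3] at hxy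
          exact h₂.path.inj (e + 1) (by omega) x1 y1 hxy
      · rw [uc c hce]
        refine (h₂.path.inj c (by omega)).mono fun p hp => ?_
        rw [← hD c hce]
        simp only [upperPart] at hp
        split_ifs at hp
        · exact hp
        · exact (Finset.mem_filter.1 hp).1
    · by_cases hce : c = e + 1
      · subst hce
        intro q hq
        obtain ⟨q1, q2⟩ := (hV2 q).1 hq
        rw [hD (e + 2) (by omega)] at q1
        obtain ⟨p, k1, k2, k3⟩ := h₂.path.links (e + 1) (by omega) q q1
        have hne : p ≠ r₂ := by
          rintro rfl
          rw [hD₂, Finset.mem_insert] at k1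
          rcases k1 with k1 | k1
          · omega
          · exact hQ₂ k1
        refine ⟨p, (hV1' p).2 (Or.inr ⟨k1, by omega, hne⟩), k2, ?_⟩
        rw [un p hne, uc (e + 1 + 1) (by omega), k3]
      · rw [uc c hce, ← hV, hVe c (by omega), hD c hce]
        by_cases hce' : c = e
        · subst hce'
          intro q hq
          rcases (hV1' q).1 hq with rfl | ⟨q1, q2, q3⟩
          · exact ⟨p₀, hp₀, hrp₀, by rw [hip₀, ur]⟩
          · rw [un q q3]
            exact h₂.path.links c (by omega) q q1
        · rw [uc (c + 1) (by omega), hVe (c + 1) (by omega), hD (c + 1) (by omega)]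
          exact h₂.path.links c (by omega)
    · obtain ⟨q1, q2⟩ := (hV2 q).1 hq
      rw [hD (e + 2) (by omega)] at q1
      rw [uc (e + 2) (by omega)] at hqi
      obtain ⟨p, k1, k2, k3⟩ := h₂.path.links (e + 1) (by omega) q q1
      exact hni p k1 (by omega) (k3.trans hqi)
    · rw [uc c (by omega), hD c (by omega)]
    · rw [lowCount_upperPart_of_lt (by omega) _ _ hs, uc (e + 2) (by omega), hD (e + 2) (by omega)]
  obtain ⟨u, i', hu, hmax⟩ := start.exists_maximal (h₁.path.mono hn)
  have hfil1 : (D₁ (e + 1)).filter (fun p => r₁ + 1 ≤ p) = V (e + 1) := by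
    ext p
    rw [hV1, Finset.mem_filter]
    rfl
  have hfil2 : (D₁ (e + 2)).filter (fun p => r₁ + 1 ≤ p) = V (e + 2) := by
    ext p
    rw [hV2, Finset.mem_filter]
    rfl
  have hue : PathLabeling e D₁ u :=
    (hu.path.mono (by omega)).congr (fun c hc => (hVe c hc).symm) fun _ _ _ _ => rfl
  obtain ⟨g, g1, g2, g3, g4⟩ := exists_greedy_labels (A := D₁ e) (B := D₁ (e + 1)) (f := u e)
    (hue.inj e le_rfl) (r₁ + 1) (u (e + 1)) (by rw [hfil1]; exact hu.path.inj (e + 1) (by omega))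
    (by rw [hfil1, ← hVe e le_rfl]; exact hu.path.links e (by omega))
    fun r _ => h₁.path.card_succ_le (by omega) r
  obtain ⟨g', k1, k2, k3, k4⟩ := exists_greedy_labels (A := D₁ (e + 1)) (B := D₁ (e + 2)) (f := g)
    g2 (r₁ + 1) (u (e + 2)) (by rw [hfil2]; exact hu.path.inj (e + 2) (by omega))
    (by
      rw [hfil2]
      intro q hq
      obtain ⟨p, p1, p2, p3⟩ := hu.path.links (e + 1) (by omega) q hq
      have hp' := (hV1 p).1 p1
      exact ⟨p, hp'.1, p2, by rw [g1 p hp'.2]; exact p3⟩)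
    fun r _ => h₁.path.card_succ_le (by omega) r
  -- comparison in column `e + 1`
  have hmid : ∀ m r, r ≤ r₁ →
      lowCount (D₂ (e + 1)) (L₂ (e + 1)) m r ≤ lowCount (D₁ (e + 1)) g m r ∨
      lowCount (D₁ (e + 1)) (L₁ (e + 1)) m r ≤ lowCount (D₁ (e + 1)) g m r := by
    intro m r hrr
    have c0 : lowCount (D₁ (e + 1)) g m (r₁ + 1) = lowCount (V (e + 1)) (u (e + 1)) m 0 := by
      rw [lowCount_upperPart (by omega) _ _ (Nat.zero_le _)]
      exact lowCount_congr m fun p _ hp => g1 p hp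
    rcases g4 m r (by omega) with h | ⟨r', a1, a2, a3⟩
    · rcases Nat.lt_or_ge m i' with hm | hm
      · right
        have c1 := hmax m hm
        rw [← hV] at c1
        have c2 := lowCount_split (D₁ (e + 1)) (L₁ (e + 1)) m r (r₁ + 1)
        omega
      · left
        have c1 := hu.mid m
        rw [if_pos hm, ← hV] at c1
        have c2 := lowCount_split (D₂ (e + 1)) (L₂ (e + 1)) m r (r₁ + 1)
        have c3 : rowCount (D₂ (e + 1)) r r₁ = rowCount (D₁ (e + 1)) r r₁ := by
          rw [hD₁, hD₂]
          apply rowCount_congr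
          intro p _ hp
          simp only [Finset.mem_insert]
          constructor <;> rintro (rfl | h)
          · omega
          · exact Or.inr h
          · omega
          · exact Or.inr h
        have c4 := rowCount_add (D₂ (e + 1)) hrr (Nat.le_succ r₁)
        have c5 := rowCount_add (D₁ (e + 1)) hrr (Nat.le_succ r₁)
        have c6 := rowCount_le_one (D₂ (e + 1)) r₁
        simp only [Nat.succ_eq_add_one] at c4 c5
        omega
    · left
      have c1 := hu.left e le_rfl m r'
      have c2 := h₂.path.lowCount_succ_le (c := e) (by omega) m r'
      have c3 := lowCount_split (D₂ (e + 1)) (L₂ (e + 1)) m r r'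
      have c4 : rowCount (D₂ (e + 1)) r r' = rowCount (D₁ (e + 1)) r r' := by
        rw [hD₁, hD₂]
        apply rowCount_congr
        intro p _ hp
        simp only [Finset.mem_insert]
        constructor <;> rintro (rfl | h)
        · omega
        · exact Or.inr h
        · omega
        · exact Or.inr h
      omega
  let Di : Bool → ℕ → Finset ℕ := fun t => if t then D₁ else D₂
  let Li : Bool → ℕ → ℕ → ℕ := fun t => if t then L₁ else L₂
  have hgood : ∀ t, IsGood n b (Di t) (Li t) := by
    rintro (_ | _)
    · exact h₂
    · exact h₁
  have hDi : ∀ t c, c ≠ e + 1 → Di t c = D₁ c := by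
    rintro (_ | _) c hc
    · exact (hD c hc).symm
    · rfl
  have hmid' : ∀ m r, r ≤ r₁ → ∃ t, lowCount (Di t (e + 1)) (Li t (e + 1)) m r ≤
      lowCount (D₁ (e + 1)) g m r := by
    intro m r hrr
    rcases hmid m r hrr with h | h
    · exact ⟨false, h⟩
    · exact ⟨true, h⟩
  -- comparison in column `e + 2`
  have hdom : ∀ m r, ∃ t, lowCount (Di t (e + 2)) (Li t (e + 2)) m r ≤
      lowCount (D₁ (e + 2)) g' m r := by
    intro m r
    rcases Nat.lt_or_ge r₁ r with hrr | hrr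
    · refine ⟨false, (hu.right m r hrr).trans ?_⟩
      rw [lowCount_upperPart_of_lt (by omega) _ _ hrr]
      exact (lowCount_congr m fun p _ hp => (k1 p (by omega)).symm).le
    · rcases k4 m r (by omega) with h | ⟨r', a1, a2, a3⟩
      · refine ⟨false, ?_⟩
        have c1 := hu.right m (r₁ + 1) (by omega)
        rw [lowCount_upperPart_of_lt (by omega) _ _ (by omega)] at c1
        have c2 := lowCount_split (D₂ (e + 2)) (L₂ (e + 2)) m r (r₁ + 1)
        have c3 : lowCount (D₁ (e + 2)) g' m (r₁ + 1) = lowCount (D₁ (e + 2)) (u (e + 2)) m (r₁ + 1) :=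
          lowCount_congr m fun p _ hp => k1 p hp
        rw [← hD (e + 2) (by omega)] at c1 c2
        change lowCount (D₂ (e + 2)) (L₂ (e + 2)) m r ≤ _
        rw [← hD (e + 2) (by omega)]
        omega
      · obtain ⟨t, ht⟩ := hmid' m r' (by omega)
        refine ⟨t, ?_⟩
        have c1 := lowCount_split (Di t (e + 2)) (Li t (e + 2)) m r r'
        have c2 : lowCount (Di t (e + 2)) (Li t (e + 2)) m r' ≤ _ :=
          (hgood t).path.lowCount_succ_le (c := e + 1) (by omega) m r'
        rw [hDi t (e + 2) (by omega)] at c1 c2 ⊢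
        omega
  obtain ⟨L, l1, l2, l3⟩ := PathLabeling.exists_extension (N := N) hn
    ((hue.update_succ g2 g3).update_succ (g := g') k2
      (by rw [Function.update_self]; exact k3)) Di Li (fun t => (hgood t).path)
    (fun t p hp => hN p (by rwa [hDi t 0 (by omega)] at hp)) (fun t c hc => hDi t c (by omega))
    (fun m r => by rw [Function.update_self]; exact hdom m r)
  have Le2 : L (e + 2) = g' := by rw [l2 (e + 2) le_rfl, Function.update_self]
  have Le1 : L (e + 1) = g := by
    rw [l2 (e + 1) (by omega), Function.update_of_ne (by omega), Function.update_self]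
  refine ⟨L, ⟨l1, fun c hc hcn m => ?_⟩, i', hu.le, ?_, fun q hq hqi => ?_⟩
  · rcases Nat.lt_or_ge e c with h | h
    · rcases Nat.lt_or_ge (e + 1) c with h' | h'
      · obtain ⟨t, ht⟩ := l3 c (by omega) hcn m 0
        exact ((hgood t).bound c hc hcn m).trans ht
      · obtain rfl : c = e + 1 := by omega
        obtain ⟨t, ht⟩ := hmid' m 0 (Nat.zero_le _)
        rw [Le1]
        exact ((hgood t).bound (e + 1) hc hcn m).trans ht
    · rw [l2 c (by omega), Function.update_of_ne (by omega), Function.update_of_ne (by omega)]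
      exact (h₂.bound c hc hcn m).trans (hu.left c h m 0)
  · obtain ⟨p, p1, p2⟩ := hu.mem
    have hp' := (hV1 p).1 p1
    exact ⟨p, hp'.1, hp'.2.le, by rw [Le1, g1 p hp'.2, p2]⟩
  · by_contra hcon
    rw [show e + 1 + 1 = e + 2 from rfl, Le2, k1 q (by omega)] at hqi
    exact hu.notMem q ((hV2 q).2 ⟨hq, by omega⟩) hqi

/-! ### Runs of the rectification and their uniqueness -/

/-- The columns of `T`, as sets of rows, with a virtual column `0` that holds the rows
`1, …, N`. -/
def cols (N : ℕ) (T : Diagram) (c : ℕ) : Finset ℕ :=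
  if c = 0 then Finset.Icc 1 N else (T.filter fun x => x.1 = c).image Prod.snd

theorem cols_zero (N : ℕ) (T : Diagram) : cols N T 0 = Finset.Icc 1 N := if_pos rfl

theorem mem_cols {N : ℕ} {T : Diagram} {c p : ℕ} (h : 1 ≤ c) : p ∈ cols N T c ↔ (c, p) ∈ T := by
  unfold cols
  rw [if_neg (by omega)]
  simp only [Finset.mem_image, Finset.mem_filter, Prod.exists, exists_eq_right]

theorem cols_congr {N : ℕ} {T U : Diagram} {c : ℕ} (h : ∀ p, (c, p) ∈ T ↔ (c, p) ∈ U) :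
    cols N T c = cols N U c := by
  rcases Nat.eq_zero_or_pos c with rfl | hc
  · rw [cols_zero, cols_zero]
  · ext p
    rw [mem_cols hc, mem_cols hc, h]

theorem cols_insert_self {N : ℕ} {T : Diagram} {x : Cell} (h : 1 ≤ x.1) :
    cols N (insert x T) x.1 = insert x.2 (cols N T x.1) := by
  ext p
  rw [mem_cols h, Finset.mem_insert, Finset.mem_insert, mem_cols h, Prod.ext_iff]
  simp

theorem cols_insert_of_ne {N : ℕ} {T : Diagram} {x : Cell} {c : ℕ} (h : c ≠ x.1) :
    cols N (insert x T) c = cols N T c := by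
  apply cols_congr
  intro p
  rw [Finset.mem_insert, Prod.ext_iff]
  simp [h]

/-- Diagrams with a good labeling whose columns have the sizes `s`. -/
structure Admissible (N n : ℕ) (b : ℕ → ℕ → ℕ) (s : ℕ → ℕ) (T : Diagram) : Prop where
  good : ∃ L, IsGood n b (cols N T) L
  pos : ∀ x ∈ T, 1 ≤ x.1 ∧ 1 ≤ x.2
  card : ∀ c, 1 ≤ c → (cols N T c).card = s c

/-- An admissible diagram together with a vacant position in one of the columns `1, …, n`. -/
structure IsState (N n : ℕ) (b : ℕ → ℕ → ℕ) (s : ℕ → ℕ) (T : Diagram) (x : Cell) : Prop where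
  adm : Admissible N n b s T
  vacant : x ∉ T
  col_pos : 1 ≤ x.1
  col_le : x.1 ≤ n
  row_pos : 1 ≤ x.2

/-- For some good labeling of `T`, the position `x` abuts a label `i ≤ k` that does not occur in the
column of `x`. -/
def CanLand (N n : ℕ) (b : ℕ → ℕ → ℕ) (k : ℕ) (T : Diagram) (x : Cell) : Prop :=
  ∃ L, IsGood n b (cols N T) L ∧ ∃ i ≤ k, (∃ p ∈ cols N T (x.1 - 1), x.2 ≤ p ∧ L (x.1 - 1) p = i) ∧
    ∀ q ∈ cols N T x.1, L x.1 q ≠ i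

/-- For some good labeling of `T`, the position `x` abuts a label `i ≤ k` whose cell in the column
of `x` is in row `p`. -/
def CanBump (N n : ℕ) (b : ℕ → ℕ → ℕ) (k : ℕ) (T : Diagram) (x : Cell) (p : ℕ) : Prop :=
  p < x.2 ∧ (x.1, p) ∈ T ∧ ∃ L, IsGood n b (cols N T) L ∧ L x.1 p ≤ k ∧
    ∃ q ∈ cols N T (x.1 - 1), x.2 ≤ q ∧ L (x.1 - 1) q = L x.1 p

/-- `Run N n b k T x U`: the position `x` can be rectified into `T` with result `U`, where the cell
that is bumped may be any one, not only the lowest. -/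
inductive Run (N n : ℕ) (b : ℕ → ℕ → ℕ) (k : ℕ) : Diagram → Cell → Diagram → Prop
  | land {T : Diagram} {x : Cell} (h : CanLand N n b k T x) : Run N n b k T x (insert x T)
  | bump {T U : Diagram} {x : Cell} {p : ℕ} (h : CanBump N n b k T x p)
      (hr : Run N n b k ((insert x T).erase (x.1, p)) (x.1, p) U) : Run N n b k T x U
  | pass {T U : Diagram} {x : Cell} {d : ℕ} (h : ¬ Reach n b k (cols N T) (x.1 - 1) x.2)
      (hd : d < x.1) (hd' : 1 ≤ d) (hv : (d, x.2) ∉ T) (hf : ∀ e, d < e → e < x.1 → (e, x.2) ∈ T)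
      (hr : Run N n b k T (d, x.2) U) : Run N n b k T x U

/-- Some number of bumps within a column. -/
inductive Bumps (N n : ℕ) (b : ℕ → ℕ → ℕ) (k : ℕ) (T : Diagram) (x : Cell) :
    Diagram → Cell → Prop
  | refl : Bumps N n b k T x T x
  | step {T' : Diagram} {x' : Cell} {p : ℕ} (hb : Bumps N n b k T x T' x')
      (h : CanBump N n b k T' x' p) :
      Bumps N n b k T x ((insert x' T').erase (x'.1, p)) (x'.1, p)

/-- The states, reached by rectification from `(T₀, x₀)`, in which the position has just entered its
column. -/
inductive Arrives (N n : ℕ) (b : ℕ → ℕ → ℕ) (k : ℕ) (T₀ : Diagram) (x₀ : Cell) :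
    Diagram → Cell → Prop
  | start : Arrives N n b k T₀ x₀ T₀ x₀
  | pass {T T' : Diagram} {x x' : Cell} {d : ℕ} (ha : Arrives N n b k T₀ x₀ T x)
      (hb : Bumps N n b k T x T' x') (h : ¬ Reach n b k (cols N T') (x'.1 - 1) x'.2)
      (hd : d < x'.1) (hd' : 1 ≤ d) (hv : (d, x'.2) ∉ T')
      (hf : ∀ e, d < e → e < x'.1 → (e, x'.2) ∈ T') : Arrives N n b k T₀ x₀ T' (d, x'.2)

theorem Run.exists_arrives {N n : ℕ} {b : ℕ → ℕ → ℕ} {k : ℕ} {T₀ : Diagram} {x₀ : Cell}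
    {T' U : Diagram} {x' : Cell} (h : Run N n b k T' x' U) : ∀ {T : Diagram} {x : Cell},
    Arrives N n b k T₀ x₀ T x → Bumps N n b k T x T' x' →
    ∃ T₁ x₁ T₂ x₂, Arrives N n b k T₀ x₀ T₁ x₁ ∧ Bumps N n b k T₁ x₁ T₂ x₂ ∧
      CanLand N n b k T₂ x₂ ∧ U = insert x₂ T₂ := by
  induction h with
  | land h => exact fun ha hb => ⟨_, _, _, _, ha, hb, h, rfl⟩
  | bump h _ ih => exact fun ha hb => ih ha (hb.step h)
  | pass h hd hd' hv hf _ ih => exact fun ha hb => ih (ha.pass hb h hd hd' hv hf) .refl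

theorem IsState.bump {N n : ℕ} {b : ℕ → ℕ → ℕ} {s : ℕ → ℕ} {k : ℕ} {T : Diagram} {x : Cell}
    {p : ℕ} (hs : IsState N n b s T x) (h : CanBump N n b k T x p) :
    IsState N n b s ((insert x T).erase (x.1, p)) (x.1, p) := by
  obtain ⟨hpx, hpT, L, hL, hk, q, hq, hxq, hqL⟩ := h
  obtain ⟨c, hc⟩ : ∃ c, x.1 = c + 1 := ⟨x.1 - 1, by have := hs.col_pos; omega⟩
  have hvac := hs.vacant
  have hrow := hs.row_pos
  have hcol := hs.col_le
  obtain ⟨x1, r⟩ := x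
  simp only at hc hpx hpT hk hq hxq hqL hvac hrow hcol ⊢
  subst hc
  simp only [Nat.add_sub_cancel] at hq hqL
  set T' := (insert (c + 1, r) T).erase (c + 1, p) with hT'
  have hmem : ∀ y, y ∈ T' ↔ y ≠ (c + 1, p) ∧ (y = (c + 1, r) ∨ y ∈ T) := by
    intro y
    rw [hT', Finset.mem_erase, Finset.mem_insert]
  have hcols : ∀ d, d ≠ c + 1 → cols N T' d = cols N T d := by
    intro d hd
    apply cols_congr
    intro y
    rw [hmem]
    simp [hd]
  have hcol1 : ∀ y, y ∈ cols N T' (c + 1) ↔ y = r ∨ y ≠ p ∧ y ≠ r ∧ y ∈ cols N T (c + 1) := by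
    intro y
    rw [mem_cols (by omega), mem_cols (by omega), hmem]
    simp only [ne_eq, Prod.mk.injEq, true_and]
    constructor
    · rintro ⟨h1, rfl | h2⟩
      · exact Or.inl rfl
      · exact Or.inr ⟨h1, by rintro rfl; exact hvac h2, h2⟩
    · rintro (rfl | ⟨h1, h2, h3⟩)
      · exact ⟨by omega, Or.inl rfl⟩
      · exact ⟨h1, Or.inr h3⟩
  have hpc : p ∈ cols N T (c + 1) := (mem_cols (by omega)).2 hpT
  have hrc : r ∉ cols N T (c + 1) := fun h => hvac ((mem_cols (by omega)).1 h)
  have hcol1' : cols N T' (c + 1) = insert r ((cols N T (c + 1)).erase p) := by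
    ext y
    rw [hcol1, Finset.mem_insert, Finset.mem_erase]
    constructor
    · rintro (h | ⟨h1, _, h2⟩)
      · exact Or.inl h
      · exact Or.inr ⟨h1, h2⟩
    · rintro (h | ⟨h1, h2⟩)
      · exact Or.inl h
      · exact Or.inr ⟨h1, by rintro rfl; exact hrc h2, h2⟩
  refine ⟨⟨?_, fun y hy => ?_, fun d hd => ?_⟩, fun h => ((hmem _).1 h).1 rfl, by simp, hcol,
    (hs.adm.pos _ hpT).2⟩
  · -- the label of the bumped cell moves to the position `(c + 1, r)`
    set L' := Function.update L (c + 1) (Function.update (L (c + 1)) r (L (c + 1) p)) with hL'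
    have uc : ∀ d, d ≠ c + 1 → L' d = L d := fun d hd => Function.update_of_ne hd _ _
    have ur : L' (c + 1) r = L (c + 1) p := by
      rw [hL', Function.update_self, Function.update_self]
    have un : ∀ y, y ≠ r → L' (c + 1) y = L (c + 1) y := fun y hy => by
      rw [hL', Function.update_self, Function.update_of_ne hy]
    have hinj := hL.path.inj (c + 1) hcol
    refine ⟨L', ⟨fun y hy => ?_, fun d hd => ?_, fun d hd => ?_⟩, fun d hd hdn m => ?_⟩
    · rw [uc 0 (by omega)]
      rw [hcols 0 (by omega)] at hy
      exact hL.path.base y hy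
    · by_cases hdc : d = c + 1
      · subst hdc
        intro y hy z hz hyz
        rcases (hcol1 y).1 hy with rfl | ⟨y1, y2, y3⟩ <;> rcases (hcol1 z).1 hz with rfl | ⟨z1, z2, z3⟩
        · rfl
        · rw [ur, un z z2] at hyz
          exact absurd (hinj hpc z3 hyz).symm z1
        · rw [ur, un y y2] at hyz
          exact absurd (hinj y3 hpc hyz) y1
        · rw [un y y2, un z z2] at hyz
          exact hinj y3 z3 hyz
      · rw [uc d hdc, hcols d hdc]
        exact hL.path.inj d hd
    · by_cases hdc : d = c + 1
      · subst hdc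
        intro y hy
        rw [hcols _ (by omega)] at hy
        rw [uc (c + 1 + 1) (by omega)]
        obtain ⟨z, z1, z2, z3⟩ := hL.path.links (c + 1) hd y hy
        by_cases hzp : z = p
        · subst hzp
          exact ⟨r, (hcol1 r).2 (Or.inl rfl), by omega, by rw [ur, z3]⟩
        · have hzr : z ≠ r := by rintro rfl; exact hrc z1
          exact ⟨z, (hcol1 z).2 (Or.inr ⟨hzp, hzr, z1⟩), z2, by rw [un z hzr, z3]⟩
      · rw [uc d hdc, hcols d hdc]
        by_cases hdc' : d = c
        · subst hdc'
          intro y hy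
          rcases (hcol1 y).1 hy with rfl | ⟨y1, y2, y3⟩
          · exact ⟨q, hq, hxq, by rw [ur, hqL]⟩
          · rw [un y y2]
            exact hL.path.links d hd y y3
        · rw [uc (d + 1) (by omega), hcols (d + 1) (by omega)]
          exact hL.path.links d hd
    · refine (hL.bound d hd hdn m).trans ?_
      by_cases hdc : d = c + 1
      · subst hdc
        apply Finset.card_le_card_of_injOn fun y => if y = p then r else y
        · intro y hy
          simp only [Finset.coe_filter, Set.mem_ofPred_eq] at hy ⊢
          split_ifs with h
          · subst h
            exact ⟨(hcol1 r).2 (Or.inl rfl), by omega, by rw [ur]; exact hy.2.2⟩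
          · have hyr : y ≠ r := by rintro rfl; exact hrc hy.1
            exact ⟨(hcol1 y).2 (Or.inr ⟨h, hyr, hy.1⟩), by omega, by rw [un y hyr]; exact hy.2.2⟩
        · intro y hy z hz hyz
          simp only [Finset.coe_filter, Set.mem_ofPred_eq] at hy hz hyz
          split_ifs at hyz with h1 h2 h2
          · rw [h1, h2]
          · subst hyz; exact absurd hz.1 hrc
          · subst hyz; exact absurd hy.1 hrc
          · exact hyz
      · rw [uc d hdc, hcols d hdc]
  · obtain ⟨_, rfl | h⟩ := (hmem y).1 hy
    · exact ⟨by simp, hrow⟩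
    · exact hs.adm.pos y h
  · by_cases hdc : d = c + 1
    · subst hdc
      rw [← hs.adm.card (c + 1) hd, hcol1', Finset.card_insert_of_notMem, Finset.card_erase_of_mem hpc]
      · have := Finset.card_pos.2 ⟨p, hpc⟩
        omega
      · exact fun h => hrc (Finset.mem_of_mem_erase h)
    · rw [hcols d hdc]
      exact hs.adm.card d hd

theorem Bumps.isState {N n : ℕ} {b : ℕ → ℕ → ℕ} {s : ℕ → ℕ} {k : ℕ} {T T' : Diagram} {x x' : Cell}
    (h : Bumps N n b k T x T' x') (hs : IsState N n b s T x) :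
    IsState N n b s T' x' ∧ x'.1 = x.1 ∧ x'.2 ≤ x.2 ∧ insert x' T' = insert x T := by
  induction h with
  | refl => exact ⟨hs, rfl, le_rfl, rfl⟩
  | step hb h ih =>
    obtain ⟨h1, h2, h3, h4⟩ := ih
    refine ⟨h1.bump h, h2, h.1.le.trans h3, ?_⟩
    rw [Finset.insert_erase (Finset.mem_insert_of_mem h.2.1), h4]

/-- If `(T₁, x)` was left alone by the column to the right of `x`, then the rectification of another
state with the same cells and a higher position neither lands nor gets down to the row of `x` within
this column. -/
theorem Bumps.lt_of_not_reach {N n : ℕ} {b : ℕ → ℕ → ℕ} {s : ℕ → ℕ} {k : ℕ} {T₁ : Diagram}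
    {x : Cell} (h₁ : IsState N n b s T₁ x) (hxn : x.1 < n)
    (hx : ¬ Reach n b k (cols N T₁) x.1 x.2) {T₂ T : Diagram} {y z : Cell}
    (h₂ : IsState N n b s T₂ y) (hxy : x.1 = y.1) (hlt : x.2 < y.2)
    (hins : insert x T₁ = insert y T₂) (hb : Bumps N n b k T₂ y T z) :
    x.2 < z.2 ∧ ¬ CanLand N n b k T z := by
  -- no label `≤ k` that abuts `z` has its cell in this column weakly below `x`
  have key : ∀ T z, IsState N n b s T z → z.1 = x.1 → insert z T = insert x T₁ → x.2 < z.2 →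
      ∀ L, IsGood n b (cols N T) L → ∀ i ≤ k,
      (∃ p ∈ cols N T (x.1 - 1), z.2 ≤ p ∧ L (x.1 - 1) p = i) →
      ¬ ∀ q ∈ cols N T x.1, L x.1 q = i → q ≤ x.2 := by
    intro T z hT hzx hins hxz L hL i hi hp hq
    obtain ⟨e, he⟩ : ∃ e, x.1 = e + 1 := ⟨x.1 - 1, by have := h₁.col_pos; omega⟩
    obtain ⟨L₁, hL₁⟩ := h₁.adm.good
    apply hx
    have c1 := cols_insert_self (N := N) (T := T₁) h₁.col_pos
    have c2 := cols_insert_self (N := N) (T := T) hT.col_pos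
    rw [hins, hzx, c1] at c2
    have n1 : x.2 ∉ cols N T₁ x.1 := fun h => h₁.vacant ((mem_cols h₁.col_pos).1 h)
    have n2 : z.2 ∉ cols N T x.1 := fun h => hT.vacant (by
      rw [← hzx] at h
      exact (mem_cols hT.col_pos).1 h)
    rw [he] at c2 n1 n2 hp hq ⊢
    rw [Nat.add_sub_cancel] at hp
    refine reach_of_exchange (N := N) (r₂ := z.2) (Q := (cols N T₁ (e + 1)).erase z.2) (by omega) hxz
      (fun h => n1 (Finset.mem_of_mem_erase h)) (Finset.notMem_erase _ _) ?_ ?_ ?_ ?_ hL₁ hL hi hp hq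
    · rw [Finset.insert_erase]
      have : z.2 ∈ insert x.2 (cols N T₁ (e + 1)) := by rw [c2]; exact Finset.mem_insert_self _ _
      rcases Finset.mem_insert.1 this with h | h
      · omega
      · exact h
    · rw [← Finset.erase_insert n2, ← c2, Finset.erase_insert_of_ne (by omega)]
    · intro c hc
      rw [← cols_insert_of_ne (x := x) (by omega), ← hins, cols_insert_of_ne (by omega)]
    · intro p hp
      rw [cols_zero, Finset.mem_Icc] at hp
      exact hp.2
  have hz : x.2 < z.2 := by
    induction hb with
    | refl => exact hlt
    | @step T' x' p hb h ih =>
      obtain ⟨k1, k2, k3, k4⟩ := hb.isState h₂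
      by_contra hcon
      obtain ⟨h3, h4, L, hL, h5, h6⟩ := h
      rw [k2, ← hxy] at h4 h5 h6
      refine key T' x' k1 (by omega) (k4.trans hins.symm) ih L hL _ h5 h6 fun q hq hqp => ?_
      rw [hL.path.inj x.1 hxn.le hq ((mem_cols h₁.col_pos).2 h4) hqp]
      simpa using hcon
  refine ⟨hz, ?_⟩
  rintro ⟨L, hL, i, hi, hp, hq⟩
  obtain ⟨k1, k2, k3, k4⟩ := hb.isState h₂
  rw [k2, ← hxy] at hp hq
  exact key T z k1 (by omega) (k4.trans hins.symm) hz L hL i hi hp fun q h1 h2 => absurd h2 (hq q h1)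

theorem Arrives.isState {N n : ℕ} {b : ℕ → ℕ → ℕ} {s : ℕ → ℕ} {k : ℕ} {T₀ T : Diagram} {x₀ x : Cell}
    (h : Arrives N n b k T₀ x₀ T x) (hs : IsState N n b s T₀ x₀) (hx₀ : x₀.1 = n) :
    IsState N n b s T x ∧ (x.1 = n ∨ x.1 < n ∧ ¬ Reach n b k (cols N T) x.1 x.2) := by
  induction h with
  | start => exact ⟨hs, Or.inl hx₀⟩
  | pass ha hb h hd hd' hv hf ih =>
    obtain ⟨h1, h2, h3, h4⟩ := hb.isState ih.1
    have := h1.col_le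
    refine ⟨⟨h1.adm, hv, hd', by simp only; omega, h1.row_pos⟩,
      Or.inr ⟨by simp only; omega, fun hr => h ?_⟩⟩
    refine hr.of_filled _ (by omega) (by omega) fun c k1 k2 => ?_
    rw [mem_cols (by omega)]
    exact hf c k1 (by omega)

/-- Within a column, the position at which a rectification enters is determined by the cells and by
the position at which it leaves, or by the fact that it lands. -/
theorem Arrives.eq_of_insert_eq {N n : ℕ} {b : ℕ → ℕ → ℕ} {s : ℕ → ℕ} {k : ℕ}
    (hsn : s n = 0) {S₀ T₀ S T S' T' : Diagram} {x₀ y₀ x y x' y' : Cell}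
    (hS₀ : IsState N n b s S₀ x₀) (hT₀ : IsState N n b s T₀ y₀) (hx₀ : x₀.1 = n) (hy₀ : y₀.1 = n)
    (hS : Arrives N n b k S₀ x₀ S x) (hT : Arrives N n b k T₀ y₀ T y) (hcol : x.1 = y.1)
    (hins : insert x S = insert y T) (hS' : Bumps N n b k S x S' x')
    (hT' : Bumps N n b k T y T' y')
    (hout : x'.2 = y'.2 ∨ CanLand N n b k S' x' ∧ CanLand N n b k T' y') : x = y ∧ S = T := by
  obtain ⟨s1, s2⟩ := hS.isState hS₀ hx₀
  obtain ⟨t1, t2⟩ := hT.isState hT₀ hy₀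
  have hempty : ∀ {T : Diagram} {x y : Cell}, IsState N n b s T x → x.1 = n → x.1 = y.1 →
      y ∈ insert x T → y.2 = x.2 := by
    intro T x y h h1 h2 h3
    rcases Finset.mem_insert.1 h3 with rfl | h4
    · rfl
    · have h5 := h.adm.card x.1 h.col_pos
      rw [h1, hsn, Finset.card_eq_zero] at h5
      have h6 : y.2 ∈ cols N T n := (mem_cols (by have := h.col_pos; omega)).2 (by
        rw [← h1, h2]; exact h4)
      rw [h5] at h6
      exact absurd h6 (by simp)
  have hrow : x.2 = y.2 := by
    rcases Nat.lt_trichotomy x.2 y.2 with h | h | h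
    · rcases s2 with s2 | ⟨s2, s3⟩
      · exact (hempty s1 s2 hcol (by rw [hins]; exact Finset.mem_insert_self _ _)).symm
      · obtain ⟨k1, k2⟩ := hT'.lt_of_not_reach s1 s2 s3 t1 hcol h hins
        have k3 := (hS'.isState s1).2.2.1
        rcases hout with h1 | h1
        · omega
        · exact absurd h1.2 k2
    · exact h
    · rcases t2 with t2 | ⟨t2, t3⟩
      · exact hempty t1 t2 hcol.symm (by rw [← hins]; exact Finset.mem_insert_self _ _)
      · obtain ⟨k1, k2⟩ := hS'.lt_of_not_reach t1 t2 t3 s1 hcol.symm h hins.symm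
        have k3 := (hT'.isState t1).2.2.1
        rcases hout with h1 | h1
        · omega
        · exact absurd h1.1 k2
  obtain rfl : x = y := Prod.ext hcol hrow
  refine ⟨rfl, ?_⟩
  rw [← Finset.erase_insert s1.vacant, hins, Finset.erase_insert t1.vacant]

theorem Arrives.start_eq {N n : ℕ} {b : ℕ → ℕ → ℕ} {s : ℕ → ℕ} {k : ℕ} (hsn : s n = 0)
    {S₀ T₀ T : Diagram} {x₀ y₀ x : Cell} (hS₀ : IsState N n b s S₀ x₀) (hT₀ : IsState N n b s T₀ y₀)
    (hx₀ : x₀.1 = n) (hy₀ : y₀.1 = n) (hS : Arrives N n b k S₀ x₀ T x)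
    (hT : Arrives N n b k T₀ y₀ T x) : S₀ = T₀ ∧ x₀ = y₀ := by
  induction hS with
  | start =>
    cases hT with
    | start => exact ⟨rfl, rfl⟩
    | pass ha hb h hd hd' hv hf =>
      have h1 := (hb.isState (ha.isState hT₀ hy₀).1).1.col_le
      simp only at hx₀
      omega
  | @pass A₁ T x₁ x₁' d ha hb h hd hd' hv hf ih =>
    have e1 := hb.isState (ha.isState hS₀ hx₀).1
    have c1 := e1.1.col_le
    generalize hz : (d, x₁'.2) = z at hT
    cases hT with
    | start =>
      rw [← hz] at hy₀
      simp only at hy₀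
      omega
    | @pass A₂ T x₂ x₂' d₂ ha₂ hb₂ h₂ hd₂ hd₂' hv₂ hf₂ =>
      have e2 := hb₂.isState (ha₂.isState hT₀ hy₀).1
      obtain ⟨rfl, hrow⟩ := Prod.mk.inj hz
      have hcol : x₁'.1 = x₂'.1 := by
        rcases Nat.lt_trichotomy x₁'.1 x₂'.1 with h3 | h3 | h3
        · exact absurd (by have := hf₂ x₁'.1 hd h3; rwa [← hrow] at this) e1.1.vacant
        · exact h3
        · exact absurd (by have := hf x₂'.1 hd₂ h3; rwa [hrow] at this) e2.1.vacant
      have hx : x₁' = x₂' := Prod.ext hcol hrow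
      obtain ⟨rfl, rfl⟩ := Arrives.eq_of_insert_eq hsn hS₀ hT₀ hx₀ hy₀ ha ha₂
        (by rw [← e1.2.1, ← e2.2.1, hcol]) (by rw [← e1.2.2.2, ← e2.2.2.2, hx]) hb hb₂ (Or.inl hrow)
      exact ih ha₂

/-- Rectifications of two positions in column `n` with the same result start from the same
diagram and the same position. -/
theorem Run.start_eq {N n : ℕ} {b : ℕ → ℕ → ℕ} {s : ℕ → ℕ} {k : ℕ} (hsn : s n = 0)
    {S₀ T₀ U : Diagram} {x₀ y₀ : Cell} (hS₀ : IsState N n b s S₀ x₀) (hT₀ : IsState N n b s T₀ y₀)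
    (hx₀ : x₀.1 = n) (hy₀ : y₀.1 = n) (hS : Run N n b k S₀ x₀ U) (hT : Run N n b k T₀ y₀ U) :
    S₀ = T₀ ∧ x₀ = y₀ := by
  obtain ⟨S₁, x₁, S₂, x₂, s1, s2, s3, rfl⟩ := hS.exists_arrives .start .refl
  obtain ⟨T₁, y₁, T₂, y₂, t1, t2, t3, hU⟩ := hT.exists_arrives .start .refl
  have e1 := s2.isState (s1.isState hS₀ hx₀).1
  have e2 := t2.isState (t1.isState hT₀ hy₀).1
  have hcol : x₂.1 = y₂.1 := by
    by_contra hne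
    have c1 := cols_insert_self (N := N) (T := S₂) e1.1.col_pos
    rw [hU, cols_insert_of_ne hne] at c1
    have c2 := congrArg Finset.card c1
    rw [Finset.card_insert_of_notMem fun h => e1.1.vacant ((mem_cols e1.1.col_pos).1 h),
      e1.1.adm.card _ e1.1.col_pos, e2.1.adm.card _ e1.1.col_pos] at c2
    omega
  obtain ⟨rfl, rfl⟩ := Arrives.eq_of_insert_eq hsn hS₀ hT₀ hx₀ hy₀ s1 t1
    (by rw [← e1.2.1, ← e2.2.1, hcol]) (by rw [← e1.2.2.2, ← e2.2.2.2, hU]) s2 t2 (Or.inr ⟨s3, t3⟩)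
  exact Arrives.start_eq hsn hS₀ hT₀ hx₀ hy₀ s1 t1

/-! ### Compositions and left swaps -/

/-- The number of indices `1 ≤ j ≤ m` with `c ≤ β j`. -/
def partCount (β : Comp) (c m : ℕ) : ℕ :=
  ((Finset.Icc 1 m).filter fun j => c ≤ β j).card

theorem partCount_anti (β : Comp) {c c' : ℕ} (h : c ≤ c') (m : ℕ) :
    partCount β c' m ≤ partCount β c m := by
  apply Finset.card_le_card
  intro j
  simp only [Finset.mem_filter]
  exact fun h' => ⟨h'.1, h.trans h'.2⟩

theorem partCount_mono (β : Comp) (c : ℕ) {m m' : ℕ} (h : m ≤ m') :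
    partCount β c m ≤ partCount β c m' := by
  apply Finset.card_le_card
  intro j
  simp only [Finset.mem_filter, Finset.mem_Icc]
  exact fun h' => ⟨⟨h'.1.1, h'.1.2.trans h⟩, h'.2⟩

theorem partCount_eq_zero_of_lt {β : Comp} {c : ℕ} (h : β.support.sup β < c) (m : ℕ) :
    partCount β c m = 0 := by
  unfold partCount
  rw [Finset.card_eq_zero, Finset.filter_eq_empty_iff]
  intro j _ hj
  have := Finset.le_sup (f := β) (Finsupp.mem_support_iff.2 (by omega : β j ≠ 0))
  omega

/-- The number of indices `≤ m` with parts in the range `c ≤ β j < c'` is monotone in `m`. -/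
theorem partCount_add_le (β : Comp) {c c' m m' : ℕ} (h : c ≤ c') (hm : m ≤ m') :
    partCount β c m + partCount β c' m' ≤ partCount β c m' + partCount β c' m := by
  have key : ∀ m, partCount β c m = partCount β c' m +
      ((Finset.Icc 1 m).filter fun j => c ≤ β j ∧ ¬ c' ≤ β j).card := by
    intro m
    unfold partCount
    rw [← Finset.card_union_of_disjoint]
    · congr 1
      ext j
      simp only [Finset.mem_union, Finset.mem_filter]
      constructor
      · rintro ⟨h1, h2⟩
        by_cases h3 : c' ≤ β j
        · exact Or.inl ⟨h1, h3⟩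
        · exact Or.inr ⟨h1, h2, h3⟩
      · rintro (⟨h1, h2⟩ | ⟨h1, h2, _⟩)
        · exact ⟨h1, h.trans h2⟩
        · exact ⟨h1, h2⟩
    · rw [Finset.disjoint_left]
      simp only [Finset.mem_filter]
      exact fun j h1 h2 => h2.2.2 h1.2
  have := key m
  have := key m'
  have : ((Finset.Icc 1 m).filter fun j => c ≤ β j ∧ ¬ c' ≤ β j).card ≤
      ((Finset.Icc 1 m').filter fun j => c ≤ β j ∧ ¬ c' ≤ β j).card := by
    apply Finset.card_le_card
    intro j
    simp only [Finset.mem_filter, Finset.mem_Icc]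
    exact fun h' => ⟨⟨h'.1.1, h'.1.2.trans hm⟩, h'.2⟩
  omega

theorem partCount_split (β : Comp) (c : ℕ) {r m : ℕ} (hr : 1 ≤ r) (h : r ≤ m) :
    partCount β c m = partCount β c (r - 1) + ((Finset.Icc r m).filter fun j => c ≤ β j).card := by
  unfold partCount
  rw [← Finset.card_union_of_disjoint]
  · congr 1
    ext j
    simp only [Finset.mem_union, Finset.mem_filter, Finset.mem_Icc]
    omega
  · rw [Finset.disjoint_left]
    simp only [Finset.mem_filter, Finset.mem_Icc]
    omega

theorem equivMapDomain_swap_apply (β : Comp) (r s j : ℕ) :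
    β.equivMapDomain (Equiv.swap r s) j = β (Equiv.swap r s j) := by
  rw [Finsupp.equivMapDomain_apply, Equiv.symm_swap]

theorem partCount_swap_of_le (β : Comp) {r s : ℕ} (hr : 1 ≤ r) (hrs : r < s) (c : ℕ) {m : ℕ}
    (hm : s ≤ m) : partCount (β.equivMapDomain (Equiv.swap r s)) c m = partCount β c m := by
  unfold partCount
  apply Finset.card_bij fun j _ => Equiv.swap r s j
  · intro j
    simp only [Finset.mem_filter, Finset.mem_Icc, equivMapDomain_swap_apply]
    rintro ⟨⟨h1, h2⟩, h3⟩
    refine ⟨?_, h3⟩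
    rw [Equiv.swap_apply_def]
    split_ifs <;> omega
  · intro _ _ _ _ h
    exact (Equiv.swap r s).injective h
  · intro j
    simp only [Finset.mem_filter, Finset.mem_Icc, equivMapDomain_swap_apply]
    rintro ⟨⟨h1, h2⟩, h3⟩
    refine ⟨Equiv.swap r s j, ⟨?_, by simpa using h3⟩, by simp⟩
    rw [Equiv.swap_apply_def]
    split_ifs <;> omega

theorem partCount_le_swap {β : Comp} {r s : ℕ} (hr : 1 ≤ r) (hrs : r < s) (h : β r < β s)
    (c m : ℕ) : partCount β c m ≤ partCount (β.equivMapDomain (Equiv.swap r s)) c m := by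
  rcases Nat.lt_or_ge m s with hm | hm
  · apply Finset.card_le_card
    intro j
    simp only [Finset.mem_filter, Finset.mem_Icc, equivMapDomain_swap_apply]
    rintro ⟨⟨h1, h2⟩, h3⟩
    refine ⟨⟨h1, h2⟩, ?_⟩
    rw [Equiv.swap_apply_def]
    split_ifs with h4 h5
    · subst h4; omega
    · omega
    · exact h3
  · rw [partCount_swap_of_le β hr hrs c hm]

/-- The composition `α` has its parts in positions `1, …, N`, is a rearrangement of `β`, and has the
large parts at least as far to the left. -/
structure Dominated (N : ℕ) (β α : Comp) : Prop where
  zero : α 0 = 0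
  bdd : ∀ j, N < j → α j = 0
  total : ∀ c, partCount α c N = partCount β c N
  le : ∀ c m, partCount β c m ≤ partCount α c m

theorem Dominated.leftSwap {N : ℕ} {β α α' : Comp} (h : Dominated N β α) (hs : LeftSwap α α') :
    Dominated N β α' := by
  obtain ⟨r, s, hr, hrs, hlt, rfl⟩ := hs
  have hsN : s ≤ N := by
    by_contra hcon
    have := h.bdd s (by omega)
    omega
  refine ⟨?_, fun j hj => ?_, fun c => ?_, fun c m => ?_⟩
  · rw [equivMapDomain_swap_apply, Equiv.swap_apply_of_ne_of_ne (by omega) (by omega), h.zero]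
  · rw [equivMapDomain_swap_apply, Equiv.swap_apply_of_ne_of_ne (by omega) (by omega), h.bdd j hj]
  · rw [partCount_swap_of_le α hr hrs c hsN, h.total]
  · exact (h.le c m).trans (partCount_le_swap hr hrs hlt c m)

theorem SwapLE.dominated {N : ℕ} {β α : Comp} (h : SwapLE α β) (h0 : β 0 = 0)
    (hN : ∀ j, N < j → β j = 0) : Dominated N β α := by
  induction h with
  | refl => exact ⟨h0, hN, fun _ => rfl, fun _ _ => le_rfl⟩
  | tail _ hs ih => exact ih.leftSwap hs

theorem PinnedLE.swapLE {β α : Comp} (h : PinnedLE α β) : SwapLE α β :=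
  Relation.ReflTransGen.mono
    (show PinnedLeftSwap ≤ LeftSwap from fun _ _ ⟨r, s, h1, h2, _, h4, h5⟩ => ⟨r, s, h1, h2, h4, h5⟩)
    _ _ h

theorem pinnedLeftSwap_eq_zero_iff {α α' : Comp} (h : PinnedLeftSwap α α') (j : ℕ) :
    α' j = 0 ↔ α j = 0 := by
  obtain ⟨r, s, _, _, h0, h1, rfl⟩ := h
  rw [equivMapDomain_swap_apply, Equiv.swap_apply_def]
  split_ifs with h2 h3
  · subst h2; omega
  · subst h3; omega
  · rfl

theorem PinnedLE.eq_zero_iff {β α : Comp} (h : PinnedLE α β) (j : ℕ) : α j = 0 ↔ β j = 0 := by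
  induction h with
  | refl => rfl
  | tail _ hs ih => rw [pinnedLeftSwap_eq_zero_iff hs, ih]

/-- The exchange step of the tableau criterion for the Bruhat order. At the highest level `c` where
`α` and `β` differ, `r` is the first index where they do so, and `s` is the next index whose part in
`β` exceeds `β r` without exceeding `c`. -/
theorem Dominated.exists_swap {N : ℕ} {β α : Comp} (h : Dominated N β α) (hb0 : β 0 = 0)
    (hbN : ∀ j, N < j → β j = 0) (hne : α ≠ β) :
    ∃ r s, 1 ≤ r ∧ r < s ∧ s ≤ N ∧ 0 < α r ∧ β r < β s ∧
      Dominated N (β.equivMapDomain (Equiv.swap r s)) α := by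
  classical
  have hdiff : ((Finset.Icc 1 N).filter fun j => α j ≠ β j).Nonempty := by
    by_contra hcon
    rw [Finset.not_nonempty_iff_eq_empty, Finset.filter_eq_empty_iff] at hcon
    apply hne
    ext j
    by_cases hj : j ∈ Finset.Icc 1 N
    · simpa using hcon hj
    · rw [Finset.mem_Icc, not_and_or] at hj
      rcases hj with hj | hj
      · obtain rfl : j = 0 := by omega
        rw [h.zero, hb0]
      · rw [h.bdd j (by omega), hbN j (by omega)]
  obtain ⟨j₀, hj₀, hmax⟩ := Finset.exists_max_image _ (fun j => max (α j) (β j)) hdiff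
  set c := max (α j₀) (β j₀) with hc
  have hle : ∀ j, α j ≠ β j → α j ≤ c ∧ β j ≤ c := by
    intro j hj
    have : j ∈ (Finset.Icc 1 N).filter fun j => α j ≠ β j := by
      rw [Finset.mem_filter, Finset.mem_Icc]
      refine ⟨?_, hj⟩
      by_contra hcon
      rw [not_and_or] at hcon
      rcases hcon with hcon | hcon
      · obtain rfl : j = 0 := by omega
        exact hj (by rw [h.zero, hb0])
      · exact hj (by rw [h.bdd j (by omega), hbN j (by omega)])
    have := hmax j this
    exact ⟨(le_max_left _ _).trans this, (le_max_right _ _).trans this⟩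
  have hex : ∃ j, ¬ (c ≤ α j ↔ c ≤ β j) := by
    refine ⟨j₀, ?_⟩
    have := (Finset.mem_filter.1 hj₀).2
    omega
  have hr := Nat.find_spec hex
  have hrmin := fun j => Nat.find_min hex (m := j)
  generalize Nat.find hex = r at hr hrmin
  have hcpos : 0 < c := by
    have := (Finset.mem_filter.1 hj₀).2
    omega
  have hr1 : 1 ≤ r := by
    by_contra hcon
    obtain rfl : r = 0 := by omega
    rw [h.zero, hb0] at hr
    exact hr Iff.rfl
  have hrN : r ≤ N := by
    by_contra hcon
    rw [h.bdd r (by omega), hbN r (by omega)] at hr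
    exact hr Iff.rfl
  have hbelow : ∀ c' , c' = c → partCount α c' (r - 1) = partCount β c' (r - 1) := by
    rintro c' rfl
    unfold partCount
    congr 1
    apply Finset.filter_congr
    intro j hj
    rw [Finset.mem_Icc] at hj
    exact not_not.1 (hrmin j (by omega))
  have har : c ≤ α r ∧ ¬ c ≤ β r := by
    by_contra hcon
    have h1 := h.le c r
    rw [partCount_split β c hr1 le_rfl, partCount_split α c hr1 le_rfl, hbelow c rfl,
      Finset.Icc_self, Finset.filter_singleton, Finset.filter_singleton, if_pos (by tauto),
      if_neg (by tauto)] at h1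
    simp at h1
  have harc : α r = c := le_antisymm (hle r (by omega)).1 har.1
  have hs₀ : ∃ s, r < s ∧ β r < β s ∧ β s ≤ c := by
    by_contra hcon
    push Not at hcon
    have hlt : partCount β c N < partCount α c N := by
      apply Finset.card_lt_card
      rw [Finset.ssubset_iff_of_subset]
      · exact ⟨r, by simp [hr1, hrN, har.1], by simp [har.2]⟩
      · intro j
        simp only [Finset.mem_filter, Finset.mem_Icc]
        rintro ⟨h1, h2⟩
        refine ⟨h1, ?_⟩
        by_contra h3
        have h4 := hle j (by omega)
        rcases Nat.lt_trichotomy j r with h5 | rfl | h5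
        · have := not_not.1 (hrmin j h5)
          omega
        · omega
        · have := hcon j h5 (by omega)
          omega
    have := h.total c
    omega
  have hs := Nat.find_spec hs₀
  have hsmin := fun j => Nat.find_min hs₀ (m := j)
  generalize Nat.find hs₀ = s at hs hsmin
  obtain ⟨hrs, hlt, hsc⟩ := hs
  have hsN : s ≤ N := by
    by_contra hcon
    have := hbN s (by omega)
    omega
  refine ⟨r, s, hr1, hrs, hsN, by omega, hlt, h.zero, h.bdd, fun c' => ?_, fun c' m => ?_⟩
  · rw [partCount_swap_of_le β hr1 hrs c' hsN, h.total]
  · by_cases hcase : β r < c' ∧ c' ≤ β s ∧ r ≤ m ∧ m < s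
    · obtain ⟨k1, k2, k3, k4⟩ := hcase
      rw [partCount_split _ c' hr1 k3, partCount_split α c' hr1 k3]
      have e1 : partCount (β.equivMapDomain (Equiv.swap r s)) c' (r - 1) ≤
          partCount α c' (r - 1) := by
        refine le_trans (Finset.card_le_card ?_) (h.le c' (r - 1))
        intro j
        simp only [Finset.mem_filter, Finset.mem_Icc, equivMapDomain_swap_apply]
        rintro ⟨h1, h2⟩
        rw [Equiv.swap_apply_of_ne_of_ne (by omega) (by omega)] at h2
        exact ⟨h1, h2⟩
      refine Nat.add_le_add e1 (Finset.card_le_card ?_)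
      intro j
      simp only [Finset.mem_filter, Finset.mem_Icc, equivMapDomain_swap_apply]
      rintro ⟨h1, h2⟩
      refine ⟨h1, ?_⟩
      by_cases hj : j = r
      · subst hj; omega
      · rw [Equiv.swap_apply_of_ne_of_ne hj (by omega)] at h2
        -- no part of `β` between `r` and `s` lies in the range `β r < x ≤ c`
        have h3 := hsmin j (by omega)
        by_contra h4
        have := hle j (by omega)
        exact h3 ⟨by omega, by omega, by omega⟩
    · refine le_trans ?_ (h.le c' m)
      rcases Nat.lt_or_ge m s with hm | hm
      · apply Finset.card_le_card
        intro j
        simp only [Finset.mem_filter, Finset.mem_Icc, equivMapDomain_swap_apply]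
        rintro ⟨h1, h2⟩
        refine ⟨h1, ?_⟩
        by_cases hj : j = r
        · subst hj
          rw [Equiv.swap_apply_left] at h2
          omega
        · rwa [Equiv.swap_apply_of_ne_of_ne hj (by omega)] at h2
      · rw [partCount_swap_of_le β hr1 hrs c' hm]

theorem sum_swap_index_lt {N : ℕ} {β : Comp} {r s : ℕ} (hr : 1 ≤ r) (hrs : r < s) (hsN : s ≤ N)
    (hlt : β r < β s) : ∑ j ∈ Finset.Icc 1 N, β.equivMapDomain (Equiv.swap r s) j * j <
      ∑ j ∈ Finset.Icc 1 N, β j * j := by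
  have h1 : s ∈ Finset.Icc 1 N := by rw [Finset.mem_Icc]; omega
  have h2 : r ∈ (Finset.Icc 1 N).erase s := by
    rw [Finset.mem_erase, Finset.mem_Icc]; omega
  rw [← Finset.add_sum_erase _ _ h1, ← Finset.add_sum_erase _ _ h1, ← Finset.add_sum_erase _ _ h2,
    ← Finset.add_sum_erase _ _ h2]
  have e : ∑ x ∈ ((Finset.Icc 1 N).erase s).erase r, β.equivMapDomain (Equiv.swap r s) x * x =
      ∑ x ∈ ((Finset.Icc 1 N).erase s).erase r, β x * x := by
    apply Finset.sum_congr rfl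
    intro x hx
    simp only [Finset.mem_erase] at hx
    rw [equivMapDomain_swap_apply, Equiv.swap_apply_of_ne_of_ne hx.1 hx.2.1]
  rw [e, equivMapDomain_swap_apply, equivMapDomain_swap_apply, Equiv.swap_apply_left,
    Equiv.swap_apply_right]
  obtain ⟨d, hd⟩ := Nat.exists_eq_add_of_lt hlt
  obtain ⟨d', rfl⟩ := Nat.exists_eq_add_of_lt hrs
  rw [hd]
  nlinarith [Nat.zero_le (d * d'), Nat.zero_le d, Nat.zero_le d']

/-- The tableau criterion for left swaps. -/
theorem Dominated.swapLE {N : ℕ} {β α : Comp} (h : Dominated N β α) (hb0 : β 0 = 0)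
    (hbN : ∀ j, N < j → β j = 0) : SwapLE α β := by
  induction hw : ∑ j ∈ Finset.Icc 1 N, β j * j using Nat.strong_induction_on generalizing β with
  | _ w ih =>
  by_cases hne : α = β
  · subst hne; exact .refl
  · obtain ⟨r, s, h1, h2, h3, h4, h5, h6⟩ := h.exists_swap hb0 hbN hne
    refine .head ⟨r, s, h1, h2, h5, rfl⟩ (ih _ (hw ▸ sum_swap_index_lt h1 h2 h3 h5) h6 ?_ ?_ rfl)
    · rw [equivMapDomain_swap_apply, Equiv.swap_apply_of_ne_of_ne (by omega) (by omega), hb0]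
    · intro j hj
      rw [equivMapDomain_swap_apply, Equiv.swap_apply_of_ne_of_ne (by omega) (by omega), hbN j hj]

/-- The tableau criterion for pinned left swaps. -/
theorem Dominated.pinnedLE {N : ℕ} {β α : Comp} (h : Dominated N β α) (hb0 : β 0 = 0)
    (hbN : ∀ j, N < j → β j = 0) (hsupp : ∀ j, α j = 0 ↔ β j = 0) : PinnedLE α β := by
  induction hw : ∑ j ∈ Finset.Icc 1 N, β j * j using Nat.strong_induction_on generalizing β with
  | _ w ih =>
  by_cases hne : α = β
  · subst hne; exact .refl
  · obtain ⟨r, s, h1, h2, h3, h4, h5, h6⟩ := h.exists_swap hb0 hbN hne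
    have hpos : 0 < β r := by
      have := (hsupp r).not.1 (by omega)
      omega
    have hstep : PinnedLeftSwap β (β.equivMapDomain (Equiv.swap r s)) :=
      ⟨r, s, h1, h2, hpos, h5, rfl⟩
    refine .head hstep (ih _ (hw ▸ sum_swap_index_lt h1 h2 h3 h5) h6 ?_ ?_ (fun j => ?_) rfl)
    · rw [equivMapDomain_swap_apply, Equiv.swap_apply_of_ne_of_ne (by omega) (by omega), hb0]
    · intro j hj
      rw [equivMapDomain_swap_apply, Equiv.swap_apply_of_ne_of_ne (by omega) (by omega), hbN j hj]
    · rw [hsupp, pinnedLeftSwap_eq_zero_iff hstep]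

/-! ### The maximum of the rearrangements with a given support -/

/-- The number of elements of `A` that are at most `m`. -/
def headCount (A : Finset ℕ) (m : ℕ) : ℕ := (A.filter fun j => j ≤ m).card

theorem headCount_add (A : Finset ℕ) {m m' : ℕ} (h : m ≤ m') :
    headCount A m' = headCount A m + (A.filter fun j => m < j ∧ j ≤ m').card := by
  unfold headCount
  rw [← Finset.card_union_of_disjoint]
  · congr 1
    ext j
    simp only [Finset.mem_union, Finset.mem_filter]
    constructor
    · rintro ⟨h1, h2⟩
      rcases Nat.lt_or_ge m j with h3 | h3
      · exact Or.inr ⟨h1, h3, h2⟩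
      · exact Or.inl ⟨h1, h3⟩
    · rintro (⟨h1, h2⟩ | ⟨h1, h2, h3⟩)
      · exact ⟨h1, by omega⟩
      · exact ⟨h1, h3⟩
  · rw [Finset.disjoint_left]
    simp only [Finset.mem_filter]
    intro j h1 h2
    omega

theorem headCount_of_le {A : Finset ℕ} {m : ℕ} (h : ∀ j ∈ A, j ≤ m) : headCount A m = A.card := by
  unfold headCount
  rw [Finset.filter_true_of_mem h]

theorem partCount_of_le {β : Comp} {N c m : ℕ} (hN : ∀ j, N < j → β j = 0) (hc : 1 ≤ c)
    (hm : N ≤ m) : partCount β c m = partCount β c N := by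
  apply le_antisymm _ (partCount_mono β c hm)
  apply Finset.card_le_card
  intro j
  simp only [Finset.mem_filter, Finset.mem_Icc]
  rintro ⟨h7, h8⟩
  refine ⟨⟨h7.1, ?_⟩, h8⟩
  by_contra h9
  rw [hN j (by omega)] at h8
  omega

/-- The order `⪯⁰` is antisymmetric, since a left swap decreases the weighted sum of the parts. -/
theorem PinnedLE.antisymm {α β : Comp} (h : PinnedLE α β) (h' : PinnedLE β α) : α = β := by
  have key : ∀ {α β : Comp}, PinnedLE α β → ∀ N, (∀ j, N < j → β j = 0) →
      ∑ j ∈ Finset.Icc 1 N, α j * j ≤ ∑ j ∈ Finset.Icc 1 N, β j * j := by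
    intro α β h N hN
    induction h with
    | refl => exact le_rfl
    | tail h1 hs ih =>
      refine le_trans ?_ ih
      obtain ⟨r, s, k1, k2, _, k4, rfl⟩ := hs
      refine (sum_swap_index_lt k1 k2 ?_ k4).le
      by_contra hcon
      have := (PinnedLE.eq_zero_iff h1 s).2 (hN s (by omega))
      omega
  obtain ⟨N, hN⟩ : ∃ N, ∀ j, N < j → β j = 0 := by
    refine ⟨β.support.sup id, fun j hj => ?_⟩
    by_contra hcon
    have := Finset.le_sup (f := id) (Finsupp.mem_support_iff.2 hcon)
    simp only [id] at this
    omega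
  rcases Relation.ReflTransGen.cases_head h with h1 | ⟨γ, h1, h2⟩
  · exact h1.symm
  · obtain ⟨r, s, k1, k2, k3, k4, e⟩ := h1
    have hs : s ≤ N := by
      by_contra hcon
      have := hN s (by omega)
      omega
    have e1 := sum_swap_index_lt k1 k2 hs k4
    rw [← e] at e1
    have hγ : ∀ j, N < j → γ j = 0 := fun j hj =>
      (pinnedLeftSwap_eq_zero_iff ⟨r, s, k1, k2, k3, k4, e⟩ j).2 (hN j hj)
    have e2 := key h2 N hγ
    have e3 := key h' N fun j hj => (h.eq_zero_iff j).2 (hN j hj)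
    omega

theorem headCount_eq_partCount {α : Comp} {A : Finset ℕ} {c : ℕ}
    (h : ∀ j, j ∈ A ↔ 1 ≤ j ∧ c ≤ α j) (m : ℕ) : headCount A m = partCount α c m := by
  unfold headCount partCount
  congr 1
  ext j
  simp only [Finset.mem_filter, Finset.mem_Icc, h]
  tauto

theorem exists_initial_subset (Q : Finset ℕ) (d : ℕ) (h : d ≤ Q.card) :
    ∃ E ⊆ Q, E.card = d ∧ ∀ m, (∀ q ∈ Q, q ≤ m → q ∈ E) ∨ ∀ q ∈ E, q ≤ m := by
  induction d with
  | zero => exact ⟨∅, by simp, rfl, fun m => Or.inr (by simp)⟩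
  | succ d ih =>
    obtain ⟨E, h1, h2, h3⟩ := ih (by omega)
    have hne : (Q \ E).Nonempty := by
      rw [← Finset.card_pos, Finset.card_sdiff_of_subset h1]
      omega
    have hq := Finset.mem_sdiff.1 (Finset.min'_mem _ hne)
    have hmin : ∀ q ∈ Q \ E, (Q \ E).min' hne ≤ q := fun q hq => Finset.min'_le (Q \ E) q hq
    generalize (Q \ E).min' hne = q₀ at hq hmin
    refine ⟨insert q₀ E, Finset.insert_subset hq.1 h1, by rw [Finset.card_insert_of_notMem hq.2, h2],
      fun m => ?_⟩
    by_cases hm : ∀ q ∈ Q, q ≤ m → q ∈ E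
    · exact Or.inl fun q hq hqm => Finset.mem_insert_of_mem (hm q hq hqm)
    · have h4 := (h3 m).resolve_left hm
      push Not at hm
      obtain ⟨q, k1, k2, k3⟩ := hm
      have k4 := hmin q (Finset.mem_sdiff.2 ⟨k1, k3⟩)
      refine Or.inr fun q' hq' => ?_
      rcases Finset.mem_insert.1 hq' with h' | hq'
      · exact h' ▸ k4.trans k2
      · exact h4 q' hq'

/-- `A` may serve as the set of indices whose part is at least `c`, in a rearrangement of `β` with
support `P`. -/
structure IsLevel (N : ℕ) (β : Comp) (P : Finset ℕ) (c : ℕ) (A : Finset ℕ) : Prop where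
  subset : A ⊆ P
  card : A.card = partCount β c N
  le : ∀ m, partCount β c m ≤ headCount A m

/-- No rearrangement of `β` with support `P` has fewer indices `≤ m` with parts at least `c`
than `A` has: too many indices between `m` and `m'` would be needed in level `c'`. -/
def IsLowest (N : ℕ) (β : Comp) (P : Finset ℕ) (c : ℕ) (A : Finset ℕ) : Prop :=
  ∀ m ≤ N, ∃ c' m', c ≤ c' ∧ m ≤ m' ∧ m' ≤ N ∧
    headCount A m + (P.filter fun j => m < j ∧ j ≤ m').card ≤ partCount β c' m'

theorem IsLevel.exists_superset {N : ℕ} {β : Comp} {P A : Finset ℕ} {c : ℕ}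
    (hc : 1 ≤ c) (hPN : ∀ j ∈ P, j ≤ N) (hN : ∀ j, N < j → β j = 0)
    (hP : ∀ m, partCount β c m ≤ headCount P m) (hA : IsLevel N β P (c + 1) A) :
    ∃ A', A ⊆ A' ∧ IsLevel N β P c A' := by
  have hanti := partCount_anti β (Nat.le_add_right c 1) N
  obtain ⟨E, h1, h2, h3⟩ := exists_initial_subset (P \ A) (partCount β c N - partCount β (c + 1) N) (by
    rw [Finset.card_sdiff_of_subset hA.subset, hA.card, ← headCount_of_le hPN]
    have := hP N
    omega)
  have hdisj : Disjoint A E := by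
    rw [Finset.disjoint_left]
    exact fun j hj hj' => (Finset.mem_sdiff.1 (h1 hj')).2 hj
  refine ⟨A ∪ E, Finset.subset_union_left, Finset.union_subset hA.subset
    (h1.trans Finset.sdiff_subset), ?_, fun m => ?_⟩
  · rw [Finset.card_union_of_disjoint hdisj, h2, hA.card]
    omega
  · rcases h3 m with h4 | h4
    · refine (hP m).trans (Finset.card_le_card fun j hj => ?_)
      rw [Finset.mem_filter] at hj ⊢
      refine ⟨?_, hj.2⟩
      by_cases hjA : j ∈ A
      · exact Finset.mem_union_left _ hjA
      · exact Finset.mem_union_right _ (h4 j (Finset.mem_sdiff.2 ⟨hj.1, hjA⟩) hj.2)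
    · have e : headCount (A ∪ E) m = headCount A m + E.card := by
        unfold headCount
        rw [Finset.filter_union, Finset.card_union_of_disjoint
          (Finset.disjoint_filter_filter hdisj), Finset.filter_true_of_mem h4]
      rw [e, h2]
      have h5 := hA.le m
      rcases Nat.le_total m N with h6 | h6
      · have := partCount_add_le β (Nat.le_add_right c 1) h6
        omega
      · have e1 := partCount_of_le hN hc h6
        have e2 := partCount_of_le hN (Nat.le_succ_of_le hc) h6
        have e3 := headCount_of_le fun j hj => (hPN j (hA.subset hj)).trans h6
        have e4 := hA.card
        simp only [Nat.succ_eq_add_one] at e2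
        omega

/-- The step of the greedy construction of the maximum: among the possible sets of the next level,
the one with the largest sum of elements is lowest. -/
theorem IsLevel.exists_lowest {N : ℕ} {β : Comp} {P A : Finset ℕ} {c : ℕ} (hc : 1 ≤ c)
    (hPN : ∀ j ∈ P, j ≤ N) (hN : ∀ j, N < j → β j = 0)
    (hP : ∀ m, partCount β c m ≤ headCount P m) (hA : IsLevel N β P (c + 1) A)
    (hlow : IsLowest N β P (c + 1) A) : ∃ A', A ⊆ A' ∧ IsLevel N β P c A' ∧ IsLowest N β P c A' := by
  classical
  obtain ⟨A₁, k1, k2⟩ := hA.exists_superset hc hPN hN hP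
  obtain ⟨A', hA', hmax⟩ := Finset.exists_max_image
    (P.powerset.filter fun B => A ⊆ B ∧ IsLevel N β P c B) (fun B => ∑ j ∈ B, j)
    ⟨A₁, by simp [k1, k2, k2.subset]⟩
  rw [Finset.mem_filter] at hA'
  obtain ⟨-, hAA, hl⟩ := hA'
  refine ⟨A', hAA, hl, fun m hm => ?_⟩
  by_cases hs : ∃ s, s ∈ P ∧ m < s ∧ s ∉ A'
  · have hs' := Nat.find_spec hs
    have hmin := fun j => Nat.find_min hs (m := j)
    generalize Nat.find hs = s at hs' hmin
    obtain ⟨s1, s2, s3⟩ := hs'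
    have hfill : ∀ m'' < s, (P.filter fun j => m < j ∧ j ≤ m'') =
        A'.filter fun j => m < j ∧ j ≤ m'' := by
      intro m'' h
      ext j
      simp only [Finset.mem_filter]
      constructor
      · rintro ⟨j1, j2, j3⟩
        refine ⟨?_, j2, j3⟩
        by_contra hj
        exact hmin j (by omega) ⟨j1, j2, hj⟩
      · rintro ⟨j1, j2⟩
        exact ⟨hl.subset j1, j2⟩
    have hsN := hPN s s1
    by_cases htight : ∃ m'', m ≤ m'' ∧ m'' < s ∧ headCount A' m'' = partCount β c m''
    · obtain ⟨m'', t1, t2, t3⟩ := htight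
      refine ⟨c, m'', le_rfl, t1, by omega, ?_⟩
      rw [hfill m'' t2, ← t3, headCount_add A' t1]
    obtain ⟨c', m', l1, l2, l3, l4⟩ := hlow m hm
    by_cases hnew : ∃ a ∈ A', a ∉ A ∧ a ≤ m
    · obtain ⟨a, ha, hamax⟩ := Finset.exists_max_image (A'.filter fun a => a ∉ A ∧ a ≤ m) id
        (by obtain ⟨a, a1, a2⟩ := hnew; exact ⟨a, Finset.mem_filter.2 ⟨a1, a2⟩⟩)
      rw [Finset.mem_filter] at ha
      obtain ⟨a1, a2, a3⟩ := ha
      have hamax' : ∀ j ∈ A', a < j → j ≤ m → j ∈ A := by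
        intro j j1 j2 j3
        by_contra hj
        have := hamax j (Finset.mem_filter.2 ⟨j1, hj, j3⟩)
        simp only [id] at this
        omega
      -- moving `a` to `s` would give a larger sum
      have hbad : ¬ IsLevel N β P c (insert s (A'.erase a)) := by
        intro hcon
        have hss : s ∉ A'.erase a := fun h => s3 (Finset.mem_of_mem_erase h)
        have := hmax (insert s (A'.erase a)) (by
          rw [Finset.mem_filter, Finset.mem_powerset]
          refine ⟨hcon.subset, fun j hj => ?_, hcon⟩
          exact Finset.mem_insert_of_mem (Finset.mem_erase.2 ⟨by rintro rfl; exact a2 hj, hAA hj⟩))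
        rw [Finset.sum_insert hss, ← Finset.add_sum_erase A' _ a1] at this
        omega
      have ht : ∃ t, a ≤ t ∧ t < s ∧ headCount A' t = partCount β c t := by
        by_contra hcon
        push Not at hcon
        apply hbad
        have hss : s ∉ A'.erase a := fun h => s3 (Finset.mem_of_mem_erase h)
        refine ⟨Finset.insert_subset s1 ((Finset.erase_subset _ _).trans hl.subset), ?_, fun t => ?_⟩
        · rw [Finset.card_insert_of_notMem hss, Finset.card_erase_add_one a1, hl.card]
        · have h1 := hl.le t
          by_cases hta : a ≤ t
          · by_cases hts : t < s
            · have h2 := hcon t hta hts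
              have h3 : headCount A' t ≤ headCount (insert s (A'.erase a)) t + 1 := by
                unfold headCount
                rw [← Finset.card_erase_add_one (s := A'.filter fun j => j ≤ t) (a := a)
                  (Finset.mem_filter.2 ⟨a1, hta⟩)]
                refine Nat.add_le_add_right (Finset.card_le_card fun j => ?_) 1
                simp only [Finset.mem_filter, Finset.mem_insert, Finset.mem_erase]
                tauto
              omega
            · have h3 : headCount A' t ≤ headCount (insert s (A'.erase a)) t := by
                unfold headCount
                rw [← Finset.card_erase_add_one (s := A'.filter fun j => j ≤ t) (a := a)
                  (Finset.mem_filter.2 ⟨a1, hta⟩),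
                  ← Finset.card_insert_of_notMem (s := (A'.filter fun j => j ≤ t).erase a) (a := s)
                  fun h => s3 (Finset.mem_filter.1 (Finset.mem_of_mem_erase h)).1]
                apply Finset.card_le_card fun j => ?_
                simp only [Finset.mem_filter, Finset.mem_insert, Finset.mem_erase]
                rintro (rfl | ⟨j1, j2, j3⟩)
                · exact ⟨Or.inl rfl, by omega⟩
                · exact ⟨Or.inr ⟨j1, j2⟩, j3⟩
              omega
          · refine h1.trans (Finset.card_le_card fun j => ?_)
            simp only [Finset.mem_filter, Finset.mem_insert, Finset.mem_erase]
            rintro ⟨j1, j2⟩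
            exact ⟨Or.inr ⟨by omega, j1⟩, j2⟩
      obtain ⟨t, t1, t2, t3⟩ := ht
      have htm : t < m := by
        by_contra hcon
        exact htight ⟨t, by omega, t2, t3⟩
      refine ⟨c, m', le_rfl, l2, l3, ?_⟩
      have e1 := headCount_add A' htm.le
      have e2 := headCount_add A htm.le
      have e3 : (A'.filter fun j => t < j ∧ j ≤ m) = A.filter fun j => t < j ∧ j ≤ m := by
        ext j
        simp only [Finset.mem_filter]
        constructor
        · rintro ⟨j1, j2, j3⟩
          exact ⟨hamax' j j1 (by omega) j3, j2, j3⟩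
        · rintro ⟨j1, j2⟩
          exact ⟨hAA j1, j2⟩
      rw [e3] at e1
      have e4 := partCount_add_le β (c := c) (c' := c') (by omega) (htm.le.trans l2)
      have e5 := hA.le t
      have e6 := partCount_anti β l1 t
      omega
    · push Not at hnew
      refine ⟨c', m', by omega, l2, l3, le_trans (Nat.add_le_add_right ?_ _) l4⟩
      apply Finset.card_le_card fun j => ?_
      simp only [Finset.mem_filter]
      rintro ⟨j1, j2⟩
      refine ⟨?_, j2⟩
      by_contra hj
      have := hnew j j1 hj
      omega
  · push Not at hs
    refine ⟨c, N, le_rfl, hm, le_rfl, ?_⟩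
    rw [← hl.card, ← headCount_of_le (m := N) fun j hj => hPN j (hl.subset hj), headCount_add A' hm]
    refine Nat.add_le_add_left (Finset.card_le_card fun j => ?_) _
    simp only [Finset.mem_filter]
    rintro ⟨j1, j2, j3⟩
    exact ⟨hs j j1 j2, j2, j3⟩

/-- If `β` has a rearrangement below it with support `P`, then there is a largest one. -/
theorem Dominated.exists_maximum {N : ℕ} {β γ₀ : Comp}
    (hbN : ∀ j, N < j → β j = 0) (h₀ : Dominated N β γ₀) :
    ∃ α, Dominated N β α ∧ (∀ j, α j = 0 ↔ γ₀ j = 0) ∧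
      ∀ γ, Dominated N β γ → (∀ j, γ j = 0 ↔ γ₀ j = 0) → Dominated N α γ := by
  set P := (Finset.Icc 1 N).filter fun j => 1 ≤ γ₀ j with hPdef
  have hPN : ∀ j ∈ P, j ≤ N := fun j hj => (Finset.mem_Icc.1 (Finset.mem_filter.1 hj).1).2
  have hmemP : ∀ γ, Dominated N β γ → (∀ j, γ j = 0 ↔ γ₀ j = 0) → ∀ j, j ∈ P ↔ 1 ≤ j ∧ 1 ≤ γ j := by
    intro γ hγ h j
    rw [hPdef, Finset.mem_filter, Finset.mem_Icc]
    have h1 := h j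
    have h2 := hγ.bdd j
    omega
  have hP1 : ∀ m, headCount P m = partCount γ₀ 1 m := fun m =>
    headCount_eq_partCount (hmemP γ₀ h₀ fun _ => Iff.rfl) m
  have hP : ∀ c, 1 ≤ c → ∀ m, partCount β c m ≤ headCount P m := fun c hc m => by
    rw [hP1]
    exact (partCount_anti β hc m).trans (h₀.le 1 m)
  set M := β.support.sup β with hM
  have hzero : ∀ c, M < c → ∀ m, partCount β c m = 0 := fun c hc => partCount_eq_zero_of_lt hc
  have hbuild : ∀ d ≤ M, ∃ α : Comp, (∀ j, α j ≠ 0 → j ∈ P ∧ M + 1 - d ≤ α j) ∧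
      ∀ c, M + 1 - d ≤ c → IsLevel N β P c (P.filter fun j => c ≤ α j) ∧
        IsLowest N β P c (P.filter fun j => c ≤ α j) := by
    intro d
    induction d with
    | zero =>
      intro _
      refine ⟨0, by simp, fun c hc => ?_⟩
      have e : (P.filter fun j => c ≤ (0 : Comp) j) = ∅ := by
        rw [Finset.filter_eq_empty_iff]
        intro j _
        rw [Finsupp.zero_apply]
        omega
      rw [e]
      refine ⟨⟨by simp, by rw [hzero c (by omega), Finset.card_empty],
        fun m => by rw [hzero c (by omega)]; omega⟩, fun m hm => ⟨c, m, le_rfl, le_rfl, hm, ?_⟩⟩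
      rw [hzero c (by omega), Finset.filter_eq_empty_iff.2 (by omega)]
      simp [headCount]
    | succ d ih =>
      intro hd
      obtain ⟨α, h1, h2⟩ := ih (by omega)
      obtain ⟨c, hc⟩ : ∃ c, M + 1 - (d + 1) = c := ⟨_, rfl⟩
      have hc1 : 1 ≤ c := by omega
      have hcd : M + 1 - d = c + 1 := by omega
      rw [hc]
      rw [hcd] at h1 h2
      obtain ⟨A', k1, k2, k3⟩ := (h2 (c + 1) le_rfl).1.exists_lowest hc1 hPN hbN (hP c hc1)
        (h2 (c + 1) le_rfl).2
      obtain ⟨α', hα'⟩ : ∃ α' : Comp, ∀ j, α' j = if α j = 0 ∧ j ∈ A' then c else α j := by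
        refine ⟨Finsupp.onFinset (P ∪ α.support) (fun j => if α j = 0 ∧ j ∈ A' then c else α j)
          fun j hj => ?_, fun j => rfl⟩
        split_ifs at hj with h3
        · exact Finset.mem_union_left _ (k2.subset h3.2)
        · exact Finset.mem_union_right _ (Finsupp.mem_support_iff.2 hj)
      refine ⟨α', fun j hj => ?_, fun c' hc' => ?_⟩
      · rw [hα'] at hj ⊢
        split_ifs at hj ⊢ with h3
        · exact ⟨k2.subset h3.2, le_rfl⟩
        · have := h1 j hj
          exact ⟨this.1, by omega⟩
      · rcases Nat.eq_or_lt_of_le hc' with rfl | hc'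
        · have e : (P.filter fun j => c ≤ α' j) = A' := by
            ext j
            rw [Finset.mem_filter, hα']
            constructor
            · rintro ⟨j1, j2⟩
              split_ifs at j2 with h3
              · exact h3.2
              · refine k1 (Finset.mem_filter.2 ⟨j1, (h1 j (by omega)).2⟩)
            · intro j1
              refine ⟨k2.subset j1, ?_⟩
              split_ifs with h3
              · exact le_rfl
              · have := h1 j (by tauto)
                omega
          rw [e]
          exact ⟨k2, k3⟩
        · have e : (P.filter fun j => c' ≤ α' j) = P.filter fun j => c' ≤ α j := by
            apply Finset.filter_congr
            intro j _
            rw [hα']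
            split_ifs with h3
            · omega
            · rfl
          rw [e]
          exact h2 c' hc'
  obtain ⟨α, h1, h2⟩ := hbuild M le_rfl
  rw [show M + 1 - M = 1 by omega] at h1 h2
  have hcount : ∀ c, 1 ≤ c → ∀ m, headCount (P.filter fun j => c ≤ α j) m = partCount α c m := by
    intro c hc m
    apply headCount_eq_partCount
    intro j
    rw [Finset.mem_filter]
    constructor
    · rintro ⟨j1, j2⟩
      exact ⟨((hmemP γ₀ h₀ (fun _ => Iff.rfl) j).1 j1).1, j2⟩
    · rintro ⟨j1, j2⟩
      exact ⟨(h1 j (by omega)).1, j2⟩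
  have hc0 : ∀ δ ε : Comp, ∀ m, partCount δ 0 m = partCount ε 0 m := by
    intro δ ε m
    simp [partCount]
  have htot : ∀ c, partCount α c N = partCount β c N := by
    intro c
    rcases Nat.eq_zero_or_pos c with rfl | hc
    · exact hc0 _ _ _
    · rw [← hcount c hc, headCount_of_le fun j hj => hPN j (Finset.mem_filter.1 hj).1, (h2 c hc).1.card]
  have hsupp : ∀ j, α j = 0 ↔ γ₀ j = 0 := by
    have e : (P.filter fun j => 1 ≤ α j) = P := by
      apply Finset.eq_of_subset_of_card_le (Finset.filter_subset _ _)
      rw [(h2 1 le_rfl).1.card, ← h₀.total, ← hP1, headCount_of_le hPN]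
    intro j
    constructor
    · intro hj
      by_contra hj0
      have : j ∈ P := (hmemP γ₀ h₀ (fun _ => Iff.rfl) j).2
        ⟨by by_contra h; obtain rfl : j = 0 := by omega
            exact hj0 h₀.zero, by omega⟩
      rw [← e, Finset.mem_filter] at this
      omega
    · intro hj
      by_contra hj0
      have := ((hmemP γ₀ h₀ (fun _ => Iff.rfl) j).1 (h1 j hj0).1).2
      omega
  refine ⟨α, ⟨?_, fun j hj => ?_, htot, fun c m => ?_⟩, hsupp, fun γ hγ hγs => ?_⟩
  · exact (hsupp 0).2 h₀.zero
  · exact (hsupp j).2 (h₀.bdd j hj)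
  · rcases Nat.eq_zero_or_pos c with rfl | hc
    · exact (hc0 _ _ _).le
    · rw [← hcount c hc]
      exact (h2 c hc).1.le m
  · refine ⟨hγ.zero, hγ.bdd, fun c => by rw [hγ.total, htot], fun c m => ?_⟩
    rcases Nat.eq_zero_or_pos c with rfl | hc
    · exact (hc0 _ _ _).le
    rcases Nat.le_total m N with hm | hm
    · obtain ⟨c', m', l1, l2, l3, l4⟩ := (h2 c hc).2 m hm
      rw [hcount c hc] at l4
      have e1 := hγ.le c' m'
      have e2 := partCount_anti γ l1 m'
      have e3 : partCount γ c m' ≤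
          partCount γ c m + (P.filter fun j => m < j ∧ j ≤ m').card := by
        refine le_trans (Finset.card_le_card fun j => ?_) (Finset.card_union_le _ _)
        simp only [Finset.mem_union, Finset.mem_filter, Finset.mem_Icc, hmemP γ hγ hγs]
        omega
      omega
    · rw [partCount_of_le (fun j hj => (hsupp j).2 (h₀.bdd j hj)) hc hm,
        partCount_of_le hγ.bdd hc hm, htot, hγ.total]

/-- The labels of the insertion: if `θ(T) ⪯ β`, then every maximal `α` with `θ(T) ⪯⁰ α ⪯ β` lies
above all compositions `⪯ β` with the support of `θ(T)`. -/
theorem insertionLabel_spec {N : ℕ} {β : Comp} {T : Diagram} (hb0 : β 0 = 0)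
    (hbN : ∀ j, N < j → β j = 0) (hθ : Dominated N β (threadWeight T)) :
    SwapLE (insertionLabel β T) β ∧ (∀ j, insertionLabel β T j = 0 ↔ threadWeight T j = 0) ∧
      ∀ γ, Dominated N β γ → (∀ j, γ j = 0 ↔ threadWeight T j = 0) →
        PinnedLE γ (insertionLabel β T) := by
  obtain ⟨α, h1, h2, h3⟩ := hθ.exists_maximum hbN
  have hle : ∀ γ, Dominated N β γ → (∀ j, γ j = 0 ↔ threadWeight T j = 0) → PinnedLE γ α :=
    fun γ hγ hs => (h3 γ hγ hs).pinnedLE h1.zero h1.bdd fun j => by rw [hs, h2]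
  have hex : ∃ α, IsInsertionLabel β T α := by
    refine ⟨α, hle _ hθ fun _ => Iff.rfl, h1.swapLE hb0 hbN, fun γ k1 k2 k3 => ?_⟩
    have k4 := hle γ (k2.dominated hb0 hbN) fun j => (k1.eq_zero_iff j).symm
    exact PinnedLE.antisymm k4 k3
  have hspec : IsInsertionLabel β T (insertionLabel β T) := by
    unfold insertionLabel
    rw [dif_pos hex]
    exact hex.choose_spec
  generalize insertionLabel β T = α' at hspec
  obtain ⟨k1, k2, k3⟩ := hspec
  have e : α = α' := k3 α (hle _ hθ fun _ => Iff.rfl) (h1.swapLE hb0 hbN)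
    (hle α' (k2.dominated hb0 hbN) fun j => (k1.eq_zero_iff j).symm)
  subst e
  exact ⟨k2, h2, hle⟩

/-! ### Threads -/

theorem lowCount_union {A B : Finset ℕ} (h : Disjoint A B) (f : ℕ → ℕ) (m r : ℕ) :
    lowCount (A ∪ B) f m r = lowCount A f m r + lowCount B f m r := by
  unfold lowCount
  rw [Finset.filter_union, Finset.card_union_of_disjoint (Finset.disjoint_filter_filter h)]

/-- Replacing a label that occurs by a smaller one, and vice versa, does not decrease the number of
labels `≤ m`. -/
theorem lowCount_zero_le_swap {A : Finset ℕ} {f : ℕ → ℕ} {a b p : ℕ} (hf : Set.InjOn f A)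
    (hab : a < b) (hp : p ∈ A) (hpb : f p = b) (m : ℕ) :
    lowCount A f m 0 ≤ lowCount A (Equiv.swap a b ∘ f) m 0 := by
  unfold lowCount
  rcases Nat.lt_or_ge m b with h | h
  · apply Finset.card_le_card_of_injOn fun q => if f q = a then p else q
    · intro q hq
      simp only [Finset.coe_filter, Set.mem_ofPred_eq, Function.comp_apply] at hq ⊢
      split_ifs with h1
      · refine ⟨hp, Nat.zero_le _, ?_⟩
        rw [hpb, Equiv.swap_apply_right]
        omega
      · rw [Equiv.swap_apply_of_ne_of_ne h1 (by omega)]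
        exact hq
    · intro q hq q' hq' he
      simp only [Finset.coe_filter, Set.mem_ofPred_eq] at hq hq'
      simp only at he
      split_ifs at he with h1 h2 h2
      · exact hf hq.1 hq'.1 (h1.trans h2.symm)
      · subst he; omega
      · subst he; omega
      · exact he
  · apply Finset.card_le_card
    intro q
    simp only [Finset.mem_filter, Function.comp_apply]
    rintro ⟨h1, h2, h3⟩
    refine ⟨h1, h2, ?_⟩
    rw [Equiv.swap_apply_def]
    split_ifs <;> omega

theorem lowCount_zero_le_swapOn {n : ℕ} {D : ℕ → Finset ℕ} {L : ℕ → ℕ → ℕ}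
    (hL : PathLabeling n D L) {a b lo hi : ℕ} (hab : a < b) (hhi : hi ≤ n)
    (hd : ∀ c, lo < c → c ≤ hi → ∃ p ∈ D c, L c p = b) (c m : ℕ) :
    lowCount (D c) (L c) m 0 ≤ lowCount (D c) (swapOn lo hi a b L c) m 0 := by
  by_cases h : lo < c ∧ c ≤ hi
  · rw [swapOn_of_mem L h.1 h.2]
    obtain ⟨p, p1, p2⟩ := hd c h.1 h.2
    exact lowCount_zero_le_swap (hL.inj c (by omega)) hab p1 p2 m
  · rw [swapOn_of_notMem L h]

/-- A label of some column occurs in every column to its left, weakly above. -/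
theorem PathLabeling.exists_left {n : ℕ} {D : ℕ → Finset ℕ} {L : ℕ → ℕ → ℕ}
    (hL : PathLabeling n D L) {c : ℕ} (hc : c ≤ n) {p : ℕ} (hp : p ∈ D c) :
    ∀ d ≤ c, ∃ q ∈ D d, p ≤ q ∧ L d q = L c p := by
  induction c generalizing p with
  | zero => intro d hd; obtain rfl : d = 0 := by omega
            exact ⟨p, hp, le_rfl, rfl⟩
  | succ c ih =>
    intro d hd
    rcases Nat.eq_or_lt_of_le hd with rfl | hd
    · exact ⟨p, hp, le_rfl, rfl⟩
    · obtain ⟨q, h1, h2, h3⟩ := hL.links c (by omega) p hp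
      obtain ⟨q', k1, k2, k3⟩ := ih (by omega) h1 d (by omega)
      exact ⟨q', k1, h2.trans k2, k3.trans h3⟩

/-- The step of a thread to the next column: labels can be exchanged such that the cell `(e + 1, p)`
has the label of the lowest cell `(e, q)` weakly above it, without decreasing the numbers of labels
`≤ m`. The path through `(e + 1, p)` is required to reach the last nonempty column `h`. -/
theorem PathLabeling.exists_thread_step {n h : ℕ} {D : ℕ → Finset ℕ} {L : ℕ → ℕ → ℕ}
    (hL : PathLabeling n D L) (hh : h ≤ n) (hemp : ∀ c, h < c → D c = ∅) {e p q : ℕ}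
    (he : e + 1 ≤ h) (hp : p ∈ D (e + 1)) (hq : q ∈ D e) (hpq : p ≤ q)
    (hmin : ∀ q' ∈ D e, p ≤ q' → q ≤ q')
    (hpres : ∀ c, e + 1 ≤ c → c ≤ h → ∃ y ∈ D c, L c y = L (e + 1) p) :
    ∃ L', PathLabeling n D L' ∧
      (∀ c ≤ n, ∀ m, lowCount (D c) (L c) m 0 ≤ lowCount (D c) (L' c) m 0) ∧
      L' e q = L' (e + 1) p ∧
      ∀ c, e + 1 ≤ c → c ≤ n → ∀ y ∈ D c, (L' c y = L' (e + 1) p ↔ L c y = L (e + 1) p) := by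
  obtain ⟨q', hq', hpq', hqi⟩ := hL.links e (by omega) p hp
  set i := L (e + 1) p with hi
  have hqq := hmin q' hq' hpq'
  set j := L e q with hj
  rcases Nat.lt_trichotomy j i with hji | hji | hji
  · -- exchange the parts of the two paths on the right of column `e`
    have hq_ne : q ≠ q' := by rintro rfl; omega
    have hpath : PathLabeling n D (Kohnert.swapOn e h j i L) := by
      refine hL.swapOn (by omega) ((hL.links e (by omega)).swap_right ?_ ?_) fun hhn => ?_
      · intro y hy hyi
        rw [hL.inj (e + 1) (by omega) hy hp hyi]
        exact ⟨q, hq, hpq, rfl⟩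
      · intro y hy hyj
        obtain ⟨z, z1, z2, z3⟩ := hL.links e (by omega) y hy
        rw [hL.inj e (by omega) z1 hq (z3.trans hyj)] at z2
        exact ⟨q', hq', z2.trans hqq, hqi⟩
      · intro y hy
        rw [hemp (h + 1) (by omega)] at hy
        simp at hy
    refine ⟨_, hpath, fun c hc m => lowCount_zero_le_swapOn hL hji hh ?_ c m, ?_, ?_⟩
    · intro c h1 h2
      exact hpres c h1 h2
    · rw [swapOn_of_notMem L (by omega), swapOn_of_mem L (by omega) he]
      simp [← hi, ← hj]
    · intro c h1 h2 y hy
      have h3 : c ≤ h := by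
        by_contra hcon
        rw [hemp c (by omega)] at hy
        simp at hy
      rw [swapOn_of_mem L (by omega) h3, swapOn_of_mem L (by omega) he]
      exact (Equiv.swap j i).apply_eq_iff_eq
  · exact ⟨L, hL, fun _ _ _ => le_rfl, hji, fun _ _ _ _ _ => Iff.rfl⟩
  · -- exchange the parts of the two paths between column `e` and their last crossing
    have hqne : q < q' := lt_of_le_of_ne hqq (by rintro rfl; omega)
    let P : ℕ → Prop := fun f => ∀ c, f ≤ c → c ≤ e → ∀ y ∈ D c, ∀ z ∈ D c, L c y = j → L c z = i →
      y < z
    have hPe : P e := by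
      intro c h1 h2 y hy z hz hyj hzi
      obtain rfl : c = e := by omega
      rw [hL.inj c (by omega) hy hq hyj, hL.inj c (by omega) hz hq' (hzi.trans hqi.symm)]
      exact hqne
    have hP0 : ¬ P 0 := by
      intro hcon
      obtain ⟨y, y1, y2, y3⟩ := hL.exists_left (by omega) hq 0 (by omega)
      obtain ⟨z, z1, z2, z3⟩ := hL.exists_left (by omega) hq' 0 (by omega)
      have := hcon 0 le_rfl (by omega) y y1 z z1 y3 (z3.trans hqi)
      rw [hL.base y y1] at y3
      rw [hL.base z z1] at z3
      omega
    classical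
    have hex : ∃ f, P f := ⟨e, hPe⟩
    have hf := Nat.find_spec hex
    have hfmin := fun f => Nat.find_min hex (m := f)
    have hfe := Nat.find_min' hex hPe
    generalize Nat.find hex = f' at hf hfmin hfe
    obtain ⟨f, rfl⟩ : ∃ f, f' = f + 1 := by
      refine ⟨f' - 1, ?_⟩
      by_contra hcon
      obtain rfl : f' = 0 := by omega
      exact hP0 hf
    -- in column `f` the path labeled `j` is above the one labeled `i`
    obtain ⟨y, hy, z, hz, hyj, hzi, hyz⟩ :
        ∃ y ∈ D f, ∃ z ∈ D f, L f y = j ∧ L f z = i ∧ z ≤ y := by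
      by_contra hcon
      push Not at hcon
      refine hfmin f (by omega) fun c h1 h2 y hy z hz hyj hzi => ?_
      rcases Nat.eq_or_lt_of_le h1 with rfl | h1
      · exact hcon y hy z hz hyj hzi
      · exact hf c h1 h2 y hy z hz hyj hzi
    have hpath : PathLabeling n D (Kohnert.swapOn f e i j L) := by
      refine hL.swapOn (by omega) ((hL.links f (by omega)).swap_right ?_ ?_)
        fun hhn => (hL.links e (by omega)).swap_left ?_ ?_
      · intro x hx hxj
        obtain ⟨x', x1, x2, x3⟩ := hL.exists_left (by omega) hq' (f + 1) (by omega)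
        have h1 := hf (f + 1) le_rfl hfe x hx x' x1 hxj (x3.trans hqi)
        obtain ⟨w, w1, w2, w3⟩ := hL.links f (by omega) x' x1
        rw [hL.inj f (by omega) w1 hz (by rw [w3, x3, hqi, hzi])] at w2
        exact ⟨z, hz, by omega, hzi⟩
      · intro x hx hxi
        obtain ⟨w, w1, w2, w3⟩ := hL.links f (by omega) x hx
        rw [hL.inj f (by omega) w1 hz (by rw [w3, hxi, hzi])] at w2
        exact ⟨y, hy, by omega, hyj⟩
      · intro x hx hxj
        obtain ⟨w, w1, w2, w3⟩ := hL.links e (by omega) x hx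
        rw [hL.inj e (by omega) w1 hq (by rw [w3, hxj])] at w2
        exact ⟨q', hq', by omega, hqi⟩
      · intro x hx hxi
        rw [hL.inj (e + 1) (by omega) hx hp hxi]
        exact ⟨q, hq, hpq, rfl⟩
    refine ⟨_, hpath, fun c hc m => lowCount_zero_le_swapOn hL hji (by omega) ?_ c m, ?_, ?_⟩
    · intro c h1 h2
      obtain ⟨x, x1, x2, x3⟩ := hL.exists_left (by omega) hq c h2
      exact ⟨x, x1, x3⟩
    · rw [swapOn_of_mem L (by omega) le_rfl, swapOn_of_notMem L (by omega)]
      simp [← hi, ← hj]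
    · intro c h1 h2 y hy
      rw [swapOn_of_notMem L (by omega), swapOn_of_notMem L (by omega)]

theorem mem_rowsAbove {U : Diagram} {c r p : ℕ} : p ∈ rowsAbove U c r ↔ (c, p) ∈ U ∧ r ≤ p := by
  simp only [rowsAbove, Finset.mem_image, Finset.mem_filter, Prod.exists, exists_eq_right]
  constructor
  · rintro ⟨x, h1, rfl, h2⟩
    exact ⟨h1, h2⟩
  · rintro ⟨h1, h2⟩
    exact ⟨c, h1, rfl, h2⟩

/-- Labels can be exchanged such that the cells of a thread are those with the label of its first
cell. Here and below, the columns `1, 2, …` of the diagram are counted from `0`, so that the label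
of a cell in the leftmost column is its row. -/
theorem PathLabeling.exists_threadFrom {N n h : ℕ} {U : Diagram} (hU : ∀ x ∈ U, 1 ≤ x.1)
    (hh : h ≤ n) (hemp : ∀ c, h < c → cols N U (c + 1) = ∅) : ∀ e ≤ h, ∀ (L : ℕ → ℕ → ℕ) (p : ℕ),
    PathLabeling n (fun c => cols N U (c + 1)) L → p ∈ cols N U (e + 1) →
    (∀ c, e ≤ c → c ≤ h → ∃ y ∈ cols N U (c + 1), L c y = L e p) →
    ∃ L', PathLabeling n (fun c => cols N U (c + 1)) L' ∧
      (∀ c ≤ n, ∀ m, lowCount (cols N U (c + 1)) (L c) m 0 ≤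
        lowCount (cols N U (c + 1)) (L' c) m 0) ∧
      (∀ c, e ≤ c → c ≤ n → ∀ y ∈ cols N U (c + 1), (L' c y = L' e p ↔ L c y = L e p)) ∧
      ∀ c y, (c, y) ∈ threadFrom U (e + 1) p ↔
        ∃ d ≤ e, c = d + 1 ∧ y ∈ cols N U c ∧ L' d y = L' e p := by
  intro e
  induction e with
  | zero =>
    intro _ L p hL hp _
    refine ⟨L, hL, fun _ _ _ => le_rfl, fun _ _ _ _ _ => Iff.rfl, fun c y => ?_⟩
    have h0 : ¬ (rowsAbove U 0 p).Nonempty := by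
      rintro ⟨q, hq⟩
      have := hU _ (mem_rowsAbove.1 hq).1
      simp at this
    simp only [threadFrom, dif_neg h0, Finset.mem_insert, Finset.notMem_empty, or_false,
      Prod.mk.injEq]
    constructor
    · rintro ⟨rfl, rfl⟩
      exact ⟨0, le_rfl, rfl, hp, rfl⟩
    · rintro ⟨d, h1, rfl, h2, h3⟩
      obtain rfl : d = 0 := by omega
      exact ⟨rfl, hL.inj 0 (by omega) h2 hp h3⟩
  | succ e ih =>
    intro he L p hL hp hpres
    have hne : (rowsAbove U (e + 1) p).Nonempty := by
      obtain ⟨q, h1, h2, _⟩ := hL.links e (by omega) p hp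
      exact ⟨q, mem_rowsAbove.2 ⟨(mem_cols (by omega)).1 h1, h2⟩⟩
    have hq := mem_rowsAbove.1 (Finset.min'_mem _ hne)
    have hmin : ∀ q' ∈ rowsAbove U (e + 1) p, (rowsAbove U (e + 1) p).min' hne ≤ q' :=
      fun q' hq' => Finset.min'_le _ _ hq'
    have hthread : threadFrom U (e + 1 + 1) p =
        insert (e + 2, p) (threadFrom U (e + 1) ((rowsAbove U (e + 1) p).min' hne)) := by
      rw [threadFrom, dif_pos hne]
    rw [hthread]
    generalize (rowsAbove U (e + 1) p).min' hne = q at hq hmin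
    have hqD : q ∈ cols N U (e + 1) := (mem_cols (by omega)).2 hq.1
    obtain ⟨L₁, k1, k2, k3, k4⟩ := hL.exists_thread_step hh hemp he hp hqD hq.2
      (fun q' h1 h2 => hmin q' (mem_rowsAbove.2 ⟨(mem_cols (by omega)).1 h1, h2⟩)) hpres
    have hpres' : ∀ c, e ≤ c → c ≤ h → ∃ y ∈ cols N U (c + 1), L₁ c y = L₁ e q := by
      intro c h1 h2
      rcases Nat.eq_or_lt_of_le h1 with rfl | h1
      · exact ⟨q, hqD, rfl⟩
      · obtain ⟨y, y1, y2⟩ := hpres c h1 h2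
        exact ⟨y, y1, by rw [k3]; exact (k4 c h1 (by omega) y y1).2 y2⟩
    obtain ⟨L', l1, l2, l3, l4⟩ := ih (by omega) L₁ q k1 hqD hpres'
    have hpq : L' (e + 1) p = L' e q := (l3 (e + 1) (by omega) (by omega) p hp).2 k3.symm
    refine ⟨L', l1, fun c hc m => (k2 c hc m).trans (l2 c hc m), fun c h1 h2 y hy => ?_,
      fun c y => ?_⟩
    · rw [hpq, l3 c (by omega) h2 y hy, k3, k4 c h1 h2 y hy]
    · rw [Finset.mem_insert, l4, Prod.mk.injEq]
      constructor
      · rintro (⟨rfl, rfl⟩ | ⟨d, h1, rfl, h2, h3⟩)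
        · exact ⟨e + 1, le_rfl, rfl, hp, rfl⟩
        · exact ⟨d, by omega, rfl, h2, by rw [h3, hpq]⟩
      · rintro ⟨d, h1, rfl, h2, h3⟩
        rcases Nat.eq_or_lt_of_le h1 with rfl | h1
        · exact Or.inl ⟨rfl, l1.inj (e + 1) (by omega) h2 hp h3⟩
        · exact Or.inr ⟨d, by omega, rfl, h2, by rw [h3, hpq]⟩

theorem threadWeight_of_nonempty {U t : Diagram} (h : U.Nonempty)
    (ht : t = threadFrom U (U.sup Prod.fst)
      ((rowsAbove U (U.sup Prod.fst) 0).min' (rowsAbove_sup_nonempty h))) :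
    threadWeight U =
      (∑ x ∈ t with x.1 = 1, Finsupp.single x.2 t.card) + threadWeight (U \ t) := by
  unfold threadWeight
  rw [threads, dif_pos h, List.map_cons, List.sum_cons, ht]

/-- The thread weight is the shape of a labeling whose numbers of labels `≤ m` are not smaller than
those of a given one. -/
theorem PathLabeling.exists_threadWeight {N n : ℕ} {U : Diagram} {L : ℕ → ℕ → ℕ}
    (hU : ∀ x ∈ U, 1 ≤ x.1 ∧ x.1 ≤ n + 1) (hL : PathLabeling n (fun c => cols N U (c + 1)) L) :
    ∃ L', PathLabeling n (fun c => cols N U (c + 1)) L' ∧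
      (∀ c ≤ n, ∀ m, lowCount (cols N U (c + 1)) (L c) m 0 ≤
        lowCount (cols N U (c + 1)) (L' c) m 0) ∧
      ∀ c j, c < threadWeight U j ↔ ∃ q ∈ cols N U (c + 1), L' c q = j := by
  induction hw : U.card using Nat.strong_induction_on generalizing U L with
  | _ w ih =>
  rcases U.eq_empty_or_nonempty with rfl | hne
  · refine ⟨L, hL, fun _ _ _ => le_rfl, fun c j => ?_⟩
    have : threadWeight ∅ = 0 := by
      unfold threadWeight
      rw [threads, dif_neg (by simp)]
      simp
    rw [this]
    simp [cols]
  set t := threadFrom U (U.sup Prod.fst)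
    ((rowsAbove U (U.sup Prod.fst) 0).min' (rowsAbove_sup_nonempty hne)) with ht
  have hθ := threadWeight_of_nonempty hne ht
  have hp := (mem_rowsAbove.1 (Finset.min'_mem _ (rowsAbove_sup_nonempty hne))).1
  generalize (rowsAbove U (U.sup Prod.fst) 0).min' (rowsAbove_sup_nonempty hne) = p at ht hp
  have hmax : ∀ x ∈ U, x.1 ≤ U.sup Prod.fst := fun x hx => Finset.le_sup (f := Prod.fst) hx
  generalize U.sup Prod.fst = M at ht hp hmax
  obtain ⟨h, rfl⟩ : ∃ h, M = h + 1 := ⟨M - 1, by have := (hU _ hp).1; simp only at this; omega⟩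
  have hhn : h ≤ n := by have := (hU _ hp).2; simp only at this; omega
  have hemp : ∀ c, h < c → cols N U (c + 1) = ∅ := by
    intro c hc
    rw [Finset.eq_empty_iff_forall_notMem]
    intro y hy
    have := hmax _ ((mem_cols (by omega)).1 hy)
    simp only at this
    omega
  have hpD : p ∈ cols N U (h + 1) := (mem_cols (by omega)).2 hp
  obtain ⟨L₁, k1, k2, -, k4⟩ := PathLabeling.exists_threadFrom (fun x hx => (hU x hx).1) hhn hemp
    h le_rfl L p hL hpD (fun c h1 h2 => by
      obtain rfl : c = h := by omega
      exact ⟨p, hpD, rfl⟩)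
  rw [← ht] at k4
  set i := L₁ h p with hi
  have htU : t ⊆ U := by
    rintro ⟨c, y⟩ hy
    obtain ⟨d, -, rfl, h2, -⟩ := (k4 c y).1 hy
    exact (mem_cols (by omega)).1 h2
  have hpt : (h + 1, p) ∈ t := (k4 _ _).2 ⟨h, le_rfl, rfl, hpD, rfl⟩
  have hcard : t.card = h + 1 := by
    have himg : t.image Prod.fst = Finset.Icc 1 (h + 1) := by
      ext c
      simp only [Finset.mem_image, Prod.exists, exists_and_right, exists_eq_right, Finset.mem_Icc]
      constructor
      · rintro ⟨y, hy⟩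
        obtain ⟨d, h1, rfl, -⟩ := (k4 c y).1 hy
        omega
      · rintro ⟨h1, h2⟩
        obtain ⟨y, y1, -, y3⟩ := k1.exists_left hhn hpD (c - 1) (by omega)
        refine ⟨y, (k4 c y).2 ⟨c - 1, by omega, by omega, ?_, y3⟩⟩
        rwa [Nat.sub_add_cancel h1] at y1
    rw [← Finset.card_image_of_injOn (f := Prod.fst) (s := t), himg, Nat.card_Icc]
    · omega
    · rintro ⟨c, y⟩ hy ⟨c', z⟩ hz he
      simp only at he
      subst he
      obtain ⟨d, h1, rfl, h2, h3⟩ := (k4 c y).1 hy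
      obtain ⟨d', h4, h5, h6, h7⟩ := (k4 _ z).1 hz
      obtain rfl : d' = d := by omega
      rw [k1.inj d' (by omega) h2 h6 (h3.trans h7.symm)]
  have hi0 : i ∈ cols N U 1 := by
    obtain ⟨y, y1, -, y3⟩ := k1.exists_left hhn hpD 0 (by omega)
    rw [k1.base y y1] at y3
    rw [← y3] at hi
    exact hi ▸ y1
  have hcol1 : (∑ x ∈ t with x.1 = 1, Finsupp.single x.2 t.card) = Finsupp.single i (h + 1) := by
    have : (t.filter fun x => x.1 = 1) = {(1, i)} := by
      ext ⟨c, y⟩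
      rw [Finset.mem_filter, k4, Finset.mem_singleton, Prod.mk.injEq]
      constructor
      · rintro ⟨⟨d, h1, h2, h3, h4⟩, rfl⟩
        obtain rfl : d = 0 := by omega
        rw [k1.base y h3] at h4
        exact ⟨rfl, h4⟩
      · rintro ⟨rfl, rfl⟩
        exact ⟨⟨0, by omega, rfl, hi0, k1.base _ hi0⟩, rfl⟩
    rw [this, Finset.sum_singleton, hcard]
  rw [hcol1] at hθ
  set U' := U \ t with hU'
  have hmemU' : ∀ c y, y ∈ cols N U' (c + 1) ↔ y ∈ cols N U (c + 1) ∧ (c + 1, y) ∉ t := by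
    intro c y
    rw [mem_cols (by omega), mem_cols (by omega), hU', Finset.mem_sdiff]
  have hlab : ∀ c, ∀ y ∈ cols N U (c + 1), (c + 1, y) ∉ t → L₁ c y ≠ i := by
    intro c y hy hyt hcon
    refine hyt ((k4 _ _).2 ⟨c, ?_, rfl, hy, hcon⟩)
    by_contra h1
    rw [hemp c (by omega)] at hy
    simp at hy
  have htmem : ∀ c y, (c + 1, y) ∈ t ↔ c ≤ h ∧ y ∈ cols N U (c + 1) ∧ L₁ c y = i := by
    intro c y
    rw [k4]
    constructor
    · rintro ⟨d, h1, h2, h3, h4⟩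
      obtain rfl : d = c := by omega
      exact ⟨h1, h3, h4⟩
    · rintro ⟨h1, h2, h3⟩
      exact ⟨c, h1, rfl, h2, h3⟩
  have hpath' : PathLabeling n (fun c => cols N U' (c + 1)) L₁ := by
    refine ⟨fun y hy => k1.base y ((hmemU' 0 y).1 hy).1, fun c hc y hy z hz => ?_,
      fun c hc y hy => ?_⟩
    · exact k1.inj c hc ((hmemU' c y).1 hy).1 ((hmemU' c z).1 hz).1
    · obtain ⟨y1, y2⟩ := (hmemU' _ y).1 hy
      obtain ⟨z, z1, z2, z3⟩ := k1.links c hc y y1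
      refine ⟨z, (hmemU' c z).2 ⟨z1, fun hz => ?_⟩, z2, z3⟩
      rw [((htmem c z).1 hz).2.2] at z3
      exact hlab _ y y1 y2 z3.symm
  obtain ⟨L₂, l1, l2, l3⟩ := ih U'.card (by
      rw [← hw]
      apply Finset.card_lt_card
      rw [Finset.ssubset_iff_of_subset Finset.sdiff_subset]
      exact ⟨_, hp, fun hc => (Finset.mem_sdiff.1 hc).2 hpt⟩)
    (fun x hx => hU x (Finset.mem_sdiff.1 hx).1) hpath' rfl
  have hi0' : i ∉ cols N U' 1 := fun h1 => ((hmemU' 0 i).1 h1).2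
    ((htmem 0 i).2 ⟨by omega, hi0, k1.base i hi0⟩)
  have hlab₂ : ∀ c ≤ n, ∀ y ∈ cols N U' (c + 1), L₂ c y ≠ i := fun c hc y hy hcon =>
    hi0' (hcon ▸ (l1.label_mem c hc y hy).1)
  -- the thread gets the label `i` and the other cells are labeled by induction
  let L₃ : ℕ → ℕ → ℕ := fun c y => if (c + 1, y) ∈ t then i else L₂ c y
  have e1 : ∀ c y, (c + 1, y) ∈ t → L₃ c y = i := fun c y hy => if_pos hy
  have e2 : ∀ c y, (c + 1, y) ∉ t → L₃ c y = L₂ c y := fun c y hy => if_neg hy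
  refine ⟨L₃, ⟨fun y hy => ?_, fun c hc y hy z hz hyz => ?_, fun c hc y hy => ?_⟩,
    fun c hc m => (k2 c hc m).trans ?_, fun c j => ?_⟩
  · by_cases hyt : (0 + 1, y) ∈ t
    · rw [e1 0 y hyt, ← ((htmem 0 y).1 hyt).2.2, k1.base y hy]
    · rw [e2 0 y hyt, l1.base y ((hmemU' 0 y).2 ⟨hy, hyt⟩)]
  · by_cases hyt : (c + 1, y) ∈ t <;> by_cases hzt : (c + 1, z) ∈ t
    · exact k1.inj c hc hy hz (((htmem c y).1 hyt).2.2.trans ((htmem c z).1 hzt).2.2.symm)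
    · rw [e1 c y hyt, e2 c z hzt] at hyz
      exact absurd hyz.symm (hlab₂ c hc z ((hmemU' c z).2 ⟨hz, hzt⟩))
    · rw [e2 c y hyt, e1 c z hzt] at hyz
      exact absurd hyz (hlab₂ c hc y ((hmemU' c y).2 ⟨hy, hyt⟩))
    · rw [e2 c y hyt, e2 c z hzt] at hyz
      exact l1.inj c hc ((hmemU' c y).2 ⟨hy, hyt⟩) ((hmemU' c z).2 ⟨hz, hzt⟩) hyz
  · by_cases hyt : (c + 1 + 1, y) ∈ t
    · obtain ⟨z, z1, z2, z3⟩ := k1.links c hc y hy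
      have h1 := (htmem _ y).1 hyt
      have hzt : (c + 1, z) ∈ t := (htmem c z).2 ⟨by omega, z1, z3.trans h1.2.2⟩
      exact ⟨z, z1, z2, by rw [e1 c z hzt, e1 _ y hyt]⟩
    · obtain ⟨z, z1, z2, z3⟩ := l1.links c hc y ((hmemU' _ y).2 ⟨hy, hyt⟩)
      obtain ⟨z4, z5⟩ := (hmemU' c z).1 z1
      exact ⟨z, z4, z2, by rw [e2 c z z5, e2 _ y hyt, z3]⟩
  · have hun : cols N U (c + 1) =
        cols N U' (c + 1) ∪ (cols N U (c + 1)).filter fun y => (c + 1, y) ∈ t := by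
      ext y
      rw [Finset.mem_union, hmemU', Finset.mem_filter]
      tauto
    have hdisj : Disjoint (cols N U' (c + 1))
        ((cols N U (c + 1)).filter fun y => (c + 1, y) ∈ t) := by
      rw [Finset.disjoint_left]
      intro y h1 h2
      exact ((hmemU' c y).1 h1).2 (Finset.mem_filter.1 h2).2
    rw [hun, lowCount_union hdisj, lowCount_union hdisj,
      lowCount_congr (f := L₃ c) (g := L₂ c) m fun y hy _ => e2 c y ((hmemU' c y).1 hy).2,
      lowCount_congr (f := L₃ c) (g := L₁ c) m fun y hy _ => by
        rw [e1 c y (Finset.mem_filter.1 hy).2, ((htmem c y).1 (Finset.mem_filter.1 hy).2).2.2]]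
    exact Nat.add_le_add_right (l2 c hc m) _
  · have h1 := l3 c j
    rw [hθ, Finsupp.add_apply, Finsupp.single_apply]
    split_ifs with hij
    · subst hij
      have h2 : threadWeight U' i = 0 := by
        by_contra hcon
        obtain ⟨y, y1, y2⟩ := (l3 0 i).1 (Nat.pos_of_ne_zero hcon)
        exact hlab₂ 0 (by omega) y y1 y2
      rw [h2]
      constructor
      · intro h3
        obtain ⟨y, y1, -, y3⟩ := k1.exists_left hhn hpD c (by omega)
        exact ⟨y, y1, e1 c y ((htmem c y).2 ⟨by omega, y1, y3⟩)⟩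
      · rintro ⟨y, y1, y2⟩
        by_contra h3
        rw [hemp c (by omega)] at y1
        simp at y1
    · rw [zero_add, h1]
      constructor
      · rintro ⟨y, y1, y2⟩
        obtain ⟨y3, y4⟩ := (hmemU' c y).1 y1
        exact ⟨y, y3, by rw [e2 c y y4, y2]⟩
      · rintro ⟨y, y1, y2⟩
        by_cases hyt : (c + 1, y) ∈ t
        · rw [e1 c y hyt] at y2
          exact absurd y2 hij
        · rw [e2 c y hyt] at y2
          exact ⟨y, (hmemU' c y).2 ⟨y1, hyt⟩, y2⟩

/-! ### Good labelings and semi-proper labelings -/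

/-- The labels of a good labeling can be replaced by the rows of their cells in column `1`. -/
theorem IsGood.exists_rooted {N n : ℕ} {b : ℕ → ℕ → ℕ} {T : Diagram} {L : ℕ → ℕ → ℕ} (hn : 1 ≤ n)
    (hpos : ∀ x ∈ T, 1 ≤ x.1 ∧ 1 ≤ x.2) (hL : IsGood n b (cols N T) L) :
    ∃ L', IsGood n b (cols N T) L' ∧ (∀ p ∈ cols N T 1, L' 1 p = p) ∧
      (∀ c, 1 ≤ c → c ≤ n → ∀ p ∈ cols N T c, L' c p ≤ L c p) ∧
      ∀ c, 1 ≤ c → c ≤ n → ∀ p ∈ cols N T c, ∀ d, 1 ≤ d → d ≤ n → ∀ q ∈ cols N T d,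
        (L' c p = L' d q ↔ L c p = L d q) := by
  have hex : ∀ c, 1 ≤ c → c ≤ n → ∀ p ∈ cols N T c, ∃ q ∈ cols N T 1, L 1 q = L c p ∧ p ≤ q := by
    intro c h1 h2 p hp
    obtain ⟨q, q1, q2, q3⟩ := hL.path.exists_left h2 hp 1 h1
    exact ⟨q, q1, q3, q2⟩
  choose! ρ h1 h2 h3 using hex
  have hroot : ∀ p ∈ cols N T 1, ρ 1 p = p := fun p hp =>
    hL.path.inj 1 hn (h1 1 le_rfl hn p hp) hp (h2 1 le_rfl hn p hp)
  have hle : ∀ c, 1 ≤ c → c ≤ n → ∀ p ∈ cols N T c, ρ c p ≤ L c p := fun c k1 k2 p hp =>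
    h2 c k1 k2 p hp ▸ (hL.path.label_mem 1 hn _ (h1 c k1 k2 p hp)).2
  have hiff : ∀ c, 1 ≤ c → c ≤ n → ∀ p ∈ cols N T c, ∀ d, 1 ≤ d → d ≤ n → ∀ q ∈ cols N T d,
        (ρ c p = ρ d q ↔ L c p = L d q) := by
    intro c c1 c2 p hp d d1 d2 q hq
    constructor
    · intro h
      rw [← h2 c c1 c2 p hp, h, h2 d d1 d2 q hq]
    · intro h
      apply hL.path.inj 1 hn (h1 c c1 c2 p hp) (h1 d d1 d2 q hq)
      rw [h2 c c1 c2 p hp, h, h2 d d1 d2 q hq]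
  obtain ⟨L', e0, e⟩ : ∃ L' : ℕ → ℕ → ℕ, (∀ p, L' 0 p = p) ∧ ∀ c, 1 ≤ c → L' c = ρ c :=
    ⟨fun c p => if c = 0 then p else ρ c p, fun p => if_pos rfl, fun c hc => by
      funext p
      exact if_neg (by omega)⟩
  refine ⟨L', ⟨⟨fun p _ => e0 p, fun c hc p hp q hq h => ?_,
    fun c hc p hp => ?_⟩, fun c c1 c2 m => ?_⟩, fun p hp => ?_, fun c c1 c2 p hp => ?_,
    fun c c1 c2 p hp d d1 d2 q hq => ?_⟩
  · rcases Nat.eq_zero_or_pos c with rfl | hc0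
    · rwa [e0, e0] at h
    · rw [e c hc0] at h
      exact hL.path.inj c hc hp hq ((hiff c hc0 hc p hp c hc0 hc q hq).1 h)
  · rw [e (c + 1) (by omega)]
    rcases Nat.eq_zero_or_pos c with rfl | hc0
    · refine ⟨p, ?_, le_rfl, (e0 p).trans (hroot p hp).symm⟩
      have k1 := (hpos _ ((mem_cols (by omega)).1 hp)).2
      have k2 := hL.path.label_mem 1 hn p hp
      rw [cols_zero, Finset.mem_Icc] at k2 ⊢
      exact ⟨k1, k2.2.trans k2.1.2⟩
    · obtain ⟨q, q1, q2, q3⟩ := hL.path.links c hc p hp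
      refine ⟨q, q1, q2, ?_⟩
      rw [e c hc0]
      exact (hiff c hc0 (by omega) q q1 (c + 1) (by omega) hc p hp).2 q3
  · rw [e c c1]
    refine (hL.bound c c1 c2 m).trans (Finset.card_le_card fun p => ?_)
    simp only [Finset.mem_filter]
    rintro ⟨k1, k2, k3⟩
    exact ⟨k1, k2, (hle c c1 c2 p k1).trans k3⟩
  · rw [e 1 le_rfl]
    exact hroot p hp
  · rw [e c c1]
    exact hle c c1 c2 p hp
  · rw [e c c1, e d d1]
    exact hiff c c1 c2 p hp d d1 d2 q hq

/-- The shape `γ` of the labeling `L`: the part `γ j` is the number of columns in which the label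
`j` occurs. -/
def HasShape (N : ℕ) (T : Diagram) (L : ℕ → ℕ → ℕ) (γ : Comp) : Prop :=
  ∀ c j, 1 ≤ c → (c ≤ γ j ↔ ∃ q ∈ cols N T c, L c q = j)

theorem PathLabeling.exists_hasShape {N n : ℕ} {T : Diagram} {L : ℕ → ℕ → ℕ}
    (hL : PathLabeling n (cols N T) L) (hT : ∀ c, n < c → cols N T c = ∅) :
    ∃ γ, HasShape N T L γ := by
  classical
  set f : ℕ → ℕ := fun j => ((Finset.Icc 1 n).filter fun c => ∃ q ∈ cols N T c, L c q = j).card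
    with hf
  have hiff : ∀ c j, 1 ≤ c → (c ≤ f j ↔ ∃ q ∈ cols N T c, L c q = j) := by
    intro c j hc
    constructor
    · intro h
      by_contra hcon
      have : f j ≤ (Finset.Icc 1 (c - 1)).card := by
        apply Finset.card_le_card
        intro d
        simp only [Finset.mem_filter, Finset.mem_Icc]
        rintro ⟨⟨h1, h2⟩, q, q1, rfl⟩
        refine ⟨h1, ?_⟩
        by_contra h3
        obtain ⟨q', k1, -, k3⟩ := hL.exists_left h2 q1 c (by omega)
        exact hcon ⟨q', k1, k3⟩
      rw [Nat.card_Icc] at this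
      omega
    · rintro ⟨q, q1, rfl⟩
      have hcn : c ≤ n := by
        by_contra h
        rw [hT c (by omega)] at q1
        simp at q1
      have e : c = (Finset.Icc 1 c).card := by simp
      refine e.trans_le (Finset.card_le_card fun d => ?_)
      simp only [Finset.mem_filter, Finset.mem_Icc]
      rintro ⟨h1, h2⟩
      obtain ⟨q', k1, -, k3⟩ := hL.exists_left hcn q1 d h2
      exact ⟨⟨h1, h2.trans hcn⟩, q', k1, k3⟩
  refine ⟨Finsupp.onFinset ((cols N T 1).image (L 1)) f fun j hj => ?_, hiff⟩
  obtain ⟨q, q1, q2⟩ := (hiff 1 j le_rfl).1 (by omega)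
  exact Finset.mem_image.2 ⟨q, q1, q2⟩

theorem HasShape.partCount_eq {N n : ℕ} {T : Diagram} {L : ℕ → ℕ → ℕ} {γ : Comp}
    (h : HasShape N T L γ) (hL : PathLabeling n (cols N T) L) {c : ℕ} (hc : 1 ≤ c) (hcn : c ≤ n)
    (m : ℕ) : partCount γ c m = lowCount (cols N T c) (L c) m 0 := by
  unfold partCount lowCount
  symm
  apply Finset.card_bij fun p _ => L c p
  · intro p
    simp only [Finset.mem_filter, Finset.mem_Icc]
    rintro ⟨h1, -, h3⟩
    have := (hL.label_mem c hcn p h1).1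
    rw [cols_zero, Finset.mem_Icc] at this
    exact ⟨⟨this.1, h3⟩, (h c _ hc).2 ⟨p, h1, rfl⟩⟩
  · intro p hp q hq hpq
    exact hL.inj c hcn (Finset.mem_filter.1 hp).1 (Finset.mem_filter.1 hq).1 hpq
  · intro j
    simp only [Finset.mem_filter, Finset.mem_Icc]
    rintro ⟨h1, h2⟩
    obtain ⟨q, q1, q2⟩ := (h c j hc).1 h2
    exact ⟨q, ⟨q1, Nat.zero_le _, by omega⟩, q2⟩

/-- Diagrams with a good labeling for the bounds given by `β`, and with the column sizes of `β`. -/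
abbrev AdmissibleFor (N n : ℕ) (β : Comp) (T : Diagram) : Prop :=
  Admissible N n (partCount β) (fun c => partCount β c N) T

theorem Admissible.cols_eq_empty {N n : ℕ} {β : Comp} {T : Diagram} (h : AdmissibleFor N n β T)
    (hn : partCount β n N = 0) {c : ℕ} (hc : 1 ≤ c) (hnc : n ≤ c) : cols N T c = ∅ := by
  rw [← Finset.card_eq_zero, h.card c hc]
  have := partCount_anti β hnc N
  omega

theorem HasShape.dominated {N n : ℕ} {β : Comp} {T : Diagram} {L : ℕ → ℕ → ℕ} {γ : Comp}
    (h : HasShape N T L γ) (hn1 : 1 ≤ n) (hn : partCount β n N = 0)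
    (hbN : ∀ j, N < j → β j = 0) (hT : AdmissibleFor N n β T)
    (hL : IsGood n (partCount β) (cols N T) L) : Dominated N β γ := by
  have hmem : ∀ j, 1 ≤ γ j → 1 ≤ j ∧ j ≤ N := by
    intro j hj
    obtain ⟨q, q1, q2⟩ := (h 1 j le_rfl).1 hj
    have := (hL.path.label_mem 1 hn1 q q1).1
    rw [cols_zero, Finset.mem_Icc] at this
    omega
  have hzero : ∀ c, n ≤ c → ∀ m, partCount β c m = 0 := by
    intro c hc m
    have h1 := partCount_anti β hc N
    rcases Nat.le_total m N with h2 | h2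
    · have := partCount_mono β c h2
      omega
    · have := partCount_of_le hbN (hn1.trans hc) h2
      omega
  refine ⟨?_, fun j hj => ?_, fun c => ?_, fun c m => ?_⟩
  · by_contra hcon
    have := hmem 0 (by omega)
    omega
  · by_contra hcon
    have := hmem j (by omega)
    omega
  · rcases Nat.eq_zero_or_pos c with rfl | hc
    · simp [partCount]
    rcases Nat.lt_or_ge n c with hcn | hcn
    · rw [hzero c hcn.le]
      unfold partCount
      rw [Finset.card_eq_zero, Finset.filter_eq_empty_iff]
      intro j _ hj
      obtain ⟨q, q1, -⟩ := (h c j hc).1 hj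
      rw [hT.cols_eq_empty hn hc hcn.le] at q1
      simp at q1
    · rw [h.partCount_eq hL.path hc hcn, lowCount_eq_card, ← hT.card c hc]
      · simp
      · intro p hp
        have := (hL.path.label_mem c hcn p hp).1
        rw [cols_zero, Finset.mem_Icc] at this
        exact this.2
  · rcases Nat.eq_zero_or_pos c with rfl | hc
    · simp [partCount]
    rcases Nat.lt_or_ge n c with hcn | hcn
    · rw [hzero c hcn.le]
      omega
    · rw [h.partCount_eq hL.path hc hcn]
      exact hL.bound c hc hcn m

theorem HasShape.isSemiProper {N n : ℕ} {T : Diagram} {L : ℕ → ℕ → ℕ} {γ : Comp}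
    (h : HasShape N T L γ) (hL : PathLabeling n (cols N T) L) (hpos : ∀ x ∈ T, 1 ≤ x.1)
    (hT : ∀ c, n < c → cols N T c = ∅) : IsSemiProper γ T fun x => L x.1 x.2 := by
  have hn : ∀ x ∈ T, x.1 ≤ n ∧ x.2 ∈ cols N T x.1 := by
    intro x hx
    have h1 : x.2 ∈ cols N T x.1 := (mem_cols (hpos x hx)).2 hx
    refine ⟨?_, h1⟩
    by_contra hcon
    rw [hT _ (by omega)] at h1
    simp at h1
  refine ⟨fun c hc => ⟨fun p hp => ?_, fun p hp q hq hpq => ?_, fun j hj => ?_⟩, fun x hx => ?_,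
    fun x hx y hy hxy hlt => ?_⟩
  · have h1 := hn _ hp
    have h2 := (hL.label_mem c h1.1 p h1.2).1
    rw [cols_zero, Finset.mem_Icc] at h2
    exact ⟨h2.1, (h c _ hc).2 ⟨p, h1.2, rfl⟩⟩
  · exact hL.inj c (hn _ hp).1 (hn _ hp).2 (hn _ hq).2 hpq
  · obtain ⟨q, q1, q2⟩ := (h c j hc).1 hj.2
    exact ⟨q, (mem_cols hc).1 q1, q2⟩
  · exact (hL.label_mem x.1 (hn x hx).1 x.2 (hn x hx).2).2
  · obtain ⟨q, q1, q2, q3⟩ := hL.exists_left (hn y hy).1 (hn y hy).2 x.1 hlt.le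
    rwa [hL.inj x.1 (hn x hx).1 q1 (hn x hx).2 (q3.trans hxy.symm)] at q2

/-- A semi-proper labeling, extended by the virtual column `0`. -/
def withColumnZero (L : Cell → ℕ) (c p : ℕ) : ℕ := if c = 0 then p else L (c, p)

theorem withColumnZero_of_pos (L : Cell → ℕ) {c : ℕ} (h : 1 ≤ c) (p : ℕ) :
    withColumnZero L c p = L (c, p) := if_neg (by omega)

theorem IsSemiProper.isGood {N n : ℕ} {β γ : Comp} {T : Diagram} {L : Cell → ℕ}
    (h : IsSemiProper γ T L) (hγ : Dominated N β γ) :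
    IsGood n (partCount β) (cols N T) (withColumnZero L) := by
  have hpath : PathLabeling n (cols N T) (withColumnZero L) := by
    refine ⟨fun p _ => if_pos rfl, fun c _ p hp q hq hpq => ?_, fun c _ p hp => ?_⟩
    · rcases Nat.eq_zero_or_pos c with rfl | hc
      · simpa [withColumnZero] using hpq
      · rw [withColumnZero_of_pos L hc, withColumnZero_of_pos L hc] at hpq
        exact (h.strict c hc).injOn ((mem_cols hc).1 hp) ((mem_cols hc).1 hq) hpq
    · have hpT := (mem_cols (by omega)).1 hp
      have h1 := (h.strict (c + 1) (by omega)).mapsTo hpT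
      simp only [Set.mem_ofPred_eq] at h1
      rw [withColumnZero_of_pos L (by omega)]
      rcases Nat.eq_zero_or_pos c with rfl | hc
      · refine ⟨L (1, p), ?_, h.flagged _ hpT, if_pos rfl⟩
        rw [cols_zero, Finset.mem_Icc]
        refine ⟨h1.1, ?_⟩
        by_contra hcon
        have := hγ.bdd (L (1, p)) (by omega)
        have := h1.2
        simp only [Nat.zero_add] at this
        omega
      · obtain ⟨q, q1, q2⟩ := (h.strict c hc).surjOn
          (show L (c + 1, p) ∈ {i | 1 ≤ i ∧ c ≤ γ i} from ⟨h1.1, by omega⟩)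
        refine ⟨q, (mem_cols hc).2 q1, h.descending _ q1 _ hpT q2 (by simp), ?_⟩
        rw [withColumnZero_of_pos L hc]
        exact q2
  refine ⟨hpath, fun c hc hcn m => (hγ.le c m).trans_eq ?_⟩
  refine HasShape.partCount_eq (fun d j hd => ?_) hpath hc hcn m
  constructor
  · intro hj
    obtain ⟨q, q1, q2⟩ := (h.strict d hd).surjOn (show j ∈ {i | 1 ≤ i ∧ d ≤ γ i} from
      ⟨by by_contra h0; obtain rfl : j = 0 := by omega
          rw [hγ.zero] at hj
          omega, hj⟩)
    exact ⟨q, (mem_cols hd).2 q1, (withColumnZero_of_pos L hd q).trans q2⟩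
  · rintro ⟨q, q1, rfl⟩
    rw [withColumnZero_of_pos L hd]
    exact ((h.strict d hd).mapsTo ((mem_cols hd).1 q1)).2

/-- The thread weight of an admissible diagram is a rearrangement of `β` below `β`, and its support
is given by column `1`. -/
theorem Admissible.threadWeight {N n : ℕ} {β : Comp} {T : Diagram} (h : AdmissibleFor N n β T)
    (hn1 : 1 ≤ n) (hn : partCount β n N = 0) (hbN : ∀ j, N < j → β j = 0) :
    Dominated N β (threadWeight T) ∧ ∀ j, (1, j) ∈ T ↔ threadWeight T j ≠ 0 := by
  obtain ⟨L, hL⟩ := h.good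
  obtain ⟨L', h1, h2, -, -⟩ := hL.exists_rooted hn1 h.pos
  obtain ⟨n', rfl⟩ : ∃ n', n = n' + 1 := ⟨n - 1, by omega⟩
  have hU : ∀ x ∈ T, 1 ≤ x.1 ∧ x.1 ≤ n' + 1 := by
    intro x hx
    have hx1 := (h.pos x hx).1
    refine ⟨hx1, ?_⟩
    by_contra hcon
    have h3 : x.2 ∈ cols N T x.1 := (mem_cols hx1).2 hx
    rw [h.cols_eq_empty hn hx1 (by omega)] at h3
    simp at h3
  obtain ⟨L₂, k1, k2, k3⟩ := PathLabeling.exists_threadWeight (N := N) (n := n') (U := T)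
    (L := fun c => L' (c + 1)) hU ⟨h2, fun c hc => h1.path.inj (c + 1) (by omega),
      fun c hc => h1.path.links (c + 1) (by omega)⟩
  -- the labeling of the threads, with the virtual column `0` again
  let L₃ : ℕ → ℕ → ℕ := fun c p => if c = 0 then p else L₂ (c - 1) p
  have e : ∀ c, L₃ (c + 1) = L₂ c := fun c => by
    funext p
    exact if_neg (by omega)
  have hpath : PathLabeling (n' + 1) (cols N T) L₃ := by
    refine ⟨fun p _ => if_pos rfl, fun c hc => ?_, fun c hc => ?_⟩
    · rcases Nat.eq_zero_or_pos c with rfl | hc0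
      · intro p _ q _ hpq
        exact hpq
      · obtain ⟨c, rfl⟩ : ∃ c', c = c' + 1 := ⟨c - 1, by omega⟩
        rw [e]
        exact k1.inj c (by omega)
    · rw [e]
      rcases Nat.eq_zero_or_pos c with rfl | hc0
      · intro p hp
        obtain ⟨q, q1, q2, q3⟩ := h1.path.links 0 hc p hp
        have h4 := h1.path.base q q1
        have h5 := h2 p hp
        rw [zero_add] at q3
        refine ⟨p, ?_, le_rfl, (k1.base p hp).symm⟩
        rwa [← h5, ← q3, h4]
      · obtain ⟨c, rfl⟩ : ∃ c', c = c' + 1 := ⟨c - 1, by omega⟩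
        rw [e]
        exact k1.links c (by omega)
  have hshape : HasShape N T L₃ (Kohnert.threadWeight T) := by
    intro c j hc
    obtain ⟨c, rfl⟩ : ∃ c', c = c' + 1 := ⟨c - 1, by omega⟩
    rw [e]
    exact k3 c j
  refine ⟨hshape.dominated hn1 hn hbN h ⟨hpath, fun c c1 c2 m => ?_⟩, fun j => ?_⟩
  · obtain ⟨c, rfl⟩ : ∃ c', c = c' + 1 := ⟨c - 1, by omega⟩
    rw [e]
    exact (h1.bound (c + 1) c1 c2 m).trans (k2 c (by omega) m)
  · rw [← Nat.one_le_iff_ne_zero, hshape 1 j le_rfl, ← mem_cols (N := N) le_rfl]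
    constructor
    · intro hj
      exact ⟨j, hj, k1.base j hj⟩
    · rintro ⟨q, q1, q2⟩
      rw [show L₃ 1 q = q from k1.base q q1] at q2
      exact q2 ▸ q1

/-! ### Rectification as a run -/

section Rectification

variable {N n k : ℕ} {β α : Comp} {T : Diagram} {x : Cell}

theorem LabelAt.withColumnZero {L : Cell → ℕ} {c i p : ℕ} (hpos : ∀ x ∈ T, 1 ≤ x.1)
    (hi : i ≤ N) (h : LabelAt T L c i p) : p ∈ cols N T c ∧ withColumnZero L c p = i := by
  rcases h with ⟨h1, h2⟩ | ⟨rfl, h1, rfl⟩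
  · have := hpos _ h1
    exact ⟨(mem_cols this).2 h1, (withColumnZero_of_pos L this p).trans h2⟩
  · exact ⟨by rw [cols_zero, Finset.mem_Icc]; exact ⟨h1, hi⟩, if_pos rfl⟩

theorem Lands.canLand (h0 : β 0 = 0) (hbN : ∀ j, N < j → β j = 0) (hkN : k ≤ N)
    (hα : SwapLE α β) (hpos : ∀ x ∈ T, 1 ≤ x.1) (hx : 1 ≤ x.1) (h : Lands k α T x) :
    CanLand N n (partCount β) k T x := by
  obtain ⟨α', L, i, h1, h2, h3, ⟨⟨p, p1, p2⟩, -⟩, h5⟩ := h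
  have hdom : Dominated N β α' :=
    SwapLE.dominated (Relation.ReflTransGen.trans hα h1.swapLE) h0 hbN
  obtain ⟨k1, k2⟩ := p2.withColumnZero hpos (h3.trans hkN)
  refine ⟨_, h2.isGood hdom, i, h3, ⟨p, k1, p1, k2⟩, fun q hq hcon => ?_⟩
  rw [withColumnZero_of_pos L hx] at hcon
  have := ((h2.strict x.1 hx).mapsTo ((mem_cols hx).1 hq)).2
  simp only [hcon] at this
  omega

theorem canBump_of_mem_bumpRows (h0 : β 0 = 0) (hbN : ∀ j, N < j → β j = 0) (hkN : k ≤ N)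
    (hα : SwapLE α β) (hpos : ∀ x ∈ T, 1 ≤ x.1) (hx : 1 ≤ x.1) {p : ℕ}
    (h : p ∈ bumpRows k α T x) : CanBump N n (partCount β) k T x p := by
  obtain ⟨hp, hpT, α', L, i, h1, h2, h3, ⟨⟨q, q1, q2⟩, -⟩, h5⟩ := h
  have hdom : Dominated N β α' :=
    SwapLE.dominated (Relation.ReflTransGen.trans hα h1.swapLE) h0 hbN
  obtain ⟨k1, k2⟩ := q2.withColumnZero hpos (h3.trans hkN)
  have e := (withColumnZero_of_pos L hx p).trans h5
  exact ⟨hp, hpT, _, h2.isGood hdom, e.trans_le h3, q, k1, q1, k2.trans e.symm⟩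

/-- The composition `α` lies above all rearrangements `⪯ β` whose support is column `1`
of `T`. -/
structure IsTop (N : ℕ) (β : Comp) (T : Diagram) (α : Comp) : Prop where
  swapLE : SwapLE α β
  mem_iff : ∀ j, (1, j) ∈ T ↔ α j ≠ 0
  pinnedLE : ∀ γ, Dominated N β γ → (∀ j, γ j = 0 ↔ α j = 0) → PinnedLE γ α

/-- A good labeling yields a semi-proper labeling whose shape is `⪯⁰ α`, with the same coincidences
between labels. -/
theorem IsTop.exists_isSemiProper (hα : IsTop N β T α) (hbN : ∀ j, N < j → β j = 0) (hn1 : 1 ≤ n)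
    (hn : partCount β n N = 0) (hT : AdmissibleFor N n β T) {L : ℕ → ℕ → ℕ}
    (hL : IsGood n (partCount β) (cols N T) L) :
    ∃ γ L', PinnedLE γ α ∧ IsSemiProper γ T (fun x => L' x.1 x.2) ∧ HasShape N T L' γ ∧
      PathLabeling n (cols N T) L' ∧
      (∀ c, 1 ≤ c → c ≤ n → ∀ p ∈ cols N T c, L' c p ≤ L c p) ∧
      ∀ c, 1 ≤ c → c ≤ n → ∀ p ∈ cols N T c, ∀ d, 1 ≤ d → d ≤ n → ∀ q ∈ cols N T d,
        (L' c p = L' d q ↔ L c p = L d q) := by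
  obtain ⟨L', h1, h2, h3, h4⟩ := hL.exists_rooted hn1 hT.pos
  have hemp : ∀ c, n < c → cols N T c = ∅ := fun c hc =>
    hT.cols_eq_empty hn (hn1.trans hc.le) hc.le
  obtain ⟨γ, hγ⟩ := h1.path.exists_hasShape hemp
  refine ⟨γ, L', hα.pinnedLE γ (hγ.dominated hn1 hn hbN hT h1) fun j => ?_,
    hγ.isSemiProper h1.path (fun x hx => (hT.pos x hx).1) hemp, hγ, h1.path, h3, h4⟩
  rw [← not_iff_not]
  change γ j ≠ 0 ↔ α j ≠ 0
  rw [← hα.mem_iff, ← Nat.one_le_iff_ne_zero, hγ 1 j le_rfl, ← mem_cols (N := N) le_rfl]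
  constructor
  · rintro ⟨q, q1, q2⟩
    rw [h2 q q1] at q2
    exact q2 ▸ q1
  · exact fun hj => ⟨j, hj, h2 j hj⟩

theorem IsTop.lands_of_col_eq_one (hα : IsTop N β T α) (hbN : ∀ j, N < j → β j = 0) (hn1 : 1 ≤ n)
    (hn : partCount β n N = 0) (hs : IsState N n (partCount β) (fun c => partCount β c N) T x)
    (hxk : x.2 ≤ k) (hx : x.1 = 1) : Lands k α T x := by
  obtain ⟨L, hL⟩ := hs.adm.good
  obtain ⟨γ, L', h1, h2, -⟩ := hα.exists_isSemiProper hbN hn1 hn hs.adm hL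
  have h3 : γ x.2 = 0 := by
    rw [h1.eq_zero_iff]
    by_contra hcon
    refine hs.vacant ?_
    have := (hα.mem_iff x.2).2 hcon
    rwa [← hx] at this
  have h4 : γ x.2 = x.1 - 1 := by omega
  exact ⟨γ, _, x.2, h1, h2, hxk,
    ⟨⟨x.2, le_rfl, Or.inr ⟨by omega, hs.row_pos, rfl⟩⟩, Or.inl h4⟩, h4⟩

theorem IsTop.lands_or_bump (hα : IsTop N β T α) (hbN : ∀ j, N < j → β j = 0) (hn1 : 1 ≤ n)
    (hn : partCount β n N = 0) (hs : IsState N n (partCount β) (fun c => partCount β c N) T x)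
    (hxk : x.2 ≤ k) (h : Reach n (partCount β) k (cols N T) (x.1 - 1) x.2) :
    Lands k α T x ∨ (bumpRows k α T x).Nonempty := by
  rcases Nat.eq_or_lt_of_le hs.col_pos with hx | hx
  · exact Or.inl (hα.lands_of_col_eq_one hbN hn1 hn hs hxk hx.symm)
  obtain ⟨c, hc⟩ : ∃ c, x.1 = c + 1 := ⟨x.1 - 1, by omega⟩
  have hcn := hs.col_le
  rw [hc, Nat.add_sub_cancel] at h
  obtain ⟨L, hL, i, hi, ⟨p, p1, p2, p3⟩, hlow⟩ := h
  obtain ⟨γ, L', h1, h2, h3, h4, h5, h6⟩ := hα.exists_isSemiProper hbN hn1 hn hs.adm hL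
  have hpT : (c, p) ∈ T := (mem_cols (by omega)).1 p1
  have hleft : ∃ p', x.2 ≤ p' ∧ LabelAt T (fun x => L' x.1 x.2) (x.1 - 1) (L' c p) p' := by
    rw [hc, Nat.add_sub_cancel]
    exact ⟨p, p2, Or.inl ⟨hpT, rfl⟩⟩
  have hk : L' c p ≤ k := (h5 c (by omega) (by omega) p p1).trans (by omega)
  by_cases hq : ∃ q ∈ cols N T (c + 1), L' (c + 1) q = L' c p
  · obtain ⟨q, q1, q2⟩ := hq
    have hqL := (h6 (c + 1) (by omega) (by omega) q q1 c (by omega) (by omega) p p1).1 q2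
    have hqT : (x.1, q) ∈ T := by rw [hc]; exact (mem_cols (by omega)).1 q1
    have hqx : q < x.2 := by
      refine lt_of_le_of_ne (hlow q q1 (hqL.trans p3)) ?_
      rintro rfl
      exact hs.vacant hqT
    refine Or.inr ⟨q, hqx, hqT, γ, _, L' c p, h1, h2, hk, ⟨hleft, Or.inr ⟨q, hqx, ?_⟩⟩, ?_⟩
    · exact Or.inl ⟨hqT, by simp only [hc, q2]⟩
    · simp only [hc, q2]
  · have e : γ (L' c p) = x.1 - 1 := by
      have h7 := (h3 c (L' c p) (by omega)).2 ⟨p, p1, rfl⟩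
      have h8 := (h3 (c + 1) (L' c p) (by omega)).not.2 hq
      omega
    exact Or.inl ⟨γ, _, L' c p, h1, h2, hk, ⟨hleft, Or.inl e⟩, e⟩

/-- Rectification is a run. -/
theorem IsTop.run (hα : IsTop N β T α) (h0 : β 0 = 0) (hbN : ∀ j, N < j → β j = 0)
    (hkN : k ≤ N) (hn1 : 1 ≤ n) (hn : partCount β n N = 0)
    (hs : IsState N n (partCount β) (fun c => partCount β c N) T x) (hxk : x.2 ≤ k) :
    Run N n (partCount β) k T x (rect k α T x) := by
  classical
  induction hw : x.1 + x.2 using Nat.strong_induction_on generalizing T x with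
  | _ w ih =>
  have hpos : ∀ y ∈ T, 1 ≤ y.1 := fun y hy => (hs.adm.pos y hy).1
  rw [rect]
  by_cases hl : Lands k α T x
  · rw [if_pos hl]
    exact .land (hl.canLand h0 hbN hkN hα.swapLE hpos hs.col_pos)
  rw [if_neg hl]
  by_cases hb : (bumpRows k α T x).Nonempty
  · rw [dif_pos hb]
    have hp := Nat.sInf_mem hb
    generalize sInf (bumpRows k α T x) = p at hp
    have hp' := canBump_of_mem_bumpRows (n := n) h0 hbN hkN hα.swapLE hpos hs.col_pos hp
    refine .bump hp' (ih (x.1 + p) ?_ ?_ (hs.bump hp') ?_ rfl)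
    · have := hp.1
      omega
    · -- the bumped cell is not in column `1`
      have hx1 : x.1 ≠ 1 := fun hx => hl (hα.lands_of_col_eq_one hbN hn1 hn hs hxk hx)
      refine ⟨hα.swapLE, fun j => ?_, hα.pinnedLE⟩
      rw [← hα.mem_iff, Finset.mem_erase, Finset.mem_insert]
      simp [Prod.ext_iff, Ne.symm hx1]
    · have := hp.1
      simp only
      omega
  rw [dif_neg hb]
  have hreach : ¬ Reach n (partCount β) k (cols N T) (x.1 - 1) x.2 := fun h =>
    (hα.lands_or_bump hbN hn1 hn hs hxk h).elim hl hb
  by_cases hv : (vacantLeft T x).Nonempty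
  · rw [dif_pos hv]
    have hd := Finset.max'_mem _ hv
    have hmax : ∀ d ∈ vacantLeft T x, d ≤ (vacantLeft T x).max' hv :=
      fun d hd => Finset.le_max' _ d hd
    generalize (vacantLeft T x).max' hv = d at hd hmax
    rw [vacantLeft, Finset.mem_filter, Finset.mem_Ico] at hd
    obtain ⟨⟨d1, d2⟩, d3⟩ := hd
    refine .pass hreach d2 d1 d3 (fun e h1 h2 => ?_)
      (ih (d + x.2) (by omega) hα ⟨hs.adm, d3, d1, ?_, hs.row_pos⟩ hxk rfl)
    · by_contra h3
      have := hmax e (by rw [vacantLeft, Finset.mem_filter, Finset.mem_Ico]; exact ⟨⟨by omega, h2⟩, h3⟩)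
      omega
    · have := hs.col_le
      simp only
      omega
  · -- otherwise the label of the row of `x` in the virtual column is abutted
    exfalso
    apply hreach
    have hfill : ∀ c, 0 < c → c ≤ x.1 - 1 → x.2 ∈ cols N T c := by
      intro c h1 h2
      rw [mem_cols h1]
      by_contra h3
      exact hv ⟨c, by rw [vacantLeft, Finset.mem_filter, Finset.mem_Ico]; exact ⟨by omega, h3⟩⟩
    refine Reach.of_filled (c := 0) ?_ (x.1 - 1) (by omega) ?_ hfill
    · obtain ⟨L, hL⟩ := hs.adm.good
      have hx0 : x.2 ∈ cols N T 0 := by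
        rw [cols_zero, Finset.mem_Icc]
        exact ⟨hs.row_pos, hxk.trans hkN⟩
      refine ⟨L, hL, x.2, hxk, ⟨x.2, hx0, le_rfl, hL.path.base _ hx0⟩, fun q hq h => ?_⟩
      exact h ▸ (hL.path.label_mem 1 hn1 q hq).2
    · have := hs.col_pos
      have := hs.col_le
      omega

end Rectification

/-! ### Kohnert diagrams are admissible -/

theorem rowCount_le_of_subset {A B : Finset ℕ} {r s : ℕ}
    (h : ∀ p ∈ A, r ≤ p → p < s → p ∈ B) : rowCount A r s ≤ rowCount B r s := by
  apply Finset.card_le_card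
  intro p
  simp only [Finset.mem_filter]
  rintro ⟨h1, h2, h3⟩
  exact ⟨h p h1 h2 h3, h2, h3⟩

/-- Kohnert moves preserve the existence of good labelings: the cells of the column weakly below the
moved one are labeled anew, greedily. The label counts of the column may drop in the rows above `q`
and up to `r`, but not below those of the next column, which has no cell in row `r`. -/
theorem IsGood.exists_of_kohnert {n : ℕ} {b : ℕ → ℕ → ℕ} {D D' : ℕ → Finset ℕ} {L : ℕ → ℕ → ℕ}
    {e q r : ℕ} (hn : e + 1 ≤ n) (hL : IsGood n b D L) (hr : r ∈ D (e + 1)) (hqr : q < r)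
    (hq : q ∉ D (e + 1)) (hfull : ∀ p, q < p → p < r → p ∈ D (e + 1)) (hr' : r ∉ D (e + 2))
    (hD'e : D' (e + 1) = insert q ((D (e + 1)).erase r)) (hD' : ∀ c, c ≠ e + 1 → D' c = D c) :
    ∃ L', IsGood n b D' L' := by
  have hmem : ∀ p, p ∈ D' (e + 1) ↔ p = q ∨ p ≠ r ∧ p ∈ D (e + 1) := by
    intro p
    rw [hD'e, Finset.mem_insert, Finset.mem_erase]
  have hup : ∀ p, r < p → (p ∈ D' (e + 1) ↔ p ∈ D (e + 1)) := by
    intro p hp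
    rw [hmem]
    constructor
    · rintro (h | h)
      · omega
      · exact h.2
    · exact fun h => Or.inr ⟨by omega, h⟩
  have hcard : ∀ s, ((D' (e + 1)).filter fun p => s ≤ p).card ≤
      ((D (e + 1)).filter fun p => s ≤ p).card := by
    intro s
    apply Finset.card_le_card_of_injOn fun p => if p = q then r else p
    · intro p hp
      simp only [Finset.coe_filter, Set.mem_ofPred_eq, hmem] at hp ⊢
      split_ifs with h
      · exact ⟨hr, by omega⟩
      · exact ⟨by tauto, hp.2⟩
    · intro p hp p' hp' h
      simp only [Finset.coe_filter, Set.mem_ofPred_eq, hmem] at hp hp'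
      simp only at h
      split_ifs at h <;> omega
  obtain ⟨g, g1, g2, g3, g4⟩ := exists_greedy_labels (A := D e) (B := D' (e + 1))
    (hL.path.inj e (by omega)) (r + 1) (L (e + 1))
    (fun p hp p' hp' h => by
      simp only [Finset.coe_filter, Set.mem_ofPred_eq] at hp hp'
      exact hL.path.inj (e + 1) hn ((hup p (by omega)).1 hp.1) ((hup p' (by omega)).1 hp'.1) h)
    (fun p hp => by
      rw [Finset.mem_filter] at hp
      exact hL.path.links e (by omega) p ((hup p (by omega)).1 hp.1))
    (fun s _ => (hcard s).trans (hL.path.card_succ_le (by omega) s))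
  have hhigh : ∀ m s, r < s → lowCount (D' (e + 1)) g m s = lowCount (D (e + 1)) (L (e + 1)) m s := by
    intro m s hs
    rw [lowCount_congr m fun p _ hp => g1 p (by omega)]
    unfold lowCount
    congr 1
    ext p
    simp only [Finset.mem_filter]
    constructor <;> rintro ⟨h1, h2, h3⟩
    · exact ⟨(hup p (by omega)).1 h1, h2, h3⟩
    · exact ⟨(hup p (by omega)).2 h1, h2, h3⟩
  have hbelow : ∀ m s, s ≤ q →
      lowCount (D (e + 1)) (L (e + 1)) m s ≤ lowCount (D' (e + 1)) g m s := by
    intro m s hs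
    rcases g4 m s (by omega) with h | ⟨r', h1, h2, h⟩
    · refine le_trans ?_ h
      rw [hhigh m (r + 1) (by omega)]
      refine (lowCount_split _ _ m s (r + 1)).trans (Nat.add_le_add_right ?_ _)
      apply Finset.card_le_card_of_injOn fun p => if p = r then q else p
      · intro p hp
        simp only [Finset.coe_filter, Set.mem_ofPred_eq, hmem] at hp ⊢
        split_ifs with h
        · exact ⟨Or.inl rfl, hs, by omega⟩
        · exact ⟨Or.inr ⟨h, hp.1⟩, hp.2⟩
      · intro p hp p' hp' h
        simp only [Finset.coe_filter, Set.mem_ofPred_eq] at hp hp'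
        simp only at h
        split_ifs at h with h3 h4 h4
        · exact h3.trans h4.symm
        · exact absurd (h ▸ hp'.1) hq
        · exact absurd (h ▸ hp.1) hq
        · exact h
    · refine le_trans ?_ h
      refine (lowCount_split _ _ m s r').trans (Nat.add_le_add ?_ ?_)
      · exact rowCount_le_of_subset fun p hp _ hpr => (hmem p).2 (Or.inr ⟨by omega, hp⟩)
      · exact hL.path.lowCount_succ_le (by omega) m r'
  have hDe : ∀ c ≤ e, D' c = D c := fun c hc => hD' c (by omega)
  have hpath : PathLabeling (e + 1) D' (Function.update L (e + 1) g) := by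
    refine ((hL.path.mono (by omega : e ≤ n)).congr hDe fun _ _ _ _ => rfl).update_succ g2 ?_
    rw [hDe e le_rfl]
    exact g3
  have hbound : ∀ L' : ℕ → ℕ → ℕ, (∀ c ≤ e + 1, L' c = Function.update L (e + 1) g c) →
      ∀ c, 1 ≤ c → c ≤ e + 1 → ∀ m, b c m ≤ lowCount (D' c) (L' c) m 0 := by
    intro L' hL' c h1 h2 m
    rw [hL' c h2]
    rcases Nat.eq_or_lt_of_le h2 with rfl | h3
    · rw [Function.update_self]
      exact (hL.bound _ h1 hn m).trans (hbelow m 0 (by omega))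
    · rw [Function.update_of_ne (by omega), hDe c (by omega)]
      exact hL.bound c h1 (by omega) m
  rcases Nat.eq_or_lt_of_le hn with rfl | hn'
  · exact ⟨_, hpath, hbound _ fun _ _ => rfl⟩
  have hnext : ∀ m s,
      lowCount (D (e + 2)) (L (e + 2)) m s ≤ lowCount (D' (e + 1)) g m s := by
    intro m s
    have hG := fun s => hL.path.lowCount_succ_le (c := e + 1) hn' m s
    rcases Nat.lt_or_ge r s with hs | hs
    · rw [hhigh m s hs]
      exact hG s
    rcases Nat.lt_or_ge q s with hs' | hs'
    · have hrow : ∀ t, rowCount (D (e + 2)) s t ≤ rowCount (D' (e + 1)) s t ∨ r + 1 < t := by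
        intro t
        rcases Nat.lt_or_ge (r + 1) t with ht | ht
        · exact Or.inr ht
        refine Or.inl (rowCount_le_of_subset fun p hp h1 h2 => (hmem p).2 ?_)
        have : p ≠ r := fun h => hr' (h ▸ hp)
        exact Or.inr ⟨this, hfull p (by omega) (by omega)⟩
      rcases g4 m s (by omega) with h | ⟨r', h1, h2, h⟩
      · refine le_trans ?_ h
        rw [hhigh m (r + 1) (by omega)]
        exact (lowCount_split _ _ m s (r + 1)).trans
          (Nat.add_le_add ((hrow _).resolve_right (by omega)) (hG _))
      · refine le_trans ?_ h
        exact (lowCount_split _ _ m s r').trans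
          (Nat.add_le_add ((hrow _).resolve_right (by omega))
            ((hG _).trans (hL.path.lowCount_succ_le (by omega) m r')))
    · exact (hG s).trans (hbelow m s hs')
  -- in the labeling `L`, column `e + 1` may be replaced by a copy of column `e + 2`
  have hdup : PathLabeling n (Function.update D (e + 1) (D (e + 2)))
      (Function.update L (e + 1) (L (e + 2))) := by
    have e1 : ∀ c, c ≠ e + 1 → Function.update D (e + 1) (D (e + 2)) c = D c := fun c hc =>
      Function.update_of_ne hc _ _
    have e2 : ∀ c, c ≠ e + 1 → Function.update L (e + 1) (L (e + 2)) c = L c := fun c hc =>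
      Function.update_of_ne hc _ _
    have e3 : Function.update D (e + 1) (D (e + 2)) (e + 1) = D (e + 2) :=
      Function.update_self _ _ _
    have e4 : Function.update L (e + 1) (L (e + 2)) (e + 1) = L (e + 2) :=
      Function.update_self _ _ _
    refine ⟨?_, fun c hc => ?_, fun c hc => ?_⟩
    · rw [e1 0 (by omega), e2 0 (by omega)]
      exact hL.path.base
    · by_cases h : c = e + 1
      · subst h
        rw [e3, e4]
        exact hL.path.inj (e + 2) hn'
      · rw [e1 c h, e2 c h]
        exact hL.path.inj c hc
    · by_cases h : c = e + 1
      · subst h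
        rw [e3, e4, e1 _ (by omega), e2 _ (by omega)]
        exact fun p hp => ⟨p, hp, le_rfl, rfl⟩
      rw [e1 c h, e2 c h]
      by_cases h' : c = e
      · subst h'
        rw [e3, e4]
        intro p hp
        obtain ⟨p₁, k1, k2, k3⟩ := hL.path.links (c + 1) (by omega) p hp
        obtain ⟨p₂, l1, l2, l3⟩ := hL.path.links c (by omega) p₁ k1
        exact ⟨p₂, l1, k2.trans l2, l3.trans k3⟩
      · rw [e1 _ (by omega), e2 _ (by omega)]
        exact hL.path.links c hc
  obtain ⟨L', l1, l2, l3⟩ := hpath.exists_extension (N := (D 0).sup id) hn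
    (fun _ : Unit => Function.update D (e + 1) (D (e + 2)))
    (fun _ => Function.update L (e + 1) (L (e + 2))) (fun _ => hdup)
    (fun _ p hp => by
      rw [Function.update_of_ne (by omega)] at hp
      exact Finset.le_sup (f := id) hp)
    (fun _ c hc => by rw [Function.update_of_ne (by omega), hD' c (by omega)])
    (fun m s => ⟨(), by
      rw [Function.update_self, Function.update_self, Function.update_self]
      exact hnext m s⟩)
  refine ⟨L', l1, fun c h1 h2 m => ?_⟩
  rcases Nat.lt_or_ge (e + 1) c with h3 | h3
  · obtain ⟨-, h4⟩ := l3 c h3.le h2 m 0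
    rw [Function.update_of_ne (by omega), Function.update_of_ne (by omega)] at h4
    exact (hL.bound c h1 h2 m).trans h4
  · exact hbound L' l2 c h1 h3 m

theorem Admissible.kohnertMove {N n : ℕ} {b : ℕ → ℕ → ℕ} {s : ℕ → ℕ} {T U : Diagram}
    (h : Admissible N n b s T) (hTU : KohnertMove T U) : Admissible N n b s U := by
  obtain ⟨c, r, q, hr, hright, hq1, hqr, hq, hfull, rfl⟩ := hTU
  have hc := (h.pos _ hr).1
  simp only at hc
  obtain ⟨e, rfl⟩ : ∃ e, c = e + 1 := ⟨c - 1, by omega⟩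
  have hother : ∀ d, d ≠ e + 1 → cols N (insert (e + 1, q) (T.erase (e + 1, r))) d = cols N T d := by
    intro d hd
    apply cols_congr
    intro p
    simp [hd]
  have hself : cols N (insert (e + 1, q) (T.erase (e + 1, r))) (e + 1) =
      insert q ((cols N T (e + 1)).erase r) := by
    ext p
    rw [mem_cols hc, Finset.mem_insert, Finset.mem_insert, Finset.mem_erase, Finset.mem_erase,
      mem_cols hc]
    simp
  have hrD : r ∈ cols N T (e + 1) := (mem_cols hc).2 hr
  have hqD : q ∉ cols N T (e + 1) := fun h' => hq ((mem_cols hc).1 h')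
  refine ⟨?_, fun x hx => ?_, fun d hd => ?_⟩
  · obtain ⟨L, hL⟩ := h.good
    rcases Nat.lt_or_ge n (e + 1) with hn | hn
    · exact ⟨L, hL.path.congr (fun d hd => hother d (by omega)) fun _ _ _ _ => rfl,
        fun d h1 h2 m => by rw [hother d (by omega)]; exact hL.bound d h1 h2 m⟩
    · exact hL.exists_of_kohnert hn hrD hqr hqD
        (fun p h1 h2 => (mem_cols hc).2 (hfull p h1 h2))
        (fun h' => hright (e + 2) (by omega) ((mem_cols (by omega)).1 h')) hself hother
  · rw [Finset.mem_insert, Finset.mem_erase] at hx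
    rcases hx with rfl | hx
    · exact ⟨hc, hq1⟩
    · exact h.pos x hx.2
  · by_cases hde : d = e + 1
    · subst hde
      rw [hself, Finset.card_insert_of_notMem fun h' => hqD (Finset.mem_of_mem_erase h'),
        Finset.card_erase_add_one hrD, h.card _ hd]
    · rw [hother d hde, h.card d hd]

theorem admissible_compDiagram {N n : ℕ} {β : Comp} (h0 : β 0 = 0)
    (hbN : ∀ j, N < j → β j = 0) : AdmissibleFor N n β (compDiagram β) := by
  have hmem : ∀ c p, (c, p) ∈ compDiagram β ↔ 1 ≤ c ∧ c ≤ β p := by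
    intro c p
    simp only [compDiagram, Finset.mem_biUnion, Finsupp.mem_support_iff, Finset.mem_image,
      Finset.mem_Icc, Prod.mk.injEq]
    constructor
    · rintro ⟨r, -, c', h1, rfl, rfl⟩
      exact h1
    · rintro ⟨h1, h2⟩
      exact ⟨p, by omega, c, ⟨h1, h2⟩, rfl, rfl⟩
  have hcol : ∀ c, 1 ≤ c → cols N (compDiagram β) c = (Finset.Icc 1 N).filter fun j => c ≤ β j := by
    intro c hc
    ext p
    rw [mem_cols hc, hmem, Finset.mem_filter, Finset.mem_Icc]
    constructor
    · rintro ⟨-, h2⟩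
      refine ⟨⟨?_, ?_⟩, h2⟩
      · by_contra h
        obtain rfl : p = 0 := by omega
        omega
      · by_contra h
        have := hbN p (by omega)
        omega
    · exact fun h => ⟨hc, h.2⟩
  refine ⟨⟨fun _ p => p, ⟨fun _ _ => rfl, fun _ _ _ _ _ _ h => h, fun c _ p hp => ?_⟩,
    fun c hc _ m => ?_⟩, fun x hx => ?_, fun c hc => by rw [hcol c hc]; rfl⟩
  · refine ⟨p, ?_, le_rfl, rfl⟩
    rw [hcol _ (by omega)] at hp
    rcases Nat.eq_zero_or_pos c with rfl | hc
    · rw [cols_zero]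
      exact (Finset.mem_filter.1 hp).1
    · rw [hcol c hc]
      rw [Finset.mem_filter] at hp ⊢
      exact ⟨hp.1, by omega⟩
  · rw [hcol c hc]
    apply Finset.card_le_card
    intro p
    simp only [Finset.mem_filter, Finset.mem_Icc]
    rintro ⟨⟨h1, h2⟩, h3⟩
    refine ⟨⟨⟨h1, ?_⟩, h3⟩, Nat.zero_le _, h2⟩
    by_contra h
    have := hbN p (by omega)
    omega
  · have h1 := (hmem x.1 x.2).1 hx
    refine ⟨h1.1, ?_⟩
    by_contra h
    have h2 : x.2 = 0 := by omega
    rw [h2] at h1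
    omega

theorem admissible_of_mem_KD {N n : ℕ} {β : Comp} (h0 : β 0 = 0) (hbN : ∀ j, N < j → β j = 0)
    {T : Diagram} (hT : T ∈ KD β) : AdmissibleFor N n β T := by
  induction hT with
  | refl => exact admissible_compDiagram h0 hbN
  | tail _ hs ih => exact ih.kohnertMove hs

/-- The insertion into a Kohnert diagram is a run that starts in the empty column
`max β + 1`. -/
theorem run_insertion {N k : ℕ} {β : Comp} (h0 : β 0 = 0) (hbN : ∀ j, N < j → β j = 0)
    (hkN : k ≤ N) {T : Diagram} (hT : T ∈ KD β) {r : ℕ} (hr : 1 ≤ r) (hrk : r ≤ k) :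
    IsState N (β.support.sup β + 1) (partCount β) (fun c => partCount β c N) T
      (β.support.sup β + 1, r) ∧
    Run N (β.support.sup β + 1) (partCount β) k T (β.support.sup β + 1, r) (insertion β k T r) := by
  have hn : partCount β (β.support.sup β + 1) N = 0 := partCount_eq_zero_of_lt (Nat.lt_succ_self _) N
  have hn1 : 1 ≤ β.support.sup β + 1 := by omega
  have hadm : AdmissibleFor N (β.support.sup β + 1) β T := admissible_of_mem_KD h0 hbN hT
  obtain ⟨h1, h2⟩ := hadm.threadWeight hn1 hn hbN
  obtain ⟨k1, k2, k3⟩ := insertionLabel_spec h0 hbN h1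
  have htop : IsTop N β T (insertionLabel β T) := by
    refine ⟨k1, fun j => ?_, fun γ hγ hs => k3 γ hγ fun j => (hs j).trans (k2 j)⟩
    rw [h2, ne_eq, ne_eq, k2]
  have hstate : IsState N (β.support.sup β + 1) (partCount β) (fun c => partCount β c N) T
      (β.support.sup β + 1, r) := by
    refine ⟨hadm, fun h => ?_, hn1, le_rfl, hr⟩
    have h3 := (mem_cols (N := N) hn1).2 h
    rw [hadm.cols_eq_empty hn hn1 le_rfl] at h3
    simp at h3
  exact ⟨hstate, htop.run h0 hbN hkN hn1 hn hstate hrk⟩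

end Kohnert

theorem theorem3p8 (β : Kohnert.Comp) (hβ : β 0 = 0) (k : ℕ)
    (S T : Kohnert.Diagram) (hS : S ∈ Kohnert.KD β) (hT : T ∈ Kohnert.KD β)
    (s t : ℕ) (hs : 1 ≤ s) (hsk : s ≤ k) (ht : 1 ≤ t) (htk : t ≤ k)
    (h : Kohnert.insertion β k S s = Kohnert.insertion β k T t) :
    S = T ∧ s = t := by
  obtain ⟨N, hbN, hkN⟩ : ∃ N, (∀ j, N < j → β j = 0) ∧ k ≤ N := by
    refine ⟨max (β.support.sup id) k, fun j hj => ?_, le_max_right _ _⟩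
    by_contra hcon
    have := Finset.le_sup (f := id) (Finsupp.mem_support_iff.2 hcon)
    simp only [id] at this
    omega
  obtain ⟨h1, h2⟩ := Kohnert.run_insertion hβ hbN hkN hS hs hsk
  obtain ⟨h3, h4⟩ := Kohnert.run_insertion hβ hbN hkN hT ht htk
  rw [← h] at h4
  obtain ⟨h5, h6⟩ := Kohnert.Run.start_eq
    (s := fun c => Kohnert.partCount β c N)
    (Kohnert.partCount_eq_zero_of_lt (Nat.lt_succ_self _) N) h1 h3 rfl rfl h2 h4
  exact ⟨h5, congrArg Prod.snd h6⟩
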